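/- Let $d\geq 1$, and let $\mathbb{L}^d=(\mathbb{Z}^d,\mathbb{E}^d)$ be the hypercubic lattice, whose edges are the unordered pairs $[x,y]$ of points of $\mathbb{Z}^d$ at Euclidean distance $1$. For $p\in(0,1)$ let $\mathbb{P}$ be the product measure on $\Omega=\{0,1\}^{\mathbb{E}^d}$ under which the coordinates $\omega_{[x,y]}$ are independent and equal to $1$ with probability $p$, and let $\mathcal{G}^{(\omega)}$ be the graph on $\mathbb{Z}^d$ with edge set $\{[x,y]\in\mathbb{E}^d:\omega_{[x,y]}=1\}$. On the complex Hilbert space $\ell^2(\mathbb{Z}^d)$ let $D^{(\omega)}$ be multiplication by the vertex degree of $\mathcal{G}^{(\omega)}$, let $(A^{(\omega)}\varphi)(x)=\sum_{y:\,\omega_{[x,y]}=1}\varphi(y)$, and put $$\Delta_{\mathrm N}^{(\omega)}=D^{(\omega)}-A^{(\omega)},\qquad \Delta_{\widetilde{\mathrm D}}^{(\omega)}=(2d-D^{(\omega)})+\Delta_{\mathrm N}^{(\omega)},\qquad \Delta_{\mathrm D}^{(\omega)}=2(2d-D^{(\omega)})+\Delta_{\mathrm N}^{(\omega)}.$$ Let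 $p_c=\sup\{q\in[0,1]:$ for bond probability $q$ the cluster of the origin is almost surely finite$\}$ be the critical probability. For a bounded self-adjoint operator $B$ on a Hilbert space $H$ and $\varphi\in H$, let $\mu_\varphi$ be the spectral measure, $\int f\,d\mu_\varphi=\langle\varphi,f(B)\varphi\rangle$; for $\varkappa\in\{\mathrm{pp},\mathrm{sc},\mathrm{ac}\}$ let $H_\varkappa$ be the closed $B$-invariant subspace of those $\varphi$ for which $\mu_\varphi$ is pure point, singular continuous, or absolutely continuous, respectively, and let $\mathrm{spec}_\varkappa(B)$ be the spectrum of $B$ restricted to $H_\varkappa$. Fix $\mathrm X\in\{\mathrm N,\widetilde{\mathrm D},\mathrm D\}$ and $p\in(0,1)$. Then: 1. $\omega\mapsto\Delta_{\mathrm X}^{(\omega)}$ is an ergodic random operator with respect to $\mathbb{Z}^d$-translations: every $\Delta_{\mathrm X}^{(\omega)}$ is bounded and self-adjoint; $\omega\mapsto\langle\varphi,\Delta_{\mathrm X}^{(\omega)}\psi\rangle$ is measurable for all $\varphi,\psi$; the translations $\tau_z\omega=(\omega_{[x+z,y+z]})_{[x,y]}$, $z\in\mathbb{Z}^d$, form a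 $\mathbb{P}$-preserving ergodic group action on $\Omega$; and $\Delta_{\mathrm X}^{(\tau_z\omega)}=T_z^{-1}\Delta_{\mathrm X}^{(\omega)}T_z$ for all $z$ and $\omega$, where $(T_z\varphi)(x)=\varphi(x-z)$. 2. $\mathrm{spec}(\Delta_{\mathrm X}^{(\omega)})=[0,4d]$ for $\mathbb{P}$-almost every $\omega$. 3. For every $\varkappa\in\{\mathrm{pp},\mathrm{sc},\mathrm{ac}\}$ there is a closed (non-random, possibly empty) set $\Sigma_{\mathrm X}^{(\varkappa)}\subset\mathbb{R}$ such that $\mathrm{spec}_\varkappa(\Delta_{\mathrm X}^{(\omega)})=\Sigma_{\mathrm X}^{(\varkappa)}$ for $\mathbb{P}$-almost every $\omega$. 4. If $p<p_c$, then there is a (non-random) set $S\subset\mathbb{R}$ that is dense in $[0,4d]$, i.e. $\overline{S}=[0,4d]$, such that for $\mathbb{P}$-almost every $\omega$ the spectrum of $\Delta_{\mathrm X}^{(\omega)}$ is only pure point, i.e. $H_{\mathrm{pp}}=\ell^2(\mathbb{Z}^d)$, $\mathrm{spec}_{\mathrm{pp}}(\Delta_{\mathrm X}^{(\omega)})=[0,4d]$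 and $\mathrm{spec}_{\mathrm{sc}}(\Delta_{\mathrm X}^{(\omega)})=\mathrm{spec}_{\mathrm{ac}}(\Delta_{\mathrm X}^{(\omega)})=\varnothing$; the set of eigenvalues of $\Delta_{\mathrm X}^{(\omega)}$ is exactly $S$; and every eigenvalue has an infinite-dimensional eigenspace. -/

import Mathlib

open MeasureTheory
open scoped CompactlySupported ENNReal InnerProductSpace unitInterval

noncomputable section
namespace PercLap

section Spectral
variable {H : Type*} [NormedAddCommGroup H] [InnerProductSpace ℂ H] [CompleteSpace H]

/-- The positive linear functional `f ↦ ⟨φ, f(A) φ⟩` on compactly supported continuous functions,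
with `f(A)` given by the continuous functional calculus. -/
def spectralFunctional (A : H →L[ℂ] H) (φ : H) : C_c(ℝ, ℝ) →ₚ[ℝ] ℝ :=
  PositiveLinearMap.mk₀
    { toFun := fun f => (⟪φ, cfc (f : ℝ → ℝ) A φ⟫_ℂ).re
      map_add' := fun f g => by
        have h := cfc_add (R := ℝ) A (f : ℝ → ℝ) (g : ℝ → ℝ) f.continuous.continuousOn
          g.continuous.continuousOn
        have h' : (⇑(f + g) : ℝ → ℝ) = fun x => f x + g x := rfl
        rw [h', h, add_apply, inner_add_right, Complex.add_re]
      map_smul' := fun c f => by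
        have h := cfc_const_mul (R := ℝ) c (f : ℝ → ℝ) A f.continuous.continuousOn
        have h' : (⇑(c • f) : ℝ → ℝ) = fun x => c * f x := rfl
        rw [h', h, ← algebraMap_smul ℂ c (cfc (f : ℝ → ℝ) A), smul_apply,
          inner_smul_right]
        simp }
    (fun f hf => by
      have h : (0 : H →L[ℂ] H) ≤ cfc (f : ℝ → ℝ) A := cfc_nonneg fun x _ => hf x
      exact (ContinuousLinearMap.nonneg_iff_isPositive _ |>.1 h).re_inner_nonneg_right φ)

/-- The spectral measure `μ_φ` of the vector `φ` with respect to a bounded self-adjoint operator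
`A`: the unique regular Borel measure on `ℝ` with `∫ f dμ_φ = ⟨φ, f(A) φ⟩` for all continuous
compactly supported `f`. -/
def spectralMeasure (A : H →L[ℂ] H) (φ : H) : Measure ℝ :=
  RealRMK.rieszMeasure (spectralFunctional A φ)

instance (A : H →L[ℂ] H) (φ : H) : (spectralMeasure A φ).Regular :=
  RealRMK.regular_rieszMeasure _

theorem integral_spectralMeasure (A : H →L[ℂ] H) (φ : H) (f : C_c(ℝ, ℝ)) :
    ∫ x, f x ∂(spectralMeasure A φ) = (⟪φ, cfc (f : ℝ → ℝ) A φ⟫_ℂ).re :=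
  RealRMK.integral_rieszMeasure (spectralFunctional A φ) f

theorem integrable_Cc (μ : Measure ℝ) [IsLocallyFiniteMeasure μ] (f : C_c(ℝ, ℝ)) :
    Integrable (f : ℝ → ℝ) μ :=
  f.continuous.integrable_of_hasCompactSupport f.hasCompactSupport

theorem spectralMeasure_zero (A : H →L[ℂ] H) : spectralMeasure A 0 = 0 := by
  refine Measure.ext_of_integral_eq_on_compactlySupported fun f => ?_
  simp [integral_spectralMeasure]

theorem isLocallyFiniteMeasure_add (μ ν : Measure ℝ) [IsLocallyFiniteMeasure μ]
    [IsLocallyFiniteMeasure ν] : IsLocallyFiniteMeasure (μ + ν) := by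
  refine ⟨fun x => ?_⟩
  obtain ⟨s, hs, hμ⟩ := μ.finiteAt_nhds x
  obtain ⟨t, ht, hν⟩ := ν.finiteAt_nhds x
  refine ⟨s ∩ t, Filter.inter_mem hs ht, ?_⟩
  rw [Measure.add_apply, ENNReal.add_lt_top]
  exact ⟨(measure_mono Set.inter_subset_left).trans_lt hμ,
    (measure_mono Set.inter_subset_right).trans_lt hν⟩

theorem spectralMeasure_parallelogram (A : H →L[ℂ] H) (φ ψ : H) :
    spectralMeasure A (φ + ψ) + spectralMeasure A (φ - ψ) =
      (spectralMeasure A φ + spectralMeasure A φ) +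
        (spectralMeasure A ψ + spectralMeasure A ψ) := by
  have := isLocallyFiniteMeasure_add (spectralMeasure A (φ + ψ)) (spectralMeasure A (φ - ψ))
  have := isLocallyFiniteMeasure_add (spectralMeasure A φ) (spectralMeasure A φ)
  have := isLocallyFiniteMeasure_add (spectralMeasure A ψ) (spectralMeasure A ψ)
  have := isLocallyFiniteMeasure_add (spectralMeasure A φ + spectralMeasure A φ)
    (spectralMeasure A ψ + spectralMeasure A ψ)
  refine Measure.ext_of_integral_eq_on_compactlySupported fun f => ?_
  simp only [integral_add_measure, integrable_Cc, integral_spectralMeasure, map_add, map_sub,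
    inner_add_left, inner_add_right, inner_sub_left, inner_sub_right, Complex.add_re,
    Complex.sub_re]
  ring

theorem spectralMeasure_smul (A : H →L[ℂ] H) (c : ℂ) (φ : H) :
    spectralMeasure A (c • φ) = (Real.toNNReal (‖c‖ ^ 2)) • spectralMeasure A φ := by
  refine Measure.ext_of_integral_eq_on_compactlySupported fun f => ?_
  rw [integral_smul_nnreal_measure, integral_spectralMeasure, integral_spectralMeasure, map_smul,
    inner_smul_left, inner_smul_right, ← mul_assoc, mul_comm ((starRingEnd ℂ) c), Complex.mul_conj,
    Complex.normSq_eq_norm_sq, Complex.re_ofReal_mul, NNReal.smul_def,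
    Real.coe_toNNReal _ (by positivity), smul_eq_mul]

theorem spectralMeasure_of_not_isSelfAdjoint {A : H →L[ℂ] H} (hA : ¬ IsSelfAdjoint A) (φ : H) :
    spectralMeasure A φ = 0 := by
  refine Measure.ext_of_integral_eq_on_compactlySupported fun f => ?_
  rw [integral_spectralMeasure, cfc_apply_of_not_predicate A hA]
  simp

theorem spectralMeasure_apply_self {A : H →L[ℂ] H} (hA : IsSelfAdjoint A) (φ : H) :
    spectralMeasure A (A φ) =
      (spectralMeasure A φ).withDensity fun x => ENNReal.ofReal (x ^ 2) := by
  have : IsLocallyFiniteMeasure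
      ((spectralMeasure A φ).withDensity fun x => ENNReal.ofReal (x ^ 2)) :=
    IsLocallyFiniteMeasure.withDensity_ofReal (by fun_prop)
  refine Measure.ext_of_integral_eq_on_compactlySupported fun f => ?_
  let g : C_c(ℝ, ℝ) := ⟨⟨fun x => x * (f x * x), by fun_prop⟩, by
    exact (f.hasCompactSupport.mul_right (f' := fun x => x)).mul_left (f := fun x => x)⟩
  have hg : (g : ℝ → ℝ) = fun x => x * (f x * x) := rfl
  have hc : ContinuousOn (f : ℝ → ℝ) (spectrum ℝ A) := f.continuous.continuousOn
  have h1 : cfc (g : ℝ → ℝ) A = A * (cfc (f : ℝ → ℝ) A * A) := by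
    rw [hg, cfc_mul (fun x : ℝ => x) (fun x => f x * x) A,
      cfc_mul (f : ℝ → ℝ) (fun x => x) A, cfc_id' ℝ A]
  rw [integral_spectralMeasure, integral_withDensity_eq_integral_toReal_smul (by fun_prop)
    (by simp)]
  have h2 : ∫ x, (ENNReal.ofReal (x ^ 2)).toReal • f x ∂(spectralMeasure A φ) =
      ∫ x, g x ∂(spectralMeasure A φ) := by
    refine integral_congr_ae (.of_forall fun x => ?_)
    simp only [hg, ENNReal.toReal_ofReal (sq_nonneg x), smul_eq_mul]
    ring
  rw [h2, integral_spectralMeasure, h1]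
  simp only [mul_apply_eq_comp]
  rw [← ContinuousLinearMap.adjoint_inner_left A, ← ContinuousLinearMap.star_eq_adjoint, hA.star_eq]

/-- The three types in the Lebesgue decomposition: pure point, singular continuous and
absolutely continuous. -/
inductive SpectralType
  | pp
  | sc
  | ac

/-- A Borel measure on `ℝ` is of pure point, singular continuous or absolutely continuous type. -/
def SpectralType.Holds : SpectralType → Measure ℝ → Prop
  | .pp, μ => ∃ S : Set ℝ, S.Countable ∧ μ Sᶜ = 0
  | .sc, μ => (∀ x, μ {x} = 0) ∧ Measure.MutuallySingular μ volume
  | .ac, μ => Measure.AbsolutelyContinuous μ volume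

theorem SpectralType.holds_zero (κ : SpectralType) : κ.Holds 0 := by
  cases κ
  · exact ⟨∅, by simp, by simp⟩
  · exact ⟨by simp, Measure.MutuallySingular.zero_left⟩
  · exact Measure.AbsolutelyContinuous.zero _

theorem SpectralType.Holds.mono {κ : SpectralType} {μ ν : Measure ℝ} (h : κ.Holds μ)
    (hν : ν ≪ μ) : κ.Holds ν := by
  cases κ
  · obtain ⟨S, hS, h0⟩ := h
    exact ⟨S, hS, hν h0⟩
  · exact ⟨fun x => hν (h.1 x), h.2.mono_ac hν .rfl⟩
  · exact hν.trans h

theorem SpectralType.Holds.add {κ : SpectralType} {μ ν : Measure ℝ} (h : κ.Holds μ)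
    (h' : κ.Holds ν) : κ.Holds (μ + ν) := by
  cases κ
  · obtain ⟨S, hS, h0⟩ := h
    obtain ⟨T, hT, h1⟩ := h'
    refine ⟨S ∪ T, hS.union hT, ?_⟩
    rw [Measure.add_apply, measure_mono_null (by simp) h0, measure_mono_null (by simp) h1,
      add_zero]
  · exact ⟨fun x => by simp [h.1 x, h'.1 x], h.2.add_left h'.2⟩
  · exact Measure.AbsolutelyContinuous.add_left h h'

/-- The spectral subspace `H_κ`: all vectors whose spectral measure is purely of type `κ`. -/
def spectralSubspace (A : H →L[ℂ] H) (κ : SpectralType) : Submodule ℂ H where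
  carrier := {φ | κ.Holds (spectralMeasure A φ)}
  zero_mem' := by
    rw [Set.mem_ofPred_eq, spectralMeasure_zero]
    exact κ.holds_zero
  add_mem' := fun {φ ψ} hφ hψ =>
    ((hφ.add hφ).add (hψ.add hψ)).mono <| by
      rw [← spectralMeasure_parallelogram]
      exact Measure.AbsolutelyContinuous.rfl.add_right _
  smul_mem' := fun c φ hφ => by
    rw [Set.mem_ofPred_eq, spectralMeasure_smul]
    exact SpectralType.Holds.mono hφ (Measure.smul_absolutelyContinuous)

theorem mapsTo_spectralSubspace (A : H →L[ℂ] H) (κ : SpectralType) :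
    Set.MapsTo A (spectralSubspace A κ) (spectralSubspace A κ) := by
  intro φ hφ
  change κ.Holds (spectralMeasure A (A φ))
  by_cases hA : IsSelfAdjoint A
  · rw [spectralMeasure_apply_self hA]
    exact SpectralType.Holds.mono hφ (withDensity_absolutelyContinuous _ _)
  · rw [spectralMeasure_of_not_isSelfAdjoint hA]
    exact κ.holds_zero

/-- The component `spec_κ(A)` of the spectrum: the spectrum of the restriction of `A` to the
spectral subspace `H_κ`. -/
def spectralComponent (A : H →L[ℂ] H) (κ : SpectralType) : Set ℂ :=
  spectrum ℂ (A.restrict (mapsTo_spectralSubspace A κ))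

end Spectral

section Lattice

/-- The vertex set `ℤ^d`. -/
abbrev Vertex (d : ℕ) : Type := Fin d → ℤ

/-- The hypercubic lattice: vertices are adjacent iff they have Euclidean distance one. -/
def lattice (d : ℕ) : SimpleGraph (Vertex d) where
  Adj x y := ∑ i, (x i - y i) ^ 2 = 1
  symm := ⟨fun x y h => by
    rw [← h]
    exact Finset.sum_congr rfl fun i _ => by ring⟩
  loopless := ⟨fun x h => by simp at h⟩

/-- The edges of the lattice, as unordered pairs of nearest neighbours. -/
abbrev Edge (d : ℕ) : Type := (lattice d).edgeSet

/-- The nearest neighbours of the origin. -/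
def unitVectors (d : ℕ) : Set (Vertex d) := {u | ∑ i, u i ^ 2 = 1}

theorem finite_unitVectors (d : ℕ) : (unitVectors d).Finite := by
  refine (Set.finite_Icc (-1 : Vertex d) 1).subset fun u hu => ?_
  have h : ∀ i, u i ^ 2 ≤ 1 := fun i => by
    rw [← (show ∑ i, u i ^ 2 = 1 from hu)]
    exact Finset.single_le_sum (f := fun i => u i ^ 2) (fun j _ => sq_nonneg _)
      (Finset.mem_univ i)
  exact ⟨fun i => (abs_le.1 ((sq_le_one_iff_abs_le_one _).1 (h i))).1,
    fun i => (abs_le.1 ((sq_le_one_iff_abs_le_one _).1 (h i))).2⟩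

theorem lattice_adj_iff {d : ℕ} (x y : Vertex d) :
    (lattice d).Adj x y ↔ y - x ∈ unitVectors d := by
  change ∑ i, (x i - y i) ^ 2 = 1 ↔ ∑ i, (y i - x i) ^ 2 = 1
  rw [Finset.sum_congr rfl fun i _ => show (x i - y i) ^ 2 = (y i - x i) ^ 2 by ring]

theorem finite_neighborSet {d : ℕ} {G : SimpleGraph (Vertex d)} (hG : G ≤ lattice d)
    (x : Vertex d) : (G.neighborSet x).Finite := by
  refine ((finite_unitVectors d).image (x + ·)).subset fun y hy => ?_
  exact ⟨y - x, (lattice_adj_iff x y).1 (hG hy), by simp⟩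

/-- The finite set of neighbours of `x` in a subgraph `G` of the lattice. -/
def neighbors {d : ℕ} {G : SimpleGraph (Vertex d)} (hG : G ≤ lattice d) (x : Vertex d) :
    Finset (Vertex d) :=
  (finite_neighborSet hG x).toFinset

theorem mem_neighbors {d : ℕ} {G : SimpleGraph (Vertex d)} (hG : G ≤ lattice d)
    (x y : Vertex d) : y ∈ neighbors hG x ↔ G.Adj x y := by
  simp [neighbors]

/-- The vertex degree of `x` in a subgraph `G` of the lattice. -/
def vertexDegree {d : ℕ} {G : SimpleGraph (Vertex d)} (hG : G ≤ lattice d) (x : Vertex d) : ℕ :=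
  (neighbors hG x).card

theorem vertexDegree_le {d : ℕ} {G : SimpleGraph (Vertex d)} (hG : G ≤ lattice d)
    (x : Vertex d) : vertexDegree hG x ≤ (finite_unitVectors d).toFinset.card := by
  refine Finset.card_le_card_of_injOn (fun y => y - x) (fun y hy => ?_)
    (fun y _ z _ h => sub_left_injective h)
  have h : G.Adj x y := (mem_neighbors hG x y).1 hy
  simpa using (lattice_adj_iff x y).1 (hG h)

/-- The Hilbert space `ℓ²(ℤ^d)` of complex-valued square-summable sequences. -/
abbrev L2 (d : ℕ) : Type := lp (fun _ : Vertex d => ℂ) 2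

theorem memLp_two_iff {ι : Type*} (f : ι → ℂ) :
    Memℓp f 2 ↔ Summable fun x => ‖f x‖ ^ 2 := by
  rw [memℓp_gen_iff (by simp)]
  simp

theorem norm_sq_eq_tsum {d : ℕ} (φ : L2 d) : ‖φ‖ ^ 2 = ∑' x, ‖φ x‖ ^ 2 := by
  have h := lp.norm_rpow_eq_tsum (p := 2) (by simp) φ
  simpa using h

/-- Multiplication by a bounded function on `ℓ²(ℤ^d)`. -/
def mulOp {d : ℕ} (f : Vertex d → ℂ) (C : ℝ) (hf : ∀ x, ‖f x‖ ≤ C) : L2 d →L[ℂ] L2 d :=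
  have key : ∀ (φ : L2 d) (x : Vertex d), ‖f x * φ x‖ ^ 2 ≤ C ^ 2 * ‖φ x‖ ^ 2 := fun φ x => by
    rw [norm_mul, mul_pow]
    gcongr
    exact hf x
  have hs : ∀ φ : L2 d, Summable fun x => C ^ 2 * ‖φ x‖ ^ 2 := fun φ =>
    ((memLp_two_iff _).1 φ.2).mul_left _
  have hm : ∀ φ : L2 d, Memℓp (fun x => f x * φ x) 2 := fun φ =>
    (memLp_two_iff _).2 ((hs φ).of_nonneg_of_le (fun x => by positivity) (key φ))
  LinearMap.mkContinuous
    { toFun := fun φ => ⟨fun x => f x * φ x, hm φ⟩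
      map_add' := fun φ ψ => by
        ext x
        exact mul_add _ _ _
      map_smul' := fun c φ => by
        ext x
        exact mul_left_comm _ _ _ }
    C
    (fun φ => by
      have hC : 0 ≤ C := (norm_nonneg _).trans (hf 0)
      refine le_of_sq_le_sq ?_ (by positivity)
      rw [mul_pow, norm_sq_eq_tsum, norm_sq_eq_tsum, ← tsum_mul_left]
      exact ((memLp_two_iff _).1 (hm φ)).tsum_le_tsum (key φ) (hs φ))

theorem mulOp_apply {d : ℕ} (f : Vertex d → ℂ) (C : ℝ) (hf : ∀ x, ‖f x‖ ≤ C) (φ : L2 d)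
    (x : Vertex d) : mulOp f C hf φ x = f x * φ x := rfl

theorem memLp_translate {d : ℕ} (z : Vertex d) (φ : L2 d) :
    Memℓp (fun x => φ (x - z)) 2 :=
  (memLp_two_iff _).2 ((Equiv.subRight z).summable_iff.2 ((memLp_two_iff _).1 φ.2))

/-- The unitary translation operator `(T_z φ)(x) = φ(x - z)` on `ℓ²(ℤ^d)`. -/
def translation {d : ℕ} (z : Vertex d) : L2 d ≃ₗᵢ[ℂ] L2 d where
  toFun φ := ⟨fun x => φ (x - z), memLp_translate z φ⟩
  invFun φ := ⟨fun x => φ (x - -z), memLp_translate (-z) φ⟩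
  map_add' φ ψ := rfl
  map_smul' c φ := rfl
  left_inv φ := by
    ext x
    exact congrArg φ (by simp)
  right_inv φ := by
    ext x
    exact congrArg φ (by simp)
  norm_map' φ := by
    refine (sq_eq_sq₀ (norm_nonneg _) (norm_nonneg _)).1 ?_
    rw [norm_sq_eq_tsum, norm_sq_eq_tsum]
    exact (Equiv.subRight z).tsum_eq fun x => ‖φ x‖ ^ 2

theorem translation_apply {d : ℕ} (z : Vertex d) (φ : L2 d) (x : Vertex d) :
    translation z φ x = φ (x - z) := rfl

/-- The degree operator `[D(G)φ](x) = d_G(x) φ(x)`. -/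
def degreeOp {d : ℕ} {G : SimpleGraph (Vertex d)} (hG : G ≤ lattice d) : L2 d →L[ℂ] L2 d :=
  mulOp (fun x => (vertexDegree hG x : ℂ)) ((finite_unitVectors d).toFinset.card : ℝ) fun x => by
    rw [Complex.norm_natCast]
    exact_mod_cast vertexDegree_le hG x

theorem degreeOp_apply {d : ℕ} {G : SimpleGraph (Vertex d)} (hG : G ≤ lattice d) (φ : L2 d)
    (x : Vertex d) : degreeOp hG φ x = vertexDegree hG x * φ x := rfl

/-- The bounded operator underlying the adjacency operator, written as a finite sum of cut-off
translations. -/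
def hoppingOp {d : ℕ} (G : SimpleGraph (Vertex d)) : L2 d →L[ℂ] L2 d :=
  ∑ u ∈ (finite_unitVectors d).toFinset,
    (mulOp (fun x => open Classical in if G.Adj x (x + u) then 1 else 0) 1
      fun x => by split_ifs <;> simp) ∘L
      ((translation (-u)).toContinuousLinearEquiv : L2 d →L[ℂ] L2 d)

theorem hoppingOp_apply {d : ℕ} {G : SimpleGraph (Vertex d)} (hG : G ≤ lattice d) (φ : L2 d)
    (x : Vertex d) : hoppingOp G φ x = ∑ y ∈ neighbors hG x, φ y := by
  classical
  have h1 : hoppingOp G φ x = ∑ u ∈ (finite_unitVectors d).toFinset,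
      (if G.Adj x (x + u) then (1 : ℂ) else 0) * φ (x - -u) := by
    rw [hoppingOp, sum_apply, lp.coeFn_sum, Finset.sum_apply]
    refine Finset.sum_congr rfl fun u _ => ?_
    change (ite _ _ _ : ℂ) * φ (x - -u) = _
    congr
  have h2 : ∀ u, (if G.Adj x (x + u) then (1 : ℂ) else 0) * φ (x - -u) =
      if G.Adj x (x + u) then φ (x + u) else 0 := fun u => by
    rw [sub_neg_eq_add]
    split_ifs <;> simp
  rw [h1, Finset.sum_congr rfl fun u _ => h2 u, ← Finset.sum_filter]
  refine Finset.sum_bij' (fun u _ => x + u) (fun y _ => y - x) ?_ ?_ ?_ ?_ ?_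
  · intro u hu
    exact (mem_neighbors hG x _).2 (Finset.mem_filter.1 hu).2
  · intro y hy
    have h := (mem_neighbors hG x y).1 hy
    refine Finset.mem_filter.2 ⟨?_, by simpa using h⟩
    simpa using (lattice_adj_iff x y).1 (hG h)
  · intro u _
    simp
  · intro y _
    simp
  · intro u _
    rfl

/-- The adjacency operator `[A(G)φ](x) = ∑_{y : [x,y] ∈ E} φ(y)`. -/
def adjacencyOp {d : ℕ} {G : SimpleGraph (Vertex d)} (hG : G ≤ lattice d) :
    L2 d →L[ℂ] L2 d where
  toFun φ := ⟨fun x => ∑ y ∈ neighbors hG x, φ y, by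
    rw [show (fun x => ∑ y ∈ neighbors hG x, φ y) = hoppingOp G φ from
      funext fun x => (hoppingOp_apply hG φ x).symm]
    exact (hoppingOp G φ).2⟩
  map_add' φ ψ := by
    ext x
    exact Finset.sum_add_distrib
  map_smul' c φ := by
    ext x
    exact (Finset.mul_sum _ _ _).symm
  cont := by
    refine (hoppingOp G).continuous.congr fun φ => ?_
    ext x
    exact hoppingOp_apply hG φ x

theorem adjacencyOp_apply {d : ℕ} {G : SimpleGraph (Vertex d)} (hG : G ≤ lattice d) (φ : L2 d)
    (x : Vertex d) : adjacencyOp hG φ x = ∑ y ∈ neighbors hG x, φ y := rfl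

/-- The three boundary conditions: Neumann, Pseudo-Dirichlet and Dirichlet. -/
inductive BoundaryCondition
  | neumann
  | pseudoDirichlet
  | dirichlet

/-- The Laplacian `Δ_X(G)` on `ℓ²(ℤ^d)`: `Δ_N = D - A`, `Δ_D̃ = (2d - D) + Δ_N` and
`Δ_D = 2(2d - D) + Δ_N`. -/
def laplacian {d : ℕ} (X : BoundaryCondition) {G : SimpleGraph (Vertex d)} (hG : G ≤ lattice d) :
    L2 d →L[ℂ] L2 d :=
  match X with
  | .neumann => degreeOp hG - adjacencyOp hG
  | .pseudoDirichlet => ((2 * d : ℂ) • 1 - degreeOp hG) + (degreeOp hG - adjacencyOp hG)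
  | .dirichlet => (2 : ℂ) • ((2 * d : ℂ) • 1 - degreeOp hG) + (degreeOp hG - adjacencyOp hG)

end Lattice

section Percolation

/-- The configuration space `{0,1}^E` of bond percolation, with its product σ-algebra; `true`
means that the bond is present. -/
abbrev Config (d : ℕ) : Type := Edge d → Bool

/-- The product measure under which bonds are independently present with probability `p`. -/
def percMeasure (d : ℕ) (p : I) : Measure (Config d) :=
  Measure.infinitePi fun _ : Edge d => ProbabilityTheory.bernoulliMeasure true false p

/-- The bond-percolation graph `(ℤ^d, {e | ω e = 1})`. -/
def percGraph {d : ℕ} (ω : Config d) : SimpleGraph (Vertex d) where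
  Adj x y := ∃ h : (lattice d).Adj x y, ω ⟨s(x, y), h⟩ = true
  symm := ⟨fun x y ⟨h, hω⟩ => ⟨h.symm, by
    rw [← hω]
    exact congrArg ω (Subtype.ext Sym2.eq_swap)⟩⟩
  loopless := ⟨fun _ h => h.1.ne rfl⟩

theorem percGraph_le {d : ℕ} (ω : Config d) : percGraph ω ≤ lattice d := fun _ _ h => h.1

/-- The Laplacian on the bond-percolation graph. -/
def percLaplacian {d : ℕ} (X : BoundaryCondition) (ω : Config d) : L2 d →L[ℂ] L2 d :=
  laplacian X (percGraph_le ω)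

/-- The vertex set of the cluster containing `x`. -/
def clusterOf {d : ℕ} (ω : Config d) (x : Vertex d) : Set (Vertex d) :=
  {y | (percGraph ω).Reachable x y}

/-- The critical bond probability: the supremum of those `p` for which the cluster of the origin
is almost surely finite. -/
def criticalProb (d : ℕ) : ℝ :=
  sSup ((fun p : I => (p : ℝ)) '' {p | percMeasure d p {ω | (clusterOf ω 0).Infinite} = 0})

theorem lattice_adj_add {d : ℕ} {x y : Vertex d} (z : Vertex d) (h : (lattice d).Adj x y) :
    (lattice d).Adj (x + z) (y + z) := by
  rw [lattice_adj_iff] at h ⊢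
  simpa using h

/-- The translate `[x+z, y+z]` of the edge `[x,y]`. -/
def Edge.shift {d : ℕ} (z : Vertex d) (e : Edge d) : Edge d :=
  ⟨Sym2.map (· + z) e.1, by
    obtain ⟨e, he⟩ := e
    induction e with
    | _ x y => exact lattice_adj_add z he⟩

/-- The translations `τ_z ω = (ω_{[x+z,y+z]})_{[x,y]}` of the configuration space. -/
def Config.shift {d : ℕ} (z : Vertex d) (ω : Config d) : Config d := fun e => ω (e.shift z)

/-- A random operator `ω ↦ A ω` with values in the bounded self-adjoint operators on `H` is
ergodic with respect to the group `Γ`, acting by `τ` on the probability space and by the unitary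
operators `U` on `H`, if it is (weakly) measurable, if `τ` is a measure-preserving ergodic action,
and if `A (τ_z ω) = U_z⁻¹ (A ω) U_z` for all `z` and `ω`. -/
structure IsErgodicRandomOperator {Γ Ω H : Type*} [AddGroup Γ] [MeasurableSpace Ω]
    [NormedAddCommGroup H] [InnerProductSpace ℂ H] [CompleteSpace H] (P : Measure Ω)
    (τ : Γ → Ω → Ω) (U : Γ → H ≃ₗᵢ[ℂ] H) (A : Ω → H →L[ℂ] H) : Prop where
  isSelfAdjoint : ∀ ω, IsSelfAdjoint (A ω)
  measurable_inner : ∀ φ ψ : H, Measurable fun ω => ⟪φ, A ω ψ⟫_ℂ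
  shift_zero : ∀ ω, τ 0 ω = ω
  shift_add : ∀ z w ω, τ (z + w) ω = τ z (τ w ω)
  measurePreserving : ∀ z, MeasurePreserving (τ z) P P
  ergodic : ∀ s, MeasurableSet s → (∀ z, τ z ⁻¹' s = s) → P s = 0 ∨ P s = 1
  covariant : ∀ z ω φ, A (τ z ω) φ = (U z).symm (A ω (U z φ))

end Percolation

end PercLap

end

open PercLap

/-! Two facts drive the proof. The deterministic one is `norm_laplacian_sub_le`: on every subgraph
of the lattice the operator `Δ_X - 2d` has norm at most `2d`, which confines the spectrum to `[0,
4d]`. The probabilistic one is `ae_forall_infinite_agree`: almost surely every finite bond pattern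
occurs at infinitely many translates. A pattern has positive probability because `0 < p < 1`,
Poincaré recurrence makes it return, and ergodicity turns positive probability into probability one.
Since the Laplacian is local, a finitely supported vector can then be translated to infinitely many
places where the Laplacian of `ω` acts on it like that of any prescribed configuration `η`
(`ae_infinite_translation_intertwine`).

With `η` the full lattice and truncated plane waves as vectors, this yields approximate eigenvectors
at every energy in `[0, 4d]`, hence the almost sure spectrum. With `η` arbitrary and finitely
supported eigenvectors, it yields eigenspaces that contain infinitely many translates of one vector,
hence infinite multiplicity.

The spectral components are non-random because `E` lies in `spec_κ` iff every rational interval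
around `E` is charged by the spectral measure of some vector of `H_κ`; each such event is shift
invariant, so it has probability zero or one. The work lies in measurability:
`exists_mem_spectralSubspace_iff` replaces the uncountably many vectors by a countable basis, and
the Lebesgue decomposition of kernels makes the parts of the basis measures depend measurably on
`ω`. The tools are spectral projections, built as limits of the continuous functional calculus
(`exists_spectralProjection`), and the orthogonality of vectors with mutually singular spectral
measures.

Below `p_c` all clusters are finite, so the operator decomposes into finite blocks and is pure
point. The set `S` is `localizedEnergies`, whose definition involves no probability: an eigenvector
for `ω` can be cut off to one finite cluster, so eigenvalues belong to `S`, and transplantation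
gives the converse. Density holds because an energy gap without eigenvalues cannot carry pure point
spectrum. -/

open Filter Topology ProbabilityTheory

namespace PercLap

/-! ### Spectral measures, functional calculus and spectral projections. -/

section SpectralCalculus

variable {H : Type*} [NormedAddCommGroup H] [InnerProductSpace ℂ H] [CompleteSpace H]

/-- A bump function equal to one on a compact set off the spectrum and vanishing on the spectrum is
sent to `0` by the functional calculus, so its integral is `0`; inner regularity on open sets does
the rest. -/
theorem spectralMeasure_compl_spectrum (A : H →L[ℂ] H) (φ : H) :
    spectralMeasure A φ (spectrum ℝ A)ᶜ = 0 := by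
  have hc : IsClosed (spectrum ℝ A) := spectrum.isClosed A
  rw [hc.isOpen_compl.measure_eq_iSup_isCompact]
  simp only [ENNReal.iSup_eq_zero]
  intro K hK hKc
  obtain ⟨f, hf1, hf0, hfc, hf01⟩ := exists_continuous_one_zero_of_isCompact hKc hc
    (Set.disjoint_left.2 fun x hx => hK hx)
  let g : C_c(ℝ, ℝ) := ⟨f, hfc⟩
  have h0 : ∫ x, g x ∂(spectralMeasure A φ) = 0 := by
    rw [integral_spectralMeasure,
      cfc_congr (f := (g : ℝ → ℝ)) (g := fun _ => (0 : ℝ)) (fun x hx => hf0 hx)]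
    simp
  have hint := integrable_Cc (spectralMeasure A φ) g
  have h1 := (integral_eq_zero_iff_of_nonneg (fun x => (hf01 x).1) hint).1 h0
  refine measure_mono_null (fun x hx => ?_) h1
  change ¬ f x = 0
  simp [hf1 hx]

/-- The spectrum is compact and `cfc` only sees values on it. This extends the defining identity of
the spectral measure from compactly supported to all continuous functions. -/
theorem exists_Cc_eqOn_spectrum (A : H →L[ℂ] H) {f : ℝ → ℝ} (hf : Continuous f) :
    ∃ g : C_c(ℝ, ℝ), Set.EqOn f g (spectrum ℝ A) := by
  obtain ⟨b, hb1, -, hbc, -⟩ := exists_continuous_one_zero_of_isCompact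
    (ContinuousFunctionalCalculus.isCompact_spectrum (R := ℝ) A) isClosed_empty
    (Set.disjoint_empty _)
  refine ⟨⟨⟨fun x => f x * b x, by fun_prop⟩, hbc.mul_left⟩, fun x hx => ?_⟩
  change f x = f x * b x
  simp [hb1 hx]

theorem ae_mem_spectrum (A : H →L[ℂ] H) (φ : H) :
    ∀ᵐ x ∂(spectralMeasure A φ), x ∈ spectrum ℝ A :=
  mem_ae_iff.2 (spectralMeasure_compl_spectrum A φ)

theorem integrable_spectralMeasure (A : H →L[ℂ] H) (φ : H) {f : ℝ → ℝ} (hf : Continuous f) :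
    Integrable f (spectralMeasure A φ) := by
  obtain ⟨g, hg⟩ := exists_Cc_eqOn_spectrum A hf
  refine (integrable_Cc _ g).congr ?_
  filter_upwards [ae_mem_spectrum A φ] with x hx using (hg hx).symm

theorem integral_spectralMeasure_of_continuous (A : H →L[ℂ] H) (φ : H) {f : ℝ → ℝ}
    (hf : Continuous f) :
    ∫ x, f x ∂(spectralMeasure A φ) = (⟪φ, cfc f A φ⟫_ℂ).re := by
  obtain ⟨g, hg⟩ := exists_Cc_eqOn_spectrum A hf
  rw [cfc_congr hg, ← integral_spectralMeasure]
  refine integral_congr_ae ?_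
  filter_upwards [ae_mem_spectrum A φ] with x hx using hg hx

instance (A : H →L[ℂ] H) (φ : H) : IsFiniteMeasure (spectralMeasure A φ) :=
  (integrable_const_iff_isFiniteMeasure one_ne_zero).1
    (integrable_spectralMeasure A φ (continuous_const (y := (1 : ℝ))))

theorem inner_cfc_left (A : H →L[ℂ] H) (f : ℝ → ℝ) (φ ψ : H) :
    ⟪cfc f A φ, ψ⟫_ℂ = ⟪φ, cfc f A ψ⟫_ℂ := by
  have h : IsSelfAdjoint (cfc f A) := cfc_predicate f A
  rw [← ContinuousLinearMap.adjoint_inner_right, ← ContinuousLinearMap.star_eq_adjoint, h.star_eq]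

theorem norm_sq_cfc_apply (A : H →L[ℂ] H) (φ : H) {f : ℝ → ℝ} (hf : Continuous f) :
    ‖cfc f A φ‖ ^ 2 = ∫ x, f x ^ 2 ∂(spectralMeasure A φ) := by
  have h2 : cfc (fun x => f x ^ 2) A = cfc f A * cfc f A := by
    rw [← cfc_mul f f A hf.continuousOn hf.continuousOn]
    exact cfc_congr fun x _ => sq (f x)
  rw [integral_spectralMeasure_of_continuous A φ (show Continuous fun x => f x ^ 2 by fun_prop), h2,
    mul_apply_eq_comp, ← inner_cfc_left, inner_self_eq_norm_sq_to_K]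
  norm_cast

/-- Moving one factor `f(A)` across the inner product turns `⟨f(A)φ, g(A) f(A)φ⟩` into `⟨φ, (f g
f)(A) φ⟩`. Self-adjointness is not required, since otherwise `cfc` is `0` and both sides vanish. -/
theorem spectralMeasure_cfc_apply (A : H →L[ℂ] H) (φ : H) {f : ℝ → ℝ} (hf : Continuous f) :
    spectralMeasure A (cfc f A φ) =
      (spectralMeasure A φ).withDensity fun x => ENNReal.ofReal (f x ^ 2) := by
  have : IsLocallyFiniteMeasure
      ((spectralMeasure A φ).withDensity fun x => ENNReal.ofReal (f x ^ 2)) :=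
    IsLocallyFiniteMeasure.withDensity_ofReal (by fun_prop)
  refine Measure.ext_of_integral_eq_on_compactlySupported fun g => ?_
  have hg := g.continuous
  have h1 : cfc (fun x => f x * (g x * f x)) A =
      cfc f A * (cfc (g : ℝ → ℝ) A * cfc f A) := by
    rw [cfc_mul f (fun x => g x * f x) A hf.continuousOn (by fun_prop),
      cfc_mul (g : ℝ → ℝ) f A hg.continuousOn hf.continuousOn]
  rw [integral_spectralMeasure, integral_withDensity_eq_integral_toReal_smul (by fun_prop)
    (by simp), inner_cfc_left]
  have h3 := integral_spectralMeasure_of_continuous A φ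
    (show Continuous fun x => f x * (g x * f x) by fun_prop)
  rw [h1] at h3
  simp only [mul_apply_eq_comp] at h3
  rw [← h3]
  refine integral_congr_ae (.of_forall fun x => ?_)
  simp only [ENNReal.toReal_ofReal (sq_nonneg (f x)), smul_eq_mul]
  ring

variable {A : H →L[ℂ] H}

theorem cfc_one_apply (hA : IsSelfAdjoint A) (φ : H) : cfc (fun _ : ℝ => (1 : ℝ)) A φ = φ := by
  rw [cfc_const_one ℝ A]
  rfl

theorem norm_sq_eq_spectralMeasure (hA : IsSelfAdjoint A) (φ : H) :
    ‖φ‖ ^ 2 = (spectralMeasure A φ).real Set.univ := by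
  have h := norm_sq_cfc_apply A φ (continuous_const (y := (1 : ℝ)))
  rw [cfc_one_apply hA] at h
  simpa using h

theorem spectralMeasure_eq_zero_iff (hA : IsSelfAdjoint A) (φ : H) :
    spectralMeasure A φ = 0 ↔ φ = 0 := by
  refine ⟨fun h => ?_, fun h => h ▸ spectralMeasure_zero A⟩
  have := norm_sq_eq_spectralMeasure hA φ
  simpa [h] using this

theorem norm_sq_cfc_sub (A : H →L[ℂ] H) (φ : H) {f g : ℝ → ℝ} (hf : Continuous f)
    (hg : Continuous g) :
    ‖cfc f A φ - cfc g A φ‖ ^ 2 = ∫ x, (f x - g x) ^ 2 ∂(spectralMeasure A φ) := by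
  rw [← sub_apply, ← cfc_sub f g A hf.continuousOn hg.continuousOn]
  exact norm_sq_cfc_apply A φ (hf.sub hg)

theorem norm_ofReal_sub_sq (x : ℝ) (E : ℂ) : ‖(x : ℂ) - E‖ ^ 2 = (x - E.re) ^ 2 + E.im ^ 2 := by
  rw [← Complex.normSq_eq_norm_sq, Complex.normSq_apply]
  simp
  ring

/-- For real `x`, `|x - E|² = (x - E)(x - Ē)` is a polynomial with real coefficients. This is how a
complex energy `E` is handled by a functional calculus over `ℝ`. -/
theorem cfc_norm_sub_sq_apply (hA : IsSelfAdjoint A) (E : ℂ) (φ : H) :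
    cfc (fun x : ℝ => ‖(x : ℂ) - E‖ ^ 2) A φ =
      A (A φ - (starRingEnd ℂ E) • φ) - E • (A φ - (starRingEnd ℂ E) • φ) := by
  have key : ∀ (a b : ℝ), cfc (fun x : ℝ => x ^ 2 - a * x + b) A φ =
      A (A φ) - (a : ℂ) • A φ + (b : ℂ) • φ := fun a b => by
    have h := cfc_polynomial (.X ^ 2 - .C a * .X + .C b : Polynomial ℝ) A
    simp only [Polynomial.eval_add, Polynomial.eval_sub,
      Polynomial.eval_pow, Polynomial.eval_mul, Polynomial.eval_X, Polynomial.eval_C] at h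
    rw [h]
    simp only [map_add, map_sub, map_mul, map_pow, Polynomial.aeval_X, Polynomial.aeval_C,
      add_apply, sub_apply, mul_apply_eq_comp, sq A]
    rfl
  have hD : (fun x : ℝ => ‖(x : ℂ) - E‖ ^ 2) =
      fun x => x ^ 2 - (2 * E.re) * x + (E.re ^ 2 + E.im ^ 2) := by
    ext x
    rw [norm_ofReal_sub_sq]
    ring
  have h2 : ((E.re ^ 2 + E.im ^ 2 : ℝ) : ℂ) = E * starRingEnd ℂ E := by
    rw [Complex.mul_conj, Complex.normSq_apply]
    congr 1
    ring
  have h3 : ((2 * E.re : ℝ) : ℂ) = E + starRingEnd ℂ E := (Complex.add_conj E).symm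
  rw [hD, key, h2, h3]
  simp only [map_sub, map_smul]
  module

theorem norm_sq_apply_sub (hA : IsSelfAdjoint A) (E : ℂ) (φ : H) :
    ‖A φ - E • φ‖ ^ 2 = ∫ x : ℝ, ‖(x : ℂ) - E‖ ^ 2 ∂(spectralMeasure A φ) := by
  rw [integral_spectralMeasure_of_continuous A φ (by fun_prop)]
  have h := cfc_norm_sub_sq_apply hA (starRingEnd ℂ E) φ
  have h' : (fun x : ℝ => ‖(x : ℂ) - starRingEnd ℂ E‖ ^ 2) = fun x : ℝ => ‖(x : ℂ) - E‖ ^ 2 := by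
    ext x
    simp [norm_ofReal_sub_sq]
  have hs : ∀ u v : H, ⟪u, A v⟫_ℂ = ⟪A u, v⟫_ℂ := fun u v => by
    rw [← ContinuousLinearMap.adjoint_inner_left A, ← ContinuousLinearMap.star_eq_adjoint,
      hA.star_eq]
  rw [h', Complex.conj_conj] at h
  rw [h, inner_sub_right, hs, inner_smul_right, ← inner_smul_left, ← inner_sub_left]
  rw [inner_self_eq_norm_sq_to_K]
  norm_cast

/-- Indicator functions are `L¹`-limits of continuous functions with values in `[0,1]`. -/
theorem exists_continuous_approx_indicator (μ : Measure ℝ) [IsFiniteMeasure μ] {S : Set ℝ}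
    (hS : MeasurableSet S) :
    ∃ f : ℕ → ℝ → ℝ, (∀ n, Continuous (f n)) ∧ (∀ n x, f n x ∈ Set.Icc (0 : ℝ) 1) ∧
      Tendsto (fun n => ∫ x, |f n x - S.indicator 1 x| ∂μ) atTop (𝓝 0) := by
  have hint : Integrable (S.indicator (1 : ℝ → ℝ)) μ := (integrable_const (1 : ℝ)).indicator hS
  choose g hg1 hg2 hg3 hg4 using fun n : ℕ =>
    hint.exists_hasCompactSupport_integral_sub_le (Nat.one_div_pos_of_nat (α := ℝ) (n := n))
  -- Truncation to `[0, 1]` does not increase the distance to an indicator function, whose values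
  -- lie in that interval.
  refine ⟨fun n x => max 0 (min 1 (g n x)), fun n => ?_, fun n x => ?_, ?_⟩
  · have := hg3 n
    fun_prop
  · exact ⟨le_max_left _ _, max_le zero_le_one (min_le_left _ _)⟩
  · refine squeeze_zero (fun n => integral_nonneg fun x => abs_nonneg _) (fun n => ?_)
      tendsto_one_div_add_atTop_nhds_zero_nat
    refine (integral_mono_of_nonneg (.of_forall fun x => abs_nonneg _) (hint.sub (hg4 n)).norm
      (.of_forall fun x => ?_)).trans (hg2 n)
    simp only [Pi.sub_apply, Real.norm_eq_abs]
    by_cases hx : x ∈ S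
    · simp only [hx, Set.indicator_of_mem, Pi.one_apply]
      rw [abs_sub_comm, abs_le]
      rcases max_cases 0 (min 1 (g n x)) with h | h <;>
      rcases min_cases 1 (g n x) with h' | h' <;>
      rcases abs_cases (1 - g n x) with h'' | h'' <;> constructor <;> linarith
    · simp only [hx, not_false_eq_true, Set.indicator_of_notMem]
      rw [abs_sub_comm, abs_le]
      rcases max_cases 0 (min 1 (g n x)) with h | h <;>
      rcases min_cases 1 (g n x) with h' | h' <;>
      rcases abs_cases (0 - g n x) with h'' | h'' <;> constructor <;> linarith

theorem integrable_abs_sub_indicator {μ : Measure ℝ} [IsFiniteMeasure μ] {S : Set ℝ}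
    (hS : MeasurableSet S) {f : ℝ → ℝ} (hf : Continuous f) (h : ∀ x, f x ∈ Set.Icc (0 : ℝ) 1) :
    Integrable (fun x => |f x - S.indicator 1 x|) μ := by
  have hint : Integrable (S.indicator (1 : ℝ → ℝ)) μ := (integrable_const (1 : ℝ)).indicator hS
  have hfi : Integrable f μ := by
    refine Integrable.of_bound hf.aestronglyMeasurable 1 (.of_forall fun x => ?_)
    rw [Real.norm_eq_abs, abs_le]
    exact ⟨by linarith [(h x).1], (h x).2⟩
  exact (hfi.sub hint).abs

theorem integral_restrict_eq_indicator_mul {μ : Measure ℝ} {S : Set ℝ} (hS : MeasurableSet S)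
    (g : ℝ → ℝ) : ∫ x, g x ∂(μ.restrict S) = ∫ x, S.indicator 1 x * g x ∂μ := by
  rw [← integral_indicator hS]
  refine integral_congr_ae (.of_forall fun x => ?_)
  by_cases hx : x ∈ S <;> simp [hx]

/-- If `f n → 1_S` in `L¹(μ_φ)`, `0 ≤ f n ≤ 1` and `(f n)(A) φ → ψ`, then `μ_ψ = 1_S μ_φ`. -/
theorem spectralMeasure_of_tendsto {φ ψ : H} {S : Set ℝ} (hS : MeasurableSet S) {f : ℕ → ℝ → ℝ}
    (hf : ∀ n, Continuous (f n)) (hf01 : ∀ n x, f n x ∈ Set.Icc (0 : ℝ) 1)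
    (hlim : Tendsto (fun n => ∫ x, |f n x - S.indicator 1 x| ∂(spectralMeasure A φ)) atTop (𝓝 0))
    (hψ : Tendsto (fun n => cfc (f n) A φ) atTop (𝓝 ψ)) :
    spectralMeasure A ψ = (spectralMeasure A φ).restrict S := by
  refine Measure.ext_of_integral_eq_on_compactlySupported fun g => ?_
  have h1 : Tendsto (fun n => ∫ x, g x ∂(spectralMeasure A (cfc (f n) A φ))) atTop
      (𝓝 (∫ x, g x ∂(spectralMeasure A ψ))) := by
    simp only [integral_spectralMeasure]
    exact (Complex.continuous_re.tendsto _).comp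
      (hψ.inner (((cfc (g : ℝ → ℝ) A).continuous.tendsto _).comp hψ))
  refine tendsto_nhds_unique h1 ?_
  rw [integral_restrict_eq_indicator_mul hS, tendsto_iff_norm_sub_tendsto_zero]
  obtain ⟨C, hC⟩ := g.hasCompactSupport.exists_bound_of_continuous g.continuous
  have hC0 : 0 ≤ C := (norm_nonneg _).trans (hC 0)
  -- Since `1_S² = 1_S`, the integrand `(f n)² g - 1_S g` factors as `(f n - 1_S)(f n + 1_S) g`; the
  -- last two factors are bounded by `2` and `C`.
  have hlim' := hlim.const_mul (2 * C)
  rw [mul_zero] at hlim'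
  refine squeeze_zero (fun n => norm_nonneg _) (fun n => ?_) hlim'
  have h2 : ∫ x, g x ∂(spectralMeasure A (cfc (f n) A φ)) =
      ∫ x, f n x ^ 2 * g x ∂(spectralMeasure A φ) := by
    have := hf n
    rw [spectralMeasure_cfc_apply A φ (hf n),
      integral_withDensity_eq_integral_toReal_smul (by fun_prop) (by simp)]
    refine integral_congr_ae (.of_forall fun x => ?_)
    simp only [ENNReal.toReal_ofReal (sq_nonneg (f n x)), smul_eq_mul]
  have h3 : Integrable (fun x => f n x ^ 2 * g x) (spectralMeasure A φ) :=
    integrable_spectralMeasure A φ (((hf n).pow 2).mul g.continuous)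
  have h4 : Integrable (fun x => S.indicator 1 x * g x) (spectralMeasure A φ) := by
    refine ((integrable_Cc (spectralMeasure A φ) g).indicator hS).congr (.of_forall fun x => ?_)
    by_cases hx : x ∈ S <;> simp [hx]
  rw [h2, ← integral_sub h3 h4, ← integral_const_mul]
  refine norm_integral_le_of_norm_le ((integrable_abs_sub_indicator hS (hf n) (hf01 n)).const_mul _)
    (.of_forall fun x => ?_)
  have key : f n x ^ 2 * g x - S.indicator 1 x * g x =
      (f n x - S.indicator 1 x) * (f n x + S.indicator 1 x) * g x := by
    by_cases hx : x ∈ S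
    · simp only [hx, Set.indicator_of_mem, Pi.one_apply]
      ring
    · simp only [hx, not_false_eq_true, Set.indicator_of_notMem]
      ring
  have h5 : |f n x + S.indicator 1 x| ≤ 2 := by
    have := hf01 n x
    by_cases hx : x ∈ S <;> simp only [hx, Set.indicator_of_mem, not_false_eq_true,
      Set.indicator_of_notMem, Pi.one_apply, abs_le] <;> constructor <;> linarith [this.1, this.2]
  rw [key, norm_mul, norm_mul, Real.norm_eq_abs, Real.norm_eq_abs]
  calc |f n x - S.indicator 1 x| * |f n x + S.indicator 1 x| * ‖g x‖
      ≤ |f n x - S.indicator 1 x| * 2 * C := by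
        gcongr
        exact hC x
    _ = _ := by ring

/-- The spectral projection `1_S(A)` applied to a vector. -/
theorem exists_spectralProjection (hA : IsSelfAdjoint A) (φ : H) {S : Set ℝ}
    (hS : MeasurableSet S) :
    ∃ ψ : H, spectralMeasure A ψ = (spectralMeasure A φ).restrict S ∧
      spectralMeasure A (φ - ψ) = (spectralMeasure A φ).restrict Sᶜ := by
  obtain ⟨f, hf, hf01, hlim⟩ := exists_continuous_approx_indicator (spectralMeasure A φ) hS
  -- The squared distance of two terms is `∫ (f n - f N)²`, at most `∫ |f n - f N|` because both
  -- functions take values in `[0, 1]`; so `L¹` convergence already gives a Cauchy sequence in `H`.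
  have hcauchy : CauchySeq fun n => cfc (f n) A φ := by
    rw [Metric.cauchySeq_iff']
    intro ε hε
    obtain ⟨N, hN⟩ := (hlim.eventually (gt_mem_nhds (show (0 : ℝ) < ε ^ 2 / 2 by positivity))).exists_forall_of_atTop
    refine ⟨N, fun n hn => ?_⟩
    rw [dist_eq_norm]
    refine lt_of_pow_lt_pow_left₀ 2 hε.le ?_
    rw [norm_sq_cfc_sub A φ (hf n) (hf N)]
    have i1 := integrable_abs_sub_indicator (μ := spectralMeasure A φ) hS (hf n) (hf01 n)
    have i2 := integrable_abs_sub_indicator (μ := spectralMeasure A φ) hS (hf N) (hf01 N)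
    calc ∫ x, (f n x - f N x) ^ 2 ∂(spectralMeasure A φ)
        ≤ ∫ x, (|f n x - S.indicator 1 x| + |f N x - S.indicator 1 x|)
            ∂(spectralMeasure A φ) := by
          refine integral_mono_of_nonneg (.of_forall fun x => sq_nonneg _) (i1.add i2)
            (.of_forall fun x => ?_)
          have h1 := hf01 n x
          have h2 := hf01 N x
          have h3 : |f n x - f N x| ≤ 1 := abs_le.2 ⟨by linarith [h1.1, h2.2],
            by linarith [h1.2, h2.1]⟩
          have h4 : |f n x - f N x| ≤ |f n x - S.indicator 1 x| + |f N x - S.indicator 1 x| := by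
            rw [abs_sub_comm (f N x)]
            exact abs_sub_le _ _ _
          simp only
          rw [← sq_abs]
          nlinarith [abs_nonneg (f n x - f N x)]
      _ < ε ^ 2 := by
          rw [integral_add i1 i2]
          linarith [hN n hn, hN N le_rfl]
  obtain ⟨ψ, hψ⟩ := cauchySeq_tendsto_of_complete hcauchy
  refine ⟨ψ, spectralMeasure_of_tendsto hS hf hf01 hlim hψ, ?_⟩
  refine spectralMeasure_of_tendsto hS.compl (f := fun n x => 1 - f n x)
    (fun n => by have := hf n; fun_prop) (fun n x => ?_) ?_ ?_
  · exact ⟨by linarith [(hf01 n x).2], by linarith [(hf01 n x).1]⟩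
  · refine hlim.congr fun n => integral_congr_ae (.of_forall fun x => ?_)
    by_cases hx : x ∈ S
    · simp [hx, abs_sub_comm]
    · simp [hx]
  · refine ((tendsto_const_nhds (x := φ)).sub hψ).congr fun n => ?_
    rw [cfc_sub (fun _ => (1 : ℝ)) (f n) A continuous_const.continuousOn (hf n).continuousOn,
      sub_apply, cfc_one_apply hA]

/-- Vectors with mutually singular spectral measures are orthogonal. -/
theorem inner_eq_zero_of_mutuallySingular (hA : IsSelfAdjoint A) {φ ψ : H}
    (h : (spectralMeasure A φ).MutuallySingular (spectralMeasure A ψ)) : ⟪φ, ψ⟫_ℂ = 0 := by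
  obtain ⟨T, hT, hφ, hψ⟩ := h
  have hS := hT.compl
  set S := Tᶜ with hSdef
  -- Approximating in the sum of the two measures gives one sequence with `f n (A) φ → φ` and `f n
  -- (A) ψ → 0`; moving `f n (A)` across the inner product then forces `⟨φ, ψ⟩ = 0`.
  obtain ⟨f, hf, hf01, hlim⟩ := exists_continuous_approx_indicator
    (spectralMeasure A φ + spectralMeasure A ψ) hS
  have i1 n := integrable_abs_sub_indicator (μ := spectralMeasure A φ) hS (hf n) (hf01 n)
  have i2 n := integrable_abs_sub_indicator (μ := spectralMeasure A ψ) hS (hf n) (hf01 n)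
  have p1 n : 0 ≤ ∫ x, |f n x - S.indicator 1 x| ∂(spectralMeasure A φ) :=
    integral_nonneg fun x => abs_nonneg _
  have p2 n : 0 ≤ ∫ x, |f n x - S.indicator 1 x| ∂(spectralMeasure A ψ) :=
    integral_nonneg fun x => abs_nonneg _
  simp only [integral_add_measure (i1 _) (i2 _)] at hlim
  have l1 : Tendsto (fun n => ‖cfc (f n) A φ - φ‖ ^ 2) atTop (𝓝 0) := by
    refine squeeze_zero (fun n => by positivity) (fun n => ?_) hlim
    have := norm_sq_cfc_sub A φ (hf n) (continuous_const (y := (1 : ℝ)))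
    rw [cfc_one_apply hA] at this
    rw [this]
    refine le_trans ?_ (le_add_of_nonneg_right (p2 n))
    refine integral_mono_of_nonneg (.of_forall fun x => sq_nonneg _) (i1 n) ?_
    filter_upwards [mem_ae_iff.2 (show spectralMeasure A φ Sᶜ = 0 by simpa [hSdef] using hφ)]
      with x hx
    simp only [hx, Set.indicator_of_mem, Pi.one_apply]
    rw [← sq_abs, abs_of_nonpos (by linarith [(hf01 n x).2])]
    nlinarith [(hf01 n x).1, (hf01 n x).2]
  have l2 : Tendsto (fun n => ‖cfc (f n) A ψ - 0‖ ^ 2) atTop (𝓝 0) := by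
    refine squeeze_zero (fun n => by positivity) (fun n => ?_) hlim
    rw [sub_zero, norm_sq_cfc_apply A ψ (hf n)]
    refine le_trans ?_ (le_add_of_nonneg_left (p1 n))
    refine integral_mono_of_nonneg (.of_forall fun x => sq_nonneg _) (i2 n) ?_
    filter_upwards [measure_eq_zero_iff_ae_notMem.1 hψ] with x hx
    simp only [hx, not_false_eq_true, Set.indicator_of_notMem, sub_zero]
    rw [abs_of_nonneg (hf01 n x).1]
    nlinarith [(hf01 n x).1, (hf01 n x).2]
  have aux : ∀ {u : ℕ → H} {v : H}, Tendsto (fun n => ‖u n - v‖ ^ 2) atTop (𝓝 0) →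
      Tendsto u atTop (𝓝 v) := fun {u v} h => by
    rw [tendsto_iff_norm_sub_tendsto_zero]
    simpa using h.sqrt
  have t1 : Tendsto (fun n => ⟪cfc (f n) A φ, ψ⟫_ℂ) atTop (𝓝 ⟪φ, ψ⟫_ℂ) :=
    (aux l1).inner tendsto_const_nhds
  have t2 : Tendsto (fun n => ⟪φ, cfc (f n) A ψ⟫_ℂ) atTop (𝓝 ⟪φ, (0 : H)⟫_ℂ) :=
    tendsto_const_nhds.inner (aux l2)
  rw [inner_zero_right] at t2
  exact tendsto_nhds_unique t1 (t2.congr fun n => (inner_cfc_left A (f n) φ ψ).symm)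

end SpectralCalculus

/-! ### Spectral components and the Lebesgue types of spectral measures. -/

section SpectralComponents

/-- A number with approximate eigenvectors lies in the spectrum. -/
theorem mem_spectrum_of_approx_eigenvector {V : Type*} [NormedAddCommGroup V] [NormedSpace ℂ V]
    (T : V →L[ℂ] V) (E : ℂ) (h : ∀ ε > 0, ∃ v ≠ 0, ‖T v - E • v‖ ≤ ε * ‖v‖) :
    E ∈ spectrum ℂ T := by
  rw [spectrum.mem_iff]
  intro hu
  obtain ⟨R, -, hR⟩ := isUnit_iff_exists.1 hu
  -- This tolerance makes `‖R‖ * ε < 1`, contradicting `‖v‖ ≤ ‖R‖ ‖(E - T) v‖` for an inverse `R` of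
  -- `E - T`.
  obtain ⟨v, hv0, hv⟩ := h (1 / (‖R‖ + 1)) (by positivity)
  have h1 : R (E • v - T v) = v := by
    have := congrArg (fun S : V →L[ℂ] V => S v) hR
    simpa [Algebra.algebraMap_eq_smul_one] using this
  have h2 : ‖v‖ ≤ ‖R‖ * (1 / (‖R‖ + 1) * ‖v‖) := by
    calc ‖v‖ = ‖R (E • v - T v)‖ := by rw [h1]
      _ ≤ ‖R‖ * ‖E • v - T v‖ := R.le_opNorm _
      _ ≤ _ := by
        rw [norm_sub_rev]
        gcongr
  have h3 : 0 < ‖v‖ := norm_pos_iff.2 hv0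
  have h4 : ‖R‖ * (1 / (‖R‖ + 1) * ‖v‖) < ‖v‖ := by
    have : ‖R‖ * (1 / (‖R‖ + 1) * ‖v‖) = ‖R‖ / (‖R‖ + 1) * ‖v‖ := by ring
    rw [this]
    refine mul_lt_of_lt_one_left h3 ((div_lt_one (by positivity)).2 (by linarith))
  linarith

variable {H : Type*} [NormedAddCommGroup H] [InnerProductSpace ℂ H] [CompleteSpace H]
  {A : H →L[ℂ] H}

theorem mem_spectralSubspace_of_absolutelyContinuous {κ : SpectralType} {φ ψ : H}
    (hφ : φ ∈ spectralSubspace A κ) (h : spectralMeasure A ψ ≪ spectralMeasure A φ) :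
    ψ ∈ spectralSubspace A κ :=
  SpectralType.Holds.mono hφ h

theorem measurableSet_norm_sub_lt (E : ℂ) (ε : ℝ) :
    MeasurableSet {x : ℝ | ‖(x : ℂ) - E‖ < ε} :=
  (isOpen_lt (by fun_prop) continuous_const).measurableSet

theorem ne_zero_of_spectralMeasure_eq_restrict {φ ψ : H} {S : Set ℝ}
    (hψ : spectralMeasure A ψ = (spectralMeasure A φ).restrict S) (h : spectralMeasure A φ S ≠ 0) :
    ψ ≠ 0 := by
  intro h0
  rw [h0, spectralMeasure_zero] at hψ
  exact h (Measure.restrict_eq_zero.1 hψ.symm)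

theorem absolutelyContinuous_of_eq_restrict {μ ν : Measure ℝ} {S : Set ℝ}
    (h : ν = μ.restrict S) : ν ≪ μ :=
  Measure.absolutelyContinuous_of_le (h.le.trans Measure.restrict_le_self)

/-- Projecting `φ` to energies within `ε` of `E` makes `|x - E| < ε` almost everywhere for the new
spectral measure. The absolute continuity clause keeps the vector in every `H_κ` that contains `φ`.
-/
theorem exists_approx_eigenvector (hA : IsSelfAdjoint A) {E : ℂ} {ε : ℝ} {φ : H}
    (h : spectralMeasure A φ {x | ‖(x : ℂ) - E‖ < ε} ≠ 0) :
    ∃ ψ ≠ 0, spectralMeasure A ψ ≪ spectralMeasure A φ ∧ ‖A ψ - E • ψ‖ ≤ ε * ‖ψ‖ := by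
  have hS := measurableSet_norm_sub_lt E ε
  obtain ⟨ψ, hψ, -⟩ := exists_spectralProjection hA φ hS
  have hε : 0 < ε := by
    by_contra hneg
    refine h (measure_mono_null (fun x hx => ?_) measure_empty)
    exact absurd ((norm_nonneg _).trans_lt hx) hneg
  refine ⟨ψ, ne_zero_of_spectralMeasure_eq_restrict hψ h,
    absolutelyContinuous_of_eq_restrict hψ, ?_⟩
  · refine le_of_sq_le_sq ?_ (by positivity)
    rw [norm_sq_apply_sub hA, mul_pow, norm_sq_eq_spectralMeasure hA, hψ]
    have h1 : ∫ x : ℝ, ‖(x : ℂ) - E‖ ^ 2 ∂((spectralMeasure A φ).restrict {x | ‖(x : ℂ) - E‖ < ε})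
        ≤ ∫ x : ℝ, ε ^ 2 ∂((spectralMeasure A φ).restrict {x | ‖(x : ℂ) - E‖ < ε}) := by
      refine integral_mono_of_nonneg (.of_forall fun x => by positivity) (integrable_const _) ?_
      filter_upwards [ae_restrict_mem hS] with x hx
      have : ‖(x : ℂ) - E‖ < ε := hx
      gcongr
    refine h1.trans (le_of_eq ?_)
    simp [mul_comm]

/-- A two-sided inverse of `A - E` on the vectors whose spectral measure is away from `E`. -/
theorem exists_local_resolvent (hA : IsSelfAdjoint A) (E : ℂ) {ε : ℝ} (hε : 0 < ε) :
    ∃ R : H →L[ℂ] H, (∀ κ, Set.MapsTo R (spectralSubspace A κ) (spectralSubspace A κ)) ∧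
      ∀ φ, spectralMeasure A φ {x | ‖(x : ℂ) - E‖ < ε} = 0 →
        A (R φ) - E • R φ = φ ∧ R (A φ - E • φ) = φ := by
  let D : ℝ → ℝ := fun x => ‖(x : ℂ) - E‖ ^ 2
  -- Capping `1 / |x - E|²` at `ε⁻²` keeps it continuous. The operator `(A - Ē) g(A)` then acts as
  -- the resolvent, by `(x - Ē) / |x - E|² = 1 / (x - E)`, on vectors whose measure avoids the
  -- `ε`-neighbourhood of `E`.
  let g : ℝ → ℝ := fun x => (max (D x) (ε ^ 2))⁻¹
  have hD : Continuous D := by fun_prop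
  have hpos : ∀ x, 0 < max (D x) (ε ^ 2) := fun x => lt_max_of_lt_right (by positivity)
  have hg : Continuous g := (hD.max continuous_const).inv₀ fun x => (hpos x).ne'
  let B : H →L[ℂ] H := A - (starRingEnd ℂ E) • 1
  have hB : ∀ v, B v = A v - (starRingEnd ℂ E) • v := fun v => rfl
  have hcomm : ∀ v, cfc g A (A v) = A (cfc g A v) := fun v => by
    have h := (cfc_commute_cfc g (fun x : ℝ => x) A)
    rw [cfc_id' ℝ A] at h
    exact congrArg (fun T : H →L[ℂ] H => T v) h
  refine ⟨B * cfc g A, fun κ φ hφ => ?_, fun φ hφ => ?_⟩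
  · have h1 : cfc g A φ ∈ spectralSubspace A κ := by
      refine mem_spectralSubspace_of_absolutelyContinuous hφ ?_
      rw [spectralMeasure_cfc_apply A φ hg]
      exact withDensity_absolutelyContinuous _ _
    exact sub_mem (mapsTo_spectralSubspace A κ h1) (Submodule.smul_mem _ _ h1)
  · have key : A ((B * cfc g A) φ) - E • (B * cfc g A) φ = φ := by
      have h1 := cfc_norm_sub_sq_apply hA E (cfc g A φ)
      rw [mul_apply_eq_comp, hB, ← h1]
      change cfc D A (cfc g A φ) = φ
      have h2 : cfc (fun x => D x * g x) A φ = cfc D A (cfc g A φ) := by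
        rw [cfc_mul D g A hD.continuousOn hg.continuousOn]
        rfl
      rw [← h2, ← sub_eq_zero, ← norm_eq_zero, ← sq_eq_zero_iff]
      have h3 := norm_sq_cfc_sub A φ (show Continuous fun x => D x * g x from hD.mul hg)
        (continuous_const (y := (1 : ℝ)))
      rw [cfc_one_apply hA] at h3
      rw [h3]
      refine integral_eq_zero_of_ae ?_
      filter_upwards [measure_eq_zero_iff_ae_notMem.1 hφ] with x hx
      have h4 : ε ≤ ‖(x : ℂ) - E‖ := not_lt.1 hx
      have h5 : max (D x) (ε ^ 2) = D x := max_eq_left (by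
        change ε ^ 2 ≤ ‖(x : ℂ) - E‖ ^ 2
        gcongr)
      have h6 : D x ≠ 0 := h5 ▸ (hpos x).ne'
      simp only [g, h5, mul_inv_cancel₀ h6, Pi.zero_apply]
      norm_num
    refine ⟨key, ?_⟩
    refine Eq.trans ?_ key
    simp only [mul_apply_eq_comp, map_sub, map_smul, hcomm, hB]

/-- If no vector of `H_κ` has spectral mass near `E`, the local resolvent restricts to `H_κ` and
inverts the operator there; otherwise spectral projections provide approximate eigenvectors inside
`H_κ`. Neither direction uses that `H_κ` is closed. -/
theorem mem_spectralComponent_iff (hA : IsSelfAdjoint A) (κ : SpectralType) (E : ℂ) :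
    E ∈ spectralComponent A κ ↔ ∀ ε > 0, ∃ φ ∈ spectralSubspace A κ,
      spectralMeasure A φ {x | ‖(x : ℂ) - E‖ < ε} ≠ 0 := by
  constructor
  · intro hE
    by_contra! hcon
    obtain ⟨ε, hε, h0⟩ := hcon
    obtain ⟨R, hRK, hR⟩ := exists_local_resolvent hA E hε
    rw [spectralComponent, spectrum.mem_iff] at hE
    have hR1 : ∀ φ ∈ spectralSubspace A κ, (-R) φ ∈ spectralSubspace A κ :=
      fun φ hφ => neg_mem (hRK κ hφ)
    refine hE (isUnit_iff_exists.2 ⟨(-R).restrict hR1, ?_, ?_⟩)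
    · refine ContinuousLinearMap.ext fun φ => Subtype.ext ?_
      change E • (-R φ) - A (-R φ) = φ
      rw [map_neg, smul_neg, sub_neg_eq_add, neg_add_eq_sub]
      exact (hR φ (h0 φ φ.2)).1
    · refine ContinuousLinearMap.ext fun φ => Subtype.ext ?_
      change -R (E • φ - A φ) = φ
      rw [← map_neg, neg_sub]
      exact (hR φ (h0 φ φ.2)).2
  · intro h
    refine mem_spectrum_of_approx_eigenvector _ E fun ε hε => ?_
    obtain ⟨φ, hφ, hne⟩ := h ε hε
    obtain ⟨ψ, hψ0, hψ, hle⟩ := exists_approx_eigenvector hA hne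
    exact ⟨⟨ψ, mem_spectralSubspace_of_absolutelyContinuous hφ hψ⟩,
      fun h => hψ0 (congrArg Subtype.val h), hle⟩

theorem exists_spectralMeasure_ne_zero_of_mem_spectrum (hA : IsSelfAdjoint A) {E : ℂ}
    (hE : E ∈ spectrum ℂ A) {ε : ℝ} (hε : 0 < ε) :
    ∃ φ, spectralMeasure A φ {x | ‖(x : ℂ) - E‖ < ε} ≠ 0 := by
  by_contra! h0
  obtain ⟨R, -, hR⟩ := exists_local_resolvent hA E hε
  rw [spectrum.mem_iff] at hE
  refine hE (isUnit_iff_exists.2 ⟨-R, ?_, ?_⟩)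
  · ext φ
    have h1 := (hR φ (h0 φ)).1
    simp only [Algebra.algebraMap_eq_smul_one, mul_apply_eq_comp, neg_apply, map_neg,
      sub_apply, smul_apply, one_apply_eq_self, neg_sub]
    exact h1
  · ext φ
    have h1 := (hR φ (h0 φ)).2
    simp only [Algebra.algebraMap_eq_smul_one, mul_apply_eq_comp, neg_apply,
      sub_apply, smul_apply, one_apply_eq_self]
    rw [← map_neg, neg_sub]
    exact h1

theorem spectralComponent_subset_spectrum (hA : IsSelfAdjoint A) (κ : SpectralType) :
    spectralComponent A κ ⊆ spectrum ℂ A := fun E hE =>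
  mem_spectrum_of_approx_eigenvector A E fun ε hε => by
    obtain ⟨φ, -, hne⟩ := (mem_spectralComponent_iff hA κ E).1 hE ε hε
    obtain ⟨ψ, hψ0, -, hle⟩ := exists_approx_eigenvector hA hne
    exact ⟨ψ, hψ0, hle⟩

theorem spectralComponent_eq_spectrum (hA : IsSelfAdjoint A) {κ : SpectralType}
    (h : spectralSubspace A κ = ⊤) : spectralComponent A κ = spectrum ℂ A := by
  refine (spectralComponent_subset_spectrum hA κ).antisymm fun E hE => ?_
  refine (mem_spectralComponent_iff hA κ E).2 fun ε hε => ?_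
  obtain ⟨φ, hφ⟩ := exists_spectralMeasure_ne_zero_of_mem_spectrum hA hE hε
  exact ⟨φ, h ▸ Submodule.mem_top, hφ⟩

/-- An atom of a spectral measure is an eigenvalue. -/
theorem exists_eigenvector_of_atom (hA : IsSelfAdjoint A) {φ : H} {x : ℝ}
    (h : spectralMeasure A φ {x} ≠ 0) : ∃ ψ ≠ 0, A ψ = (x : ℂ) • ψ := by
  obtain ⟨ψ, hψ, -⟩ := exists_spectralProjection hA φ (measurableSet_singleton x)
  refine ⟨ψ, ne_zero_of_spectralMeasure_eq_restrict hψ h, ?_⟩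
  · rw [← sub_eq_zero, ← norm_eq_zero, ← sq_eq_zero_iff, norm_sq_apply_sub hA, hψ]
    refine integral_eq_zero_of_ae ?_
    filter_upwards [ae_restrict_mem (measurableSet_singleton x)] with y hy
    have : y = x := hy
    simp [this]

/-- The set of atoms of a measure. -/
def atoms (μ : Measure ℝ) : Set ℝ := {x | μ {x} ≠ 0}

theorem countable_atoms (μ : Measure ℝ) [SFinite μ] : (atoms μ).Countable := by
  refine (Measure.countable_meas_pos_of_disjoint_iUnion (μ := μ) (As := fun x : ℝ => {x})
    (fun x => measurableSet_singleton x) fun x y hxy => ?_).mono fun x hx => pos_iff_ne_zero.2 hx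
  simpa [Function.onFun] using hxy

/-- A carrier of the component of `μ` of the given type, `N` being a Lebesgue-null set off which
`μ` is absolutely continuous. -/
def carrier (μ : Measure ℝ) (N : Set ℝ) : SpectralType → Set ℝ
  | .pp => atoms μ
  | .sc => N \ atoms μ
  | .ac => Nᶜ

section Carrier

variable {μ : Measure ℝ} {N : Set ℝ}

theorem measurableSet_carrier [IsFiniteMeasure μ] (hN : MeasurableSet N) (κ : SpectralType) :
    MeasurableSet (carrier μ N κ) := by
  cases κ
  · exact (countable_atoms μ).measurableSet
  · exact hN.diff (countable_atoms μ).measurableSet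
  · exact hN.compl

theorem measure_eq_zero_of_countable_of_disjoint_atoms {S : Set ℝ} (hS : S.Countable)
    (h : Disjoint S (atoms μ)) : μ S = 0 := by
  rw [← Set.biUnion_of_singleton S, measure_biUnion_null_iff hS]
  intro x hx
  by_contra hne
  exact Set.disjoint_left.1 h hx hne

theorem holds_restrict_carrier [IsFiniteMeasure μ] (hN : MeasurableSet N) (hN0 : volume N = 0)
    (hac : μ.restrict Nᶜ ≪ volume) (κ : SpectralType) : κ.Holds (μ.restrict (carrier μ N κ)) := by
  cases κ
  · refine ⟨atoms μ, countable_atoms μ, ?_⟩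
    rw [Measure.restrict_apply (countable_atoms μ).measurableSet.compl]
    simp [carrier]
  · refine ⟨fun x => ?_, Nᶜ, hN.compl, ?_, ?_⟩
    · rw [Measure.restrict_apply (measurableSet_singleton x)]
      by_cases hx : x ∈ carrier μ N .sc
      · exact measure_mono_null Set.inter_subset_left (not_not.1 hx.2)
      · rw [Set.singleton_inter_eq_empty.2 hx, measure_empty]
    · rw [Measure.restrict_apply hN.compl]
      exact measure_mono_null (fun x hx => hx.1 hx.2.1) measure_empty
    · rw [compl_compl]
      exact hN0
  · exact hac

/-- Off the carrier only the other two types remain: no atoms for `pp`, an absolutely continuous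
part plus atoms for `sc`, a part on the null set `N` for `ac`. Each of these is singular to a
measure of type `κ`. -/
theorem mutuallySingular_restrict_compl_carrier [IsFiniteMeasure μ] (hN : MeasurableSet N) (hN0 : volume N = 0)
    (hac : μ.restrict Nᶜ ≪ volume) {κ : SpectralType} {ν : Measure ℝ} (hν : κ.Holds ν) :
    (μ.restrict (carrier μ N κ)ᶜ).MutuallySingular ν := by
  cases κ
  · obtain ⟨S, hS, h0⟩ := hν
    refine ⟨S, hS.measurableSet, ?_, h0⟩
    rw [Measure.restrict_apply hS.measurableSet]
    refine measure_eq_zero_of_countable_of_disjoint_atoms (hS.mono Set.inter_subset_left) ?_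
    exact Set.disjoint_left.2 fun x hx => hx.2
  · have h1 : (μ.restrict (carrier μ N .sc)ᶜ) ≪ μ.restrict Nᶜ + μ.restrict (atoms μ) := by
      refine (Measure.absolutelyContinuous_of_le ?_).trans
        (Measure.absolutelyContinuous_of_le (Measure.restrict_union_le Nᶜ (atoms μ)))
      refine Measure.restrict_mono (fun x hx => ?_) le_rfl
      by_cases hxN : x ∈ N
      · exact .inr (by_contra fun h => hx ⟨hxN, h⟩)
      · exact .inl hxN
    refine Measure.MutuallySingular.mono_ac ?_ h1 .rfl
    refine Measure.MutuallySingular.add_left (hν.2.symm.mono_ac hac .rfl) ?_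
    have hat := (countable_atoms μ).measurableSet
    refine ⟨(atoms μ)ᶜ, hat.compl, ?_, ?_⟩
    · rw [Measure.restrict_apply hat.compl]
      simp
    · rw [compl_compl, ← Set.biUnion_of_singleton (atoms μ),
        measure_biUnion_null_iff (countable_atoms μ)]
      exact fun x _ => hν.1 x
  · refine ⟨Nᶜ, hN.compl, ?_, ?_⟩
    · rw [Measure.restrict_apply hN.compl]
      simp [carrier]
    · rw [compl_compl]
      exact hν hN0

end Carrier

/-- A nonzero vector of `H_κ` with spectral measure concentrated on `J` cannot be orthogonal to the
whole total family `e`. Were the type-`κ` part of each `e i` to miss `J`, all the measures would be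
mutually singular to that of the vector. The right side involves only the `e i`, which makes
measurability in a random parameter accessible. -/
theorem exists_mem_spectralSubspace_iff (hA : IsSelfAdjoint A) {ι : Type*} {e : ι → H}
    (he : ∀ ψ, (∀ i, ⟪e i, ψ⟫_ℂ = 0) → ψ = 0) {N : ι → Set ℝ} (hN : ∀ i, MeasurableSet (N i))
    (hN0 : ∀ i, volume (N i) = 0)
    (hac : ∀ i, (spectralMeasure A (e i)).restrict (N i)ᶜ ≪ volume) (κ : SpectralType)
    {J : Set ℝ} (hJ : MeasurableSet J) :
    (∃ φ ∈ spectralSubspace A κ, spectralMeasure A φ J ≠ 0) ↔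
      ∃ i, spectralMeasure A (e i) (J ∩ carrier (spectralMeasure A (e i)) (N i) κ) ≠ 0 := by
  constructor
  · rintro ⟨φ, hφ, hφJ⟩
    obtain ⟨ψ, hψ, -⟩ := exists_spectralProjection hA φ hJ
    have hψ0 : ψ ≠ 0 := ne_zero_of_spectralMeasure_eq_restrict hψ hφJ
    have hψκ : κ.Holds (spectralMeasure A ψ) :=
      SpectralType.Holds.mono hφ (absolutelyContinuous_of_eq_restrict hψ)
    by_contra! hcon
    refine hψ0 (he ψ fun i => inner_eq_zero_of_mutuallySingular hA ?_)
    have h1 := mutuallySingular_restrict_compl_carrier (hN i) (hN0 i) (hac i) hψκ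
    have hC := measurableSet_carrier (μ := spectralMeasure A (e i)) (hN i) κ
    set C := carrier (spectralMeasure A (e i)) (N i) κ
    have h2 : (spectralMeasure A (e i)).restrict C ⟂ₘ spectralMeasure A ψ := by
      refine ⟨J, hJ, ?_, ?_⟩
      · rw [Measure.restrict_apply hJ]
        exact hcon i
      · rw [hψ, Measure.restrict_apply hJ.compl]
        simp
    rw [← Measure.restrict_add_restrict_compl (μ := spectralMeasure A (e i)) hC]
    exact h2.add_left h1
  · rintro ⟨i, hi⟩
    have hC := measurableSet_carrier (μ := spectralMeasure A (e i)) (hN i) κ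
    obtain ⟨ψ, hψ, -⟩ := exists_spectralProjection hA (e i) hC
    refine ⟨ψ, ?_, ?_⟩
    · change κ.Holds _
      rw [hψ]
      exact holds_restrict_carrier (hN i) (hN0 i) (hac i) κ
    · rwa [hψ, Measure.restrict_apply hJ]

/-- The measures of the `e i` all live on one countable set. The projection of any vector off this
set is orthogonal to every `e i`, hence zero; no closedness of `H_pp` is needed. -/
theorem spectralSubspace_pp_eq_top (hA : IsSelfAdjoint A) {ι : Type*} [Countable ι] {e : ι → H}
    (he : ∀ ψ, (∀ i, ⟪e i, ψ⟫_ℂ = 0) → ψ = 0) (h : ∀ i, e i ∈ spectralSubspace A .pp) :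
    spectralSubspace A .pp = ⊤ := by
  choose S hS h0 using h
  rw [eq_top_iff]
  intro φ _
  have hT : (⋃ i, S i).Countable := Set.countable_iUnion hS
  obtain ⟨ψ, hψ, -⟩ := exists_spectralProjection hA φ hT.measurableSet.compl
  refine ⟨⋃ i, S i, hT, ?_⟩
  have hψ0 : ψ = 0 := he ψ fun i => inner_eq_zero_of_mutuallySingular hA <| by
    refine ⟨(⋃ i, S i)ᶜ, hT.measurableSet.compl,
      measure_mono_null (Set.compl_subset_compl.2 (Set.subset_iUnion S i)) (h0 i), ?_⟩
    rw [hψ, compl_compl, Measure.restrict_apply hT.measurableSet, Set.inter_compl_self,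
      measure_empty]
  rw [hψ0, spectralMeasure_zero] at hψ
  exact Measure.restrict_eq_zero.1 hψ.symm

theorem eq_zero_of_mem_pp_of_forall_singleton (hA : IsSelfAdjoint A) {φ : H}
    (hpp : φ ∈ spectralSubspace A .pp) (h : ∀ x, spectralMeasure A φ {x} = 0) : φ = 0 := by
  obtain ⟨S, hS, h0⟩ := hpp
  rw [← spectralMeasure_eq_zero_iff hA, ← Measure.measure_univ_eq_zero, ← Set.union_compl_self S]
  refine measure_union_null ?_ h0
  rw [← Set.biUnion_of_singleton S, measure_biUnion_null_iff hS]
  exact fun x _ => h x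

/-- Measures of the two other types charge no points, whereas a pure point measure without atoms is
zero. -/
theorem spectralComponent_eq_empty (hA : IsSelfAdjoint A) (hpp : spectralSubspace A .pp = ⊤)
    {κ : SpectralType} (hκ : κ ≠ .pp) : spectralComponent A κ = ∅ := by
  refine Set.eq_empty_of_forall_notMem fun E hE => ?_
  obtain ⟨φ, hφ, hne⟩ := (mem_spectralComponent_iff hA κ E).1 hE 1 one_pos
  refine hne ?_
  rw [eq_zero_of_mem_pp_of_forall_singleton hA (hpp ▸ Submodule.mem_top : φ ∈ _) fun x => ?_,
    spectralMeasure_zero]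
  · simp
  · cases κ
    · exact absurd rfl hκ
    · exact hφ.1 x
    · exact hφ (measure_singleton x)

/-- `∫ q² dμ_φ = ‖q(A)φ‖² = 0`, so `μ_φ` lives on the finitely many real roots of `q`. -/
theorem mem_pp_of_aeval_eq_zero (hA : IsSelfAdjoint A) {φ : H} {q : Polynomial ℝ} (hq : q ≠ 0)
    (h : Polynomial.aeval A q φ = 0) : φ ∈ spectralSubspace A .pp := by
  refine ⟨q.rootSet ℝ, (q.rootSet_finite ℝ).countable, ?_⟩
  have h1 := norm_sq_cfc_apply A φ q.continuous
  rw [cfc_polynomial q A, h, norm_zero, zero_pow two_ne_zero, eq_comm,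
    integral_eq_zero_iff_of_nonneg (fun x => sq_nonneg _)
      (integrable_spectralMeasure A φ (q.continuous.pow 2))] at h1
  refine measure_mono_null (fun x hx => ?_) h1
  have : q.eval x ≠ 0 := fun h => hx ((Polynomial.mem_rootSet_of_ne hq).2 (by simpa using h))
  simpa using this

/-- Unitary conjugation is a continuous star-algebra isomorphism, hence commutes with the functional
calculus. With covariance this makes spectral events shift invariant. -/
theorem spectralMeasure_conj (hA : IsSelfAdjoint A) (U : H ≃ₗᵢ[ℂ] H) {B : H →L[ℂ] H}
    (hB : IsSelfAdjoint B) (hAB : ∀ φ, B φ = U.symm (A (U φ))) (φ : H) :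
    spectralMeasure B φ = spectralMeasure A (U φ) := by
  refine Measure.ext_of_integral_eq_on_compactlySupported fun f => ?_
  have h1 : U.symm.conjStarAlgEquiv A = B := by
    ext ψ
    simp [hAB]
  have hcont : Continuous U.symm.conjStarAlgEquiv :=
    continuous_const.clm_comp (continuous_id.clm_comp continuous_const)
  have h2 := StarAlgHomClass.map_cfc (S := ℂ) U.symm.conjStarAlgEquiv (f : ℝ → ℝ) A
    f.continuous.continuousOn hcont hA (h1 ▸ hB)
  rw [integral_spectralMeasure, integral_spectralMeasure, ← h1, ← h2,
    LinearIsometryEquiv.conjStarAlgEquiv_apply_apply, ← U.inner_map_map]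
  simp

end SpectralComponents

/-! ### Measurability of spectral data and the zero-one law. -/

section RandomOperators

variable {H : Type*} [NormedAddCommGroup H] [InnerProductSpace ℂ H] [CompleteSpace H]
  {Ω : Type*} [MeasurableSpace Ω]

/-- For polynomials the integral is a combination of the measurable moments `⟨φ, Aⁿ φ⟩`. In general,
Weierstrass approximation on `[-k, k]` with error `1/(k+1)` suffices: for each `ω` the spectrum is
eventually inside, so no bound uniform in `ω` is needed. -/
theorem measurable_integral_spectralMeasure {A : Ω → H →L[ℂ] H} (hA : ∀ ω, IsSelfAdjoint (A ω))
    {φ : H} (hm : ∀ n : ℕ, Measurable fun ω => ⟪φ, (A ω ^ n) φ⟫_ℂ) {f : ℝ → ℝ}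
    (hf : Continuous f) : Measurable fun ω => ∫ x, f x ∂(spectralMeasure (A ω) φ) := by
  have hpoly : ∀ q : Polynomial ℝ,
      Measurable fun ω => ∫ x, q.eval x ∂(spectralMeasure (A ω) φ) := fun q => by
    have h1 : ∀ ω, ∫ x, q.eval x ∂(spectralMeasure (A ω) φ) =
        ∑ n ∈ q.support, q.coeff n * (⟪φ, (A ω ^ n) φ⟫_ℂ).re := fun ω => by
      have hq : Polynomial.aeval (A ω) q φ = ∑ n ∈ q.support, (q.coeff n : ℂ) • (A ω ^ n) φ := by
        rw [Polynomial.aeval_eq_sum_range' (n := q.natDegree + 1) (Nat.lt_succ_self _),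
          sum_apply, ← Finset.sum_subset q.supp_subset_range_natDegree_succ]
        · rfl
        · intro n _ hn
          rw [Polynomial.notMem_support_iff.1 hn]
          simp
      rw [integral_spectralMeasure_of_continuous _ _ q.continuous,
        cfc_polynomial q (A ω) (hA ω), hq, inner_sum, Complex.re_sum]
      refine Finset.sum_congr rfl fun n _ => ?_
      rw [inner_smul_right, Complex.re_ofReal_mul]
    simp only [h1]
    exact Finset.measurable_sum _ fun n _ =>
      (Complex.measurable_re.comp (hm n)).const_mul _
  choose q hq using fun k : ℕ => exists_polynomial_near_of_continuousOn (-(k : ℝ)) k f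
    hf.continuousOn (1 / ((k : ℝ) + 1)) (by positivity)
  refine measurable_of_tendsto_metrizable (fun k => hpoly (q k)) (tendsto_pi_nhds.2 fun ω => ?_)
  obtain ⟨R, hR⟩ := (ContinuousFunctionalCalculus.isCompact_spectrum (R := ℝ)
    (A ω)).isBounded.subset_closedBall 0
  rw [tendsto_iff_norm_sub_tendsto_zero]
  have hlim := tendsto_one_div_add_atTop_nhds_zero_nat.mul_const
    ((spectralMeasure (A ω) φ).real Set.univ)
  rw [zero_mul] at hlim
  refine squeeze_zero' (.of_forall fun k => norm_nonneg _) ?_ hlim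
  filter_upwards [eventually_ge_atTop ⌈R⌉₊] with k hk
  rw [← integral_sub (integrable_spectralMeasure _ _ (q k).continuous)
    (integrable_spectralMeasure _ _ hf)]
  refine norm_integral_le_of_norm_le_const ?_
  filter_upwards [ae_mem_spectrum (A ω) φ] with x hx
  have h1 := hR hx
  rw [Metric.mem_closedBall, dist_zero_right, Real.norm_eq_abs] at h1
  exact (hq k x (abs_le.1 (h1.trans (Nat.ceil_le.1 hk)))).le

/-- Indicators of closed sets are limits of continuous functions, and closed sets form a π-system
generating the Borel sets. -/
theorem measurable_spectralMeasure {A : Ω → H →L[ℂ] H} (hA : ∀ ω, IsSelfAdjoint (A ω))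
    {φ : H} (hm : ∀ n : ℕ, Measurable fun ω => ⟪φ, (A ω ^ n) φ⟫_ℂ) :
    Measurable fun ω => spectralMeasure (A ω) φ := by
  have key : ∀ F : Set ℝ, IsClosed F → Measurable fun ω => spectralMeasure (A ω) φ F := by
    intro F hF
    refine measurable_of_tendsto_metrizable (f := fun n ω =>
      ∫⁻ x, hF.apprSeq n x ∂(spectralMeasure (A ω) φ)) (fun n => ?_) (tendsto_pi_nhds.2 fun ω =>
        HasOuterApproxClosed.tendsto_lintegral_apprSeq hF _)
    have hc : Continuous fun x => (hF.apprSeq n x : ℝ) :=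
      NNReal.continuous_coe.comp (hF.apprSeq n).continuous
    have h1 : ∀ ω, ∫⁻ x, hF.apprSeq n x ∂(spectralMeasure (A ω) φ) =
        ENNReal.ofReal (∫ x, (hF.apprSeq n x : ℝ) ∂(spectralMeasure (A ω) φ)) := fun ω => by
      rw [ofReal_integral_eq_lintegral_ofReal (integrable_spectralMeasure _ _ hc)
        (.of_forall fun x => NNReal.coe_nonneg _)]
      simp
    simp only [h1]
    exact (measurable_integral_spectralMeasure hA hm hc).ennreal_ofReal
  refine Measurable.measure_of_isPiSystem (S := {s | IsClosed s}) ?_ isPiSystem_isClosed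
    (fun s hs => key s hs) (key _ isClosed_univ)
  rw [BorelSpace.measurable_eq (α := ℝ), borel_eq_generateFrom_isClosed]

/-- The Lebesgue-null sets off which the measures of a kernel are absolutely continuous. -/
def singularSet (μ : Kernel Ω ℝ) (ω : Ω) : Set ℝ :=
  -- The Gaussian stands in for Lebesgue measure: it has the same null sets and is finite, so it
  -- gives a finite reference kernel for the jointly measurable Lebesgue decomposition.
  μ.mutuallySingularSetSlice (Kernel.const Ω (gaussianReal 0 1)) ω

theorem measurableSet_singularSet (μ : Kernel Ω ℝ) (ω : Ω) : MeasurableSet (singularSet μ ω) :=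
  Kernel.measurableSet_mutuallySingularSetSlice _ _ _

theorem volume_singularSet (μ : Kernel Ω ℝ) [IsFiniteKernel μ] (ω : Ω) :
    volume (singularSet μ ω) = 0 :=
  gaussianReal_absolutelyContinuous' 0 one_ne_zero
    (Kernel.measure_mutuallySingularSetSlice μ (Kernel.const Ω (gaussianReal 0 1)) ω)

theorem restrict_compl_singularSet (μ : Kernel Ω ℝ) [IsFiniteKernel μ] (ω : Ω) :
    (μ ω).restrict (singularSet μ ω)ᶜ ≪ volume := by
  set η := Kernel.const Ω (gaussianReal 0 1)
  intro s hs
  have hηs : η ω s = 0 := gaussianReal_absolutelyContinuous 0 one_ne_zero hs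
  have hm := (measurableSet_singularSet μ ω).compl
  rw [Measure.restrict_apply₀' hm.nullMeasurableSet]
  nth_rewrite 1 [← Kernel.rnDeriv_add_singularPart μ η]
  rw [add_apply, Measure.add_apply, add_eq_zero]
  constructor
  · rw [Kernel.withDensity_apply _ (Kernel.measurable_rnDeriv μ η)]
    exact withDensity_absolutelyContinuous _ _ (measure_mono_null Set.inter_subset_left hηs)
  · exact measure_mono_null Set.inter_subset_right
      (Kernel.singularPart_compl_mutuallySingularSetSlice μ η ω)

theorem measurableSet_carrier_prod (μ : Kernel Ω ℝ) [IsFiniteKernel μ] (κ : SpectralType) :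
    MeasurableSet {p : Ω × ℝ | p.2 ∈ carrier (μ p.1) (singularSet μ p.1) κ} := by
  have h1 : MeasurableSet {p : Ω × ℝ | p.2 ∈ singularSet μ p.1} :=
    Kernel.measurableSet_mutuallySingularSet μ (Kernel.const Ω (gaussianReal 0 1))
  have h2 : MeasurableSet {p : Ω × ℝ | p.2 ∈ atoms (μ p.1)} := by
    -- `(ω, x) ↦ μ ω {x}` is the kernel mass of the slices of this diagonal, hence jointly
    -- measurable.
    have hd : MeasurableSet {q : (Ω × ℝ) × ℝ | q.2 = q.1.2} :=
      measurableSet_eq_fun measurable_snd (measurable_snd.comp measurable_fst)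
    have h := Kernel.measurable_kernel_prodMk_left
      (κ := μ.comap (Prod.fst : Ω × ℝ → Ω) measurable_fst) hd
    exact h (measurableSet_singleton 0).compl
  cases κ
  · exact h2
  · exact h1.diff h2
  · exact h1.compl

theorem measurableSet_measure_inter_carrier_ne_zero (μ : Kernel Ω ℝ) [IsFiniteKernel μ]
    (κ : SpectralType) {J : Set ℝ} (hJ : MeasurableSet J) :
    MeasurableSet {ω | μ ω (J ∩ carrier (μ ω) (singularSet μ ω) κ) ≠ 0} := by
  have h := Kernel.measurable_kernel_prodMk_left (κ := μ)
    ((measurable_snd hJ).inter (measurableSet_carrier_prod μ κ))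
  exact h (measurableSet_singleton 0).compl

theorem measurable_of_hasSum {ι : Type*} [Countable ι] {f : ι → Ω → ℂ} {g : Ω → ℂ}
    (hf : ∀ i, Measurable (f i)) (h : ∀ ω, HasSum (fun i => f i ω) (g ω)) : Measurable g := by
  classical
  refine measurable_of_tendsto_metrizable' (atTop : Filter (Finset ι))
    (f := fun s ω => ∑ i ∈ s, f i ω) (fun s => Finset.measurable_sum _ fun i _ => hf i)
    (tendsto_pi_nhds.2 fun ω => h ω)

/-- Weak measurability passes to products by inserting a countable basis between the factors:
Parseval writes the entry of `Aⁿ⁺¹` as a countable sum of products of entries of `Aⁿ` and `A`. -/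
theorem measurable_inner_pow {ι : Type*} [Countable ι] (b : HilbertBasis ι ℂ H)
    {A : Ω → H →L[ℂ] H} (hm : ∀ φ ψ : H, Measurable fun ω => ⟪φ, A ω ψ⟫_ℂ) (n : ℕ) (φ ψ : H) :
    Measurable fun ω => ⟪φ, (A ω ^ n) ψ⟫_ℂ := by
  induction n generalizing ψ with
  | zero => simp
  | succ n ih =>
    refine measurable_of_hasSum (f := fun i ω => ⟪φ, (A ω ^ n) (b i)⟫_ℂ * ⟪b i, A ω ψ⟫_ℂ)
      (fun i => (ih (b i)).mul (hm (b i) ψ)) fun ω => ?_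
    have h1 : ∀ v, ⟪φ, (A ω ^ n) v⟫_ℂ = ⟪(A ω ^ n).adjoint φ, v⟫_ℂ := fun v =>
      (ContinuousLinearMap.adjoint_inner_left _ _ _).symm
    simp only [pow_succ, mul_apply_eq_comp, h1]
    exact b.hasSum_inner_mul_inner _ _

theorem HilbertBasis.eq_zero_of_inner_eq_zero {ι E : Type*} [NormedAddCommGroup E]
    [InnerProductSpace ℂ E] (b : HilbertBasis ι ℂ E) {ψ : E}
    (h : ∀ i, ⟪b i, ψ⟫_ℂ = 0) : ψ = 0 := by
  have := b.hasSum_inner_mul_inner ψ ψ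
  simp only [h, mul_zero] at this
  exact inner_self_eq_zero.1 (this.unique hasSum_zero)

variable {P : Measure Ω} {Γ : Type*} [AddGroup Γ] {τ : Γ → Ω → Ω} {U : Γ → H ≃ₗᵢ[ℂ] H}
  {A : Ω → H →L[ℂ] H}

/-- The event that the spectral component of a random operator charges `J`. -/
def chargeEvent {Ω : Type*} (A : Ω → H →L[ℂ] H) (κ : SpectralType) (J : Set ℝ) : Set Ω :=
  {ω | ∃ φ ∈ spectralSubspace (A ω) κ, spectralMeasure (A ω) φ J ≠ 0}

theorem measurableSet_chargeEvent {ι : Type*} [Countable ι] (b : HilbertBasis ι ℂ H)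
    (hA : ∀ ω, IsSelfAdjoint (A ω)) (hm : ∀ φ ψ : H, Measurable fun ω => ⟪φ, A ω ψ⟫_ℂ)
    (κ : SpectralType) {J : Set ℝ} (hJ : MeasurableSet J) :
    MeasurableSet (chargeEvent A κ J) := by
  let μ : ι → Kernel Ω ℝ := fun i => ⟨fun ω => spectralMeasure (A ω) (b i),
    measurable_spectralMeasure hA fun n => measurable_inner_pow b hm n _ _⟩
  have hμ : ∀ i ω, μ i ω = spectralMeasure (A ω) (b i) := fun i ω => rfl
  have hfin : ∀ i, IsFiniteKernel (μ i) := fun i => ⟨1, ENNReal.one_lt_top, fun ω => by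
    have h1 := norm_sq_eq_spectralMeasure (hA ω) (b i)
    rw [b.orthonormal.1 i, one_pow, measureReal_def, eq_comm, ENNReal.toReal_eq_one_iff] at h1
    rw [hμ, h1]⟩
  have h1 : chargeEvent A κ J =
      ⋃ i, {ω | μ i ω (J ∩ carrier (μ i ω) (singularSet (μ i) ω) κ) ≠ 0} := by
    ext ω
    rw [Set.mem_iUnion]
    exact exists_mem_spectralSubspace_iff (hA ω) (fun ψ => HilbertBasis.eq_zero_of_inner_eq_zero b)
      (fun i => measurableSet_singularSet (μ i) ω) (fun i => volume_singularSet (μ i) ω)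
      (fun i => restrict_compl_singularSet (μ i) ω) κ hJ
  rw [h1]
  exact MeasurableSet.iUnion fun i => measurableSet_measure_inter_carrier_ne_zero (μ i) κ hJ

theorem mem_chargeEvent_of_conj {Ω : Type*} {A : Ω → H →L[ℂ] H} {κ : SpectralType} {J : Set ℝ}
    {ω ω' : Ω}
    (hω : IsSelfAdjoint (A ω)) (hω' : IsSelfAdjoint (A ω')) (V : H ≃ₗᵢ[ℂ] H)
    (h : ∀ φ, A ω' φ = V.symm (A ω (V φ))) :
    ω' ∈ chargeEvent A κ J ↔ ω ∈ chargeEvent A κ J := by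
  have hμ := spectralMeasure_conj hω V hω' h
  constructor
  · rintro ⟨φ, hφ, hne⟩
    have hφ' : κ.Holds (spectralMeasure (A ω') φ) := hφ
    rw [hμ φ] at hφ' hne
    exact ⟨V φ, hφ', hne⟩
  · rintro ⟨φ, hφ, hne⟩
    have h1 := hμ (V.symm φ)
    rw [V.apply_symm_apply] at h1
    have hφ' : κ.Holds (spectralMeasure (A ω) φ) := hφ
    rw [← h1] at hφ' hne
    exact ⟨V.symm φ, hφ', hne⟩

theorem IsErgodicRandomOperator.prob_chargeEvent (h : IsErgodicRandomOperator P τ U A)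
    {ι : Type*} [Countable ι] (b : HilbertBasis ι ℂ H) (κ : SpectralType) {J : Set ℝ}
    (hJ : MeasurableSet J) : P (chargeEvent A κ J) = 0 ∨ P (chargeEvent A κ J) = 1 := by
  refine h.ergodic _ (measurableSet_chargeEvent b h.isSelfAdjoint h.measurable_inner κ hJ)
    fun z => ?_
  ext ω
  rw [Set.mem_preimage]
  exact mem_chargeEvent_of_conj (A := A) (ω := ω) (ω' := τ z ω) (h.isSelfAdjoint ω)
    (h.isSelfAdjoint (τ z ω)) (U z) (h.covariant z ω)

/-- Rational endpoints reduce the component to countably many events, so that almost sure statements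
about the events can be combined. Non-real `E` are excluded because spectral measures live on `ℝ`.
-/
theorem spectralComponent_eq_image {Ω : Type*} {A : Ω → H →L[ℂ] H} (hA : ∀ ω, IsSelfAdjoint (A ω)) (κ : SpectralType) (ω : Ω) :
    spectralComponent (A ω) κ = Complex.ofReal ''
      {E : ℝ | ∀ a b : ℚ, (a : ℝ) < E → E < b → ω ∈ chargeEvent A κ (Set.Ioo a b)} := by
  ext E
  rw [mem_spectralComponent_iff (hA ω)]
  constructor
  · intro h
    have him : E.im = 0 := by
      by_contra hne
      obtain ⟨φ, -, hφ⟩ := h |E.im| (abs_pos.2 hne)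
      refine hφ (measure_mono_null (fun x hx => ?_) measure_empty)
      have h1 := Complex.abs_im_le_norm ((x : ℂ) - E)
      simp only [Complex.sub_im, Complex.ofReal_im, zero_sub, abs_neg] at h1
      exact absurd hx (not_lt.2 h1)
    have hE : E = (E.re : ℂ) := Complex.ext (by simp) (by simp [him])
    refine ⟨E.re, fun a b ha hb => ?_, hE.symm⟩
    obtain ⟨φ, hφ, hne⟩ := h (min (E.re - a) (b - E.re)) (lt_min (by linarith) (by linarith))
    refine ⟨φ, hφ, fun h0 => hne (measure_mono_null (fun x hx => ?_) h0)⟩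
    have hx' : ‖(x : ℂ) - E‖ < min (E.re - a) (b - E.re) := hx
    have hxE : (x : ℂ) - E = ((x - E.re : ℝ) : ℂ) := by rw [Complex.ofReal_sub, ← hE]
    rw [hxE, Complex.norm_real, Real.norm_eq_abs, lt_min_iff, abs_lt, abs_lt] at hx'
    constructor
    · linarith [hx'.1.1]
    · linarith [hx'.2.2]
  · rintro ⟨E, hE, rfl⟩ ε hε
    obtain ⟨a, ha, ha'⟩ := exists_rat_btwn (show E - ε < E by linarith)
    obtain ⟨b, hb, hb'⟩ := exists_rat_btwn (show E < E + ε by linarith)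
    obtain ⟨φ, hφ, hne⟩ := hE a b ha' hb
    refine ⟨φ, hφ, fun h0 => hne (measure_mono_null (fun x hx => ?_) h0)⟩
    rw [Set.mem_ofPred_eq, ← Complex.ofReal_sub, Complex.norm_real, Real.norm_eq_abs, abs_lt]
    exact ⟨by linarith [hx.1], by linarith [hx.2]⟩

/-- The spectral components of an ergodic random operator are almost surely non-random. -/
theorem IsErgodicRandomOperator.exists_spectralComponent_eq [IsProbabilityMeasure P]
    (h : IsErgodicRandomOperator P τ U A) {ι : Type*} [Countable ι] (b : HilbertBasis ι ℂ H)
    (κ : SpectralType) :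
    ∃ T : Set ℝ, IsClosed T ∧ ∀ᵐ ω ∂P, spectralComponent (A ω) κ = Complex.ofReal '' T := by
  -- The deterministic set is the random one with "the event occurs" replaced by "the event has
  -- probability one"; by the zero-one law the two agree almost surely for all rational intervals at
  -- once.
  refine ⟨{E : ℝ | ∀ a b : ℚ, (a : ℝ) < E → E < b → P (chargeEvent A κ (Set.Ioo a b)) = 1},
    ?_, ?_⟩
  · rw [← isOpen_compl_iff, isOpen_iff_mem_nhds]
    intro E hE
    obtain ⟨a, c, ha, hc, hne⟩ : ∃ a c : ℚ, (a : ℝ) < E ∧ E < c ∧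
        P (chargeEvent A κ (Set.Ioo (a : ℝ) c)) ≠ 1 := by
      by_contra! hcon
      exact hE hcon
    filter_upwards [Ioo_mem_nhds ha hc] with x hx hx'
    exact hne (hx' a c hx.1 hx.2)
  · have hae : ∀ᵐ ω ∂P, ∀ a b : ℚ, ω ∈ chargeEvent A κ (Set.Ioo (a : ℝ) b) ↔
        P (chargeEvent A κ (Set.Ioo (a : ℝ) b)) = 1 := by
      refine ae_all_iff.2 fun a => ae_all_iff.2 fun c => ?_
      have hms := measurableSet_chargeEvent b h.isSelfAdjoint h.measurable_inner κ
        (measurableSet_Ioo (a := (a : ℝ)) (b := c))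
      rcases h.prob_chargeEvent b κ (measurableSet_Ioo (a := (a : ℝ)) (b := c)) with h0 | h1
      · filter_upwards [measure_eq_zero_iff_ae_notMem.1 h0] with ω hω
        simp [hω, h0]
      · filter_upwards [(mem_ae_iff_prob_eq_one hms).2 h1] with ω hω
        simp [hω, h1]
    filter_upwards [hae] with ω hω
    simp only [spectralComponent_eq_image h.isSelfAdjoint, hω]

end RandomOperators

/-! ### Locality, symmetry and norm bound of the graph Laplacians. -/

section LatticeLaplacian

variable {d : ℕ}

/-- The finite set of nearest neighbours of the origin. -/
noncomputable def units (d : ℕ) : Finset (Vertex d) := (finite_unitVectors d).toFinset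

theorem mem_units {u : Vertex d} : u ∈ units d ↔ ∑ i, u i ^ 2 = 1 := by
  rw [units, Set.Finite.mem_toFinset]
  rfl

theorem neg_mem_units {u : Vertex d} : -u ∈ units d ↔ u ∈ units d := by
  simp [mem_units]

theorem sum_units_neg {M : Type*} [AddCommMonoid M] (f : Vertex d → M) :
    ∑ u ∈ units d, f (-u) = ∑ u ∈ units d, f u :=
  Finset.sum_nbij' (fun u => -u) (fun u => -u) (fun _ hu => neg_mem_units.2 hu)
    (fun _ hu => neg_mem_units.2 hu) (fun _ _ => neg_neg _) (fun _ _ => neg_neg _) fun _ _ => rfl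

theorem exists_eq_single_of_mem_units {u : Vertex d} (hu : u ∈ units d) :
    ∃ i, ∃ s : ℤ, (s = 1 ∨ s = -1) ∧ u = Pi.single i s := by
  have h := mem_units.1 hu
  obtain ⟨i, hi⟩ : ∃ i, u i ≠ 0 := by
    by_contra! h0
    simp [h0] at h
  have hle : ∀ j ≠ i, u i ^ 2 + u j ^ 2 ≤ 1 := fun j hj => by
    rw [← h, ← Finset.sum_pair (f := fun k => u k ^ 2) hj.symm]
    exact Finset.sum_le_sum_of_subset_of_nonneg (Finset.subset_univ _) fun _ _ _ => sq_nonneg _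
  have hi1 : 1 ≤ u i ^ 2 := by
    have : 0 < u i ^ 2 := by positivity
    linarith
  have hi2 : u i ^ 2 ≤ 1 := by
    rw [← h]
    exact Finset.single_le_sum (f := fun i => u i ^ 2) (fun j _ => sq_nonneg _) (Finset.mem_univ i)
  refine ⟨i, u i, mul_self_eq_one_iff.1 (by rw [← sq]; exact le_antisymm hi2 hi1), ?_⟩
  ext j
  by_cases hj : j = i
  · subst hj
    simp
  · rw [Pi.single_eq_of_ne hj]
    exact pow_eq_zero_iff two_ne_zero |>.1 (le_antisymm (by linarith [hle j hj]) (sq_nonneg _))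

theorem single_mem_units (i : Fin d) {s : ℤ} (hs : s = 1 ∨ s = -1) :
    (Pi.single i s : Vertex d) ∈ units d := by
  rw [mem_units, Finset.sum_eq_single i]
  · rcases hs with rfl | rfl <;> simp
  · intro j _ hj
    simp [Pi.single_eq_of_ne hj]
  · simp

theorem card_units (d : ℕ) : (units d).card = 2 * d := by
  have h : units d = (Finset.univ ×ˢ ({1, -1} : Finset ℤ)).image
      fun q : Fin d × ℤ => (Pi.single q.1 q.2 : Vertex d) := by
    ext u
    simp only [Finset.mem_image, Finset.mem_product, Finset.mem_univ, true_and, Finset.mem_insert,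
      Finset.mem_singleton, Prod.exists]
    constructor
    · intro hu
      obtain ⟨i, s, hs, rfl⟩ := exists_eq_single_of_mem_units hu
      exact ⟨i, s, hs, rfl⟩
    · rintro ⟨i, s, hs, rfl⟩
      exact single_mem_units i hs
  rw [h, Finset.card_image_of_injOn, Finset.card_product]
  · simp [mul_comm]
  · rintro ⟨i, s⟩ his ⟨j, t⟩ _ hst
    have hs : s ≠ 0 := by
      simp only [Finset.coe_product, Set.mem_prod, Finset.mem_coe, Finset.mem_insert,
        Finset.mem_singleton] at his
      rcases his.2 with h | h <;> simp [h]
    have h1 := congrFun hst i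
    simp only [Pi.single_eq_same] at h1
    by_cases hij : i = j
    · subst hij
      rw [Pi.single_eq_same] at h1
      rw [h1]
    · rw [Pi.single_eq_of_ne hij] at h1
      exact absurd h1 hs

open Classical in
theorem neighbors_eq_image {G : SimpleGraph (Vertex d)} (hG : G ≤ lattice d) (x : Vertex d) :
    neighbors hG x = ((units d).filter fun u => G.Adj x (x + u)).image (x + ·) := by
  ext y
  simp only [mem_neighbors, Finset.mem_image, Finset.mem_filter]
  constructor
  · intro h
    refine ⟨y - x, ⟨?_, by simpa using h⟩, by simp⟩
    rw [units, Set.Finite.mem_toFinset]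
    exact (lattice_adj_iff x y).1 (hG h)
  · rintro ⟨u, ⟨-, h⟩, rfl⟩
    exact h

open Classical in
theorem sum_neighbors {M : Type*} [AddCommMonoid M] {G : SimpleGraph (Vertex d)}
    (hG : G ≤ lattice d) (x : Vertex d) (f : Vertex d → M) :
    ∑ y ∈ neighbors hG x, f y = ∑ u ∈ units d, if G.Adj x (x + u) then f (x + u) else 0 := by
  rw [neighbors_eq_image, Finset.sum_image (fun u _ v _ h => add_left_cancel h),
    Finset.sum_filter]

open Classical in
theorem vertexDegree_eq_sum {G : SimpleGraph (Vertex d)} (hG : G ≤ lattice d) (x : Vertex d) :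
    vertexDegree hG x = ∑ u ∈ units d, if G.Adj x (x + u) then 1 else 0 := by
  rw [vertexDegree, Finset.card_eq_sum_ones, sum_neighbors]

theorem vertexDegree_le_two_mul {G : SimpleGraph (Vertex d)} (hG : G ≤ lattice d)
    (x : Vertex d) : vertexDegree hG x ≤ 2 * d := by
  rw [← card_units]
  exact vertexDegree_le hG x

/-- The diagonal entry of the Laplacian at a vertex of degree `n`. -/
noncomputable def diagonal (d : ℕ) (X : BoundaryCondition) (n : ℕ) : ℝ :=
  match X with
  | .neumann => n
  | .pseudoDirichlet => 2 * d
  | .dirichlet => 4 * d - n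

theorem laplacian_apply (X : BoundaryCondition) {G : SimpleGraph (Vertex d)} (hG : G ≤ lattice d)
    (φ : L2 d) (x : Vertex d) :
    laplacian X hG φ x = diagonal d X (vertexDegree hG x) * φ x - ∑ y ∈ neighbors hG x, φ y := by
  cases X
  · change (vertexDegree hG x : ℂ) * φ x - ∑ y ∈ neighbors hG x, φ y = _
    simp [diagonal]
  · change ((2 * d : ℂ) * φ x - (vertexDegree hG x : ℂ) * φ x) +
      ((vertexDegree hG x : ℂ) * φ x - ∑ y ∈ neighbors hG x, φ y) = _
    simp [diagonal]
  · change (2 : ℂ) * ((2 * d : ℂ) * φ x - (vertexDegree hG x : ℂ) * φ x) +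
      ((vertexDegree hG x : ℂ) * φ x - ∑ y ∈ neighbors hG x, φ y) = _
    simp only [diagonal]
    push_cast
    ring

/-- The right side counts the missing bonds at the vertex. This is all the norm bound needs to know
about the boundary condition. -/
theorem abs_diagonal_sub_le (X : BoundaryCondition) {n : ℕ} (hn : n ≤ 2 * d) :
    |diagonal d X n - 2 * d| ≤ 2 * d - n := by
  have h : (n : ℝ) ≤ 2 * d := by exact_mod_cast hn
  rw [abs_le]
  cases X <;> simp only [diagonal] <;> constructor <;> linarith

/-- The Laplacian commutes with translations as far as the graphs agree near the support. -/
theorem laplacian_translation (X : BoundaryCondition) {G G' : SimpleGraph (Vertex d)}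
    (hG : G ≤ lattice d) (hG' : G' ≤ lattice d) (z : Vertex d) (φ : L2 d)
    (h : ∀ x, φ x ≠ 0 → ∀ y, G'.Adj (x + z) (y + z) ↔ G.Adj x y) :
    laplacian X hG' (translation z φ) = translation z (laplacian X hG φ) := by
  classical
  ext v
  obtain ⟨x, rfl⟩ : ∃ x, v = x + z := ⟨v - z, by simp⟩
  rw [translation_apply, laplacian_apply, laplacian_apply, translation_apply, add_sub_cancel_right,
    sum_neighbors, sum_neighbors]
  congr 1
  · by_cases hx : φ x = 0
    · simp [hx]
    · have hdeg : vertexDegree hG' (x + z) = vertexDegree hG x := by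
        rw [vertexDegree_eq_sum, vertexDegree_eq_sum]
        refine Finset.sum_congr rfl fun u _ => ?_
        rw [add_right_comm, if_congr (h x hx (x + u)) rfl rfl]
      rw [hdeg]
  · refine Finset.sum_congr rfl fun u _ => ?_
    rw [translation_apply, add_right_comm, add_sub_cancel_right]
    by_cases hx : φ (x + u) = 0
    · simp [hx]
    · have hadj : G'.Adj (x + z) (x + u + z) ↔ G.Adj x (x + u) := by
        rw [SimpleGraph.adj_comm, h (x + u) hx x, SimpleGraph.adj_comm]
      rw [if_congr hadj rfl rfl]

theorem isSelfAdjoint_laplacian (X : BoundaryCondition) {G : SimpleGraph (Vertex d)}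
    (hG : G ≤ lattice d) : IsSelfAdjoint (laplacian X hG) := by
  classical
  have hmul : ∀ (f : Vertex d → ℂ) (C : ℝ) (hf : ∀ x, ‖f x‖ ≤ C),
      (∀ x, starRingEnd ℂ (f x) = f x) → ∀ φ ψ, ⟪mulOp f C hf φ, ψ⟫_ℂ = ⟪φ, mulOp f C hf ψ⟫_ℂ := by
    intro f C hf hreal φ ψ
    rw [lp.inner_eq_tsum, lp.inner_eq_tsum]
    refine tsum_congr fun x => ?_
    rw [mulOp_apply, mulOp_apply]
    simp only [RCLike.inner_apply, map_mul, hreal]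
    ring
  have htr : ∀ (u : Vertex d) (φ ψ : L2 d), ⟪translation (-u) φ, ψ⟫_ℂ = ⟪φ, translation u ψ⟫_ℂ := by
    intro u φ ψ
    rw [← (translation u).inner_map_map]
    congr 1
    ext x
    simp [translation_apply]
  have hA : ∀ φ ψ, ⟪adjacencyOp hG φ, ψ⟫_ℂ = ⟪φ, adjacencyOp hG ψ⟫_ℂ := by
    intro φ ψ
    -- The adjacency operator is a sum of cut-off translations; the adjoint of the term in direction
    -- `u` is the term in direction `-u`, by symmetry of adjacency.
    let a : Vertex d → Vertex d → ℂ := fun u x => if G.Adj x (x + u) then 1 else 0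
    have ha : ∀ u x, ‖a u x‖ ≤ 1 := fun u x => by
      simp only [a]
      split_ifs <;> simp
    have har : ∀ u x, starRingEnd ℂ (a u x) = a u x := fun u x => by
      simp only [a]
      split_ifs <;> simp
    have key : ∀ φ, adjacencyOp hG φ =
        ∑ u ∈ units d, mulOp (a u) 1 (ha u) (translation (-u) φ) := fun φ => by
      ext x
      rw [adjacencyOp_apply, sum_neighbors, lp.coeFn_sum, Finset.sum_apply]
      refine Finset.sum_congr rfl fun u _ => ?_
      rw [mulOp_apply, translation_apply, sub_neg_eq_add]
      simp only [a]
      split_ifs <;> simp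
    rw [key φ, key ψ, sum_inner, inner_sum, ← sum_units_neg]
    refine Finset.sum_congr rfl fun u _ => ?_
    rw [hmul _ _ _ (har _), htr]
    congr 1
    ext x
    rw [translation_apply, mulOp_apply, mulOp_apply, translation_apply, sub_neg_eq_add]
    congr 1
    simp only [a]
    rw [add_neg_cancel_right, SimpleGraph.adj_comm]
  have hD : ∀ φ ψ, ⟪degreeOp hG φ, ψ⟫_ℂ = ⟪φ, degreeOp hG ψ⟫_ℂ := fun φ ψ =>
    hmul _ _ _ (fun x => Complex.conj_natCast _) φ ψ
  rw [ContinuousLinearMap.isSelfAdjoint_iff_isSymmetric]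
  intro φ ψ
  have hc2 : starRingEnd ℂ (2 : ℂ) = 2 := map_ofNat (starRingEnd ℂ) 2
  have hc : starRingEnd ℂ (2 * d : ℂ) = 2 * d := by rw [map_mul, hc2, Complex.conj_natCast]
  cases X
  · change ⟪degreeOp hG φ - adjacencyOp hG φ, ψ⟫_ℂ = ⟪φ, degreeOp hG ψ - adjacencyOp hG ψ⟫_ℂ
    simp only [inner_sub_left, inner_sub_right, hA, hD]
  · change ⟪((2 * d : ℂ) • φ - degreeOp hG φ) + (degreeOp hG φ - adjacencyOp hG φ), ψ⟫_ℂ =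
      ⟪φ, ((2 * d : ℂ) • ψ - degreeOp hG ψ) + (degreeOp hG ψ - adjacencyOp hG ψ)⟫_ℂ
    simp only [inner_sub_left, inner_sub_right, inner_add_left, inner_add_right, inner_smul_left,
      inner_smul_right, hA, hD, hc]
  · change ⟪(2 : ℂ) • ((2 * d : ℂ) • φ - degreeOp hG φ) + (degreeOp hG φ - adjacencyOp hG φ), ψ⟫_ℂ =
      ⟪φ, (2 : ℂ) • ((2 * d : ℂ) • ψ - degreeOp hG ψ) + (degreeOp hG ψ - adjacencyOp hG ψ)⟫_ℂ
    simp only [inner_sub_left, inner_sub_right, inner_add_left, inner_add_right, inner_smul_left,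
      inner_smul_right, hA, hD, hc, hc2]

theorem summable_norm_sq (φ : L2 d) : Summable fun x => ‖φ x‖ ^ 2 :=
  (memLp_two_iff _).1 φ.2

/-- At each vertex every one of the `2d` directions contributes at most the neighbour's modulus
(bond present) or the vertex's own modulus (bond missing). Cauchy-Schwarz costs a factor `2d`, and
after summing over all vertices each direction contributes `‖φ‖²` on average over `u` and `-u`. -/
theorem norm_laplacian_sub_le (X : BoundaryCondition) {G : SimpleGraph (Vertex d)}
    (hG : G ≤ lattice d) (φ : L2 d) :
    ‖laplacian X hG φ - (2 * d : ℂ) • φ‖ ≤ 2 * d * ‖φ‖ := by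
  classical
  let t : Vertex d → Vertex d → ℝ := fun u x =>
    (if G.Adj x (x + u) then ‖φ (x + u)‖ ^ 2 else 0) +
      (if G.Adj x (x + u) then 0 else ‖φ x‖ ^ 2)
  have hpt : ∀ x, ‖(laplacian X hG φ - (2 * d : ℂ) • φ : L2 d) x‖ ^ 2 ≤
      2 * d * ∑ u ∈ units d, t u x := fun x => by
    let r : Vertex d → ℝ := fun u => if G.Adj x (x + u) then ‖φ (x + u)‖ else ‖φ x‖
    have h1 : (laplacian X hG φ - (2 * d : ℂ) • φ : L2 d) x =
        ((diagonal d X (vertexDegree hG x) - 2 * d : ℝ) : ℂ) * φ x -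
          ∑ u ∈ units d, if G.Adj x (x + u) then φ (x + u) else 0 := by
      change laplacian X hG φ x - (2 * d : ℂ) * φ x = _
      rw [laplacian_apply, sum_neighbors]
      push_cast
      ring
    have h2 : ‖(laplacian X hG φ - (2 * d : ℂ) • φ : L2 d) x‖ ≤ ∑ u ∈ units d, r u := by
      rw [h1]
      refine (norm_sub_le _ _).trans ?_
      have h3 : ‖((diagonal d X (vertexDegree hG x) - 2 * d : ℝ) : ℂ) * φ x‖ ≤
          ∑ u ∈ units d, if G.Adj x (x + u) then 0 else ‖φ x‖ := by
        rw [norm_mul, Complex.norm_real, Real.norm_eq_abs]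
        have h4 : (∑ u ∈ units d, if G.Adj x (x + u) then 0 else ‖φ x‖) =
            (2 * d - vertexDegree hG x) * ‖φ x‖ := by
          rw [vertexDegree_eq_sum]
          push_cast
          have h5 : (2 * d : ℝ) = ∑ u ∈ units d, (1 : ℝ) := by simp [card_units]
          rw [h5, ← Finset.sum_sub_distrib, Finset.sum_mul]
          refine Finset.sum_congr rfl fun u _ => ?_
          split_ifs <;> simp
        rw [h4]
        gcongr
        exact abs_diagonal_sub_le X (vertexDegree_le_two_mul hG x)
      refine (add_le_add h3 (norm_sum_le _ _)).trans (le_of_eq ?_)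
      rw [← Finset.sum_add_distrib]
      refine Finset.sum_congr rfl fun u _ => ?_
      simp only [r]
      split_ifs <;> simp
    calc ‖(laplacian X hG φ - (2 * d : ℂ) • φ : L2 d) x‖ ^ 2
        ≤ (∑ u ∈ units d, r u) ^ 2 := by gcongr
      _ ≤ (units d).card * ∑ u ∈ units d, r u ^ 2 := sq_sum_le_card_mul_sum_sq
      _ = 2 * d * ∑ u ∈ units d, t u x := by
        rw [card_units]
        push_cast
        congr 1
        refine Finset.sum_congr rfl fun u _ => ?_
        simp only [r, t]
        split_ifs <;> simp
  have hs := summable_norm_sq φ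
  have hs1 : ∀ u, Summable fun x => if G.Adj x (x + u) then ‖φ (x + u)‖ ^ 2 else 0 := fun u =>
    ((Equiv.addRight u).summable_iff.2 hs).of_nonneg_of_le
      (fun x => by split_ifs <;> positivity) fun x => by
        simp only [Function.comp, Equiv.coe_addRight]
        split_ifs
        · exact le_rfl
        · positivity
  have hs2 : ∀ u, Summable fun x => if G.Adj x (x + u) then 0 else ‖φ x‖ ^ 2 := fun u =>
    hs.of_nonneg_of_le (fun x => by split_ifs <;> positivity) fun x => by
      split_ifs
      · positivity
      · exact le_rfl
  have hs3 : ∀ u, Summable fun x => if G.Adj x (x + u) then ‖φ x‖ ^ 2 else 0 := fun u =>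
    hs.of_nonneg_of_le (fun x => by split_ifs <;> positivity) fun x => by
      split_ifs
      · exact le_rfl
      · positivity
  -- Re-indexing charges the neighbour's value to the neighbour itself, seen in direction `-u`; it
  -- then complements the missing-bond term of that direction.
  have hshift : ∀ u, (∑' x, if G.Adj x (x + u) then ‖φ (x + u)‖ ^ 2 else 0) =
      ∑' x, if G.Adj x (x + -u) then ‖φ x‖ ^ 2 else 0 := fun u => by
    rw [← (Equiv.addRight u).tsum_eq fun x => if G.Adj x (x + -u) then ‖φ x‖ ^ 2 else 0]
    refine tsum_congr fun x => ?_
    simp only [Equiv.coe_addRight, add_neg_cancel_right]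
    rw [SimpleGraph.adj_comm]
  refine le_of_sq_le_sq ?_ (by positivity)
  rw [norm_sq_eq_tsum]
  calc ∑' x, ‖(laplacian X hG φ - (2 * d : ℂ) • φ : L2 d) x‖ ^ 2
      ≤ ∑' x, 2 * d * ∑ u ∈ units d, t u x :=
        (summable_norm_sq _).tsum_le_tsum hpt
          ((summable_sum fun u _ => (hs1 u).add (hs2 u)).mul_left _)
    _ = 2 * d * ∑ u ∈ units d, ((∑' x, if G.Adj x (x + u) then ‖φ (x + u)‖ ^ 2 else 0) +
          ∑' x, if G.Adj x (x + u) then 0 else ‖φ x‖ ^ 2) := by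
        rw [tsum_mul_left, Summable.tsum_finsetSum fun u _ => (hs1 u).add (hs2 u)]
        congr 1
        exact Finset.sum_congr rfl fun u _ => (hs1 u).tsum_add (hs2 u)
    _ = 2 * d * ∑ u ∈ units d, ∑' x, ‖φ x‖ ^ 2 := by
        congr 1
        simp only [hshift]
        rw [Finset.sum_add_distrib,
          sum_units_neg fun u => ∑' x, if G.Adj x (x + u) then ‖φ x‖ ^ 2 else 0,
          ← Finset.sum_add_distrib]
        refine Finset.sum_congr rfl fun u _ => ?_
        rw [← (hs3 u).tsum_add (hs2 u)]
        refine tsum_congr fun x => ?_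
        split_ifs <;> simp
    _ = (2 * d * ‖φ‖) ^ 2 := by
        rw [← norm_sq_eq_tsum, Finset.sum_const, card_units]
        simp only [nsmul_eq_mul]
        push_cast
        ring

theorem spectrum_laplacian_subset (X : BoundaryCondition) {G : SimpleGraph (Vertex d)}
    (hG : G ≤ lattice d) :
    spectrum ℂ (laplacian X hG) ⊆ Complex.ofReal '' Set.Icc (0 : ℝ) (4 * d) := by
  intro E hE
  have hre := (isSelfAdjoint_laplacian X hG).mem_spectrum_eq_re hE
  refine ⟨E.re, ?_, hre.symm⟩
  have h1 : E - 2 * d ∈ spectrum ℂ (laplacian X hG - algebraMap ℂ (L2 d →L[ℂ] L2 d) (2 * d)) := by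
    rw [spectrum.mem_iff] at hE ⊢
    rwa [map_sub, sub_sub_sub_cancel_right]
  have h2 := spectrum.norm_le_norm_mul_of_mem h1
  have h3 : ‖laplacian X hG - algebraMap ℂ (L2 d →L[ℂ] L2 d) (2 * d)‖ ≤ 2 * d :=
    ContinuousLinearMap.opNorm_le_bound _ (by positivity) fun φ => norm_laplacian_sub_le X hG φ
  have h4 : ‖(1 : L2 d →L[ℂ] L2 d)‖ ≤ 1 := ContinuousLinearMap.norm_id_le
  have h5 : ‖E - 2 * d‖ ≤ 2 * d := by
    refine h2.trans ((mul_le_mul h3 h4 (norm_nonneg _) (by positivity)).trans ?_)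
    rw [mul_one]
  have h6 : |E.re - 2 * d| ≤ 2 * d := by
    have := (Complex.abs_re_le_norm (E - 2 * d)).trans h5
    simpa using this
  rw [abs_le] at h6
  exact ⟨by linarith [h6.1], by linarith [h6.2]⟩

end LatticeLaplacian

/-! ### Approximate, finitely supported and cluster-supported eigenvectors. -/

section Eigenvectors

variable {d : ℕ}

/-- The cube of side length `2 n + 1` around the origin. -/
noncomputable def cube (d n : ℕ) : Finset (Vertex d) := Finset.Icc (fun _ => -(n : ℤ)) fun _ => (n : ℤ)

theorem mem_cube {n : ℕ} {x : Vertex d} : x ∈ cube d n ↔ ∀ i, -(n : ℤ) ≤ x i ∧ x i ≤ n := by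
  simp only [cube, Finset.mem_Icc, Pi.le_def, forall_and]

theorem card_cube (d n : ℕ) : (cube d n).card = (2 * n + 1) ^ d := by
  rw [cube, Pi.card_Icc]
  simp only [Int.card_Icc, Finset.prod_const, Finset.card_univ, Fintype.card_fin]
  congr 1
  omega

theorem cube_subset_cube {m n : ℕ} (h : m ≤ n) : cube d m ⊆ cube d n := fun x hx => by
  rw [mem_cube] at hx ⊢
  intro i
  have := hx i
  omega

theorem add_mem_cube {n : ℕ} {x u : Vertex d} (hx : x ∈ cube d n) (hu : u ∈ units d) :
    x + u ∈ cube d (n + 1) := by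
  rw [mem_cube] at hx ⊢
  intro i
  have h1 := hx i
  have h2 : -1 ≤ u i ∧ u i ≤ 1 := by
    obtain ⟨j, s, hs, rfl⟩ := exists_eq_single_of_mem_units hu
    by_cases hij : i = j
    · subst hij
      rw [Pi.single_eq_same]
      omega
    · rw [Pi.single_eq_of_ne hij]
      omega
  rw [Pi.add_apply]
  push_cast
  omega

/-- Boundary over volume: relative to the cube of side `2k + 3`, the two neighbouring cubes have
volumes `(1 ± 2/(2k+3))^d`, both tending to `1`. -/
theorem exists_shell_small (d : ℕ) (C : ℝ) {ε : ℝ} (hε : 0 < ε) :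
    ∃ k : ℕ, C * ((2 * ((k + 2 : ℕ) : ℝ) + 1) ^ d - (2 * (k : ℝ) + 1) ^ d) ≤
      ε * (2 * ((k + 1 : ℕ) : ℝ) + 1) ^ d := by
  have h0 : Tendsto (fun k : ℕ => 2 / (2 * (k : ℝ) + 3)) atTop (𝓝 0) := by
    refine Tendsto.const_div_atTop ?_ 2
    exact tendsto_atTop_add_const_right _ _
      (tendsto_natCast_atTop_atTop.const_mul_atTop (by norm_num))
  have h1 : Tendsto (fun k : ℕ => C * ((1 + 2 / (2 * (k : ℝ) + 3)) ^ d -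
      (1 - 2 / (2 * (k : ℝ) + 3)) ^ d)) atTop (𝓝 (C * ((1 + 0) ^ d - (1 - 0) ^ d))) :=
    (((h0.const_add 1).pow d).sub ((h0.const_sub 1).pow d)).const_mul C
  simp only [add_zero, sub_zero, sub_self, mul_zero] at h1
  obtain ⟨k, hk⟩ := (h1.eventually (gt_mem_nhds hε)).exists
  refine ⟨k, ?_⟩
  have hpos : (0 : ℝ) < 2 * k + 3 := by positivity
  have e1 : 2 * ((k + 2 : ℕ) : ℝ) + 1 = (1 + 2 / (2 * (k : ℝ) + 3)) * (2 * k + 3) := by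
    push_cast
    field_simp
    ring
  have e2 : 2 * (k : ℝ) + 1 = (1 - 2 / (2 * (k : ℝ) + 3)) * (2 * k + 3) := by
    field_simp
    ring
  have e3 : 2 * ((k + 1 : ℕ) : ℝ) + 1 = 2 * k + 3 := by
    push_cast
    ring
  rw [e1, e2, e3, mul_pow, mul_pow, ← sub_mul, ← mul_assoc]
  gcongr

/-- The phase `exp(iθ(x₁ + ⋯ + x_d))` of a diagonal plane wave. -/
noncomputable def planeWave (θ : ℝ) (x : Vertex d) : ℂ :=
  Complex.exp (((θ * ((∑ i, x i : ℤ) : ℝ) : ℝ) : ℂ) * Complex.I)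

theorem norm_planeWave (θ : ℝ) (x : Vertex d) : ‖planeWave θ x‖ = 1 :=
  Complex.norm_exp_ofReal_mul_I _

theorem planeWave_add (θ : ℝ) (x y : Vertex d) :
    planeWave θ (x + y) = planeWave θ y * planeWave θ x := by
  rw [planeWave, planeWave, planeWave, ← Complex.exp_add]
  congr 1
  simp only [Pi.add_apply, Finset.sum_add_distrib]
  push_cast
  ring

theorem sum_planeWave_units (d : ℕ) (θ : ℝ) :
    ∑ u ∈ units d, planeWave θ u = ((2 * d * Real.cos θ : ℝ) : ℂ) := by
  have h1 : ∀ u ∈ units d, planeWave θ u + planeWave θ (-u) = 2 * Complex.cos θ := by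
    intro u hu
    obtain ⟨i, s, hs, rfl⟩ := exists_eq_single_of_mem_units hu
    have h2 : ∑ j, (Pi.single i s : Vertex d) j = s := by
      rw [Finset.sum_eq_single i (fun j _ hj => Pi.single_eq_of_ne hj _) (by simp),
        Pi.single_eq_same]
    simp only [planeWave, Pi.neg_apply, Finset.sum_neg_distrib, h2]
    rw [Complex.two_cos]
    rcases hs with rfl | rfl
    · simp
    · simp [add_comm]
  have h3 : (2 : ℂ) * ∑ u ∈ units d, planeWave θ u = 2 * ((2 * d * Real.cos θ : ℝ) : ℂ) := by
    rw [two_mul]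
    nth_rewrite 2 [← sum_units_neg]
    rw [← Finset.sum_add_distrib, Finset.sum_congr rfl h1, Finset.sum_const, card_units,
      nsmul_eq_mul]
    push_cast
    ring
  exact mul_left_cancel₀ two_ne_zero h3

/-- The function with finite support `s` and values `f`, as a vector of `ℓ²`. -/
noncomputable def cutoff (s : Finset (Vertex d)) (f : Vertex d → ℂ) : L2 d :=
  ⟨(s : Set (Vertex d)).indicator f, (memLp_two_iff _).2 <|
    summable_of_ne_finset_zero (s := s) fun x hx => by
      simp [Set.indicator_of_notMem (show x ∉ (s : Set (Vertex d)) from hx)]⟩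

theorem cutoff_of_mem {s : Finset (Vertex d)} {f : Vertex d → ℂ} {x : Vertex d} (hx : x ∈ s) :
    cutoff s f x = f x :=
  Set.indicator_of_mem (show x ∈ (s : Set (Vertex d)) from hx) f

theorem cutoff_of_notMem {s : Finset (Vertex d)} {f : Vertex d → ℂ} {x : Vertex d} (hx : x ∉ s) :
    cutoff s f x = 0 :=
  Set.indicator_of_notMem (show x ∉ (s : Set (Vertex d)) from hx) f

theorem vertexDegree_of_lattice_le {G : SimpleGraph (Vertex d)} (hG : G ≤ lattice d)
    (hG' : lattice d ≤ G) (x : Vertex d) : vertexDegree hG x = 2 * d := by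
  classical
  rw [vertexDegree_eq_sum, ← card_units, Finset.card_eq_sum_ones]
  refine Finset.sum_congr rfl fun u hu => ?_
  rw [if_pos]
  refine hG' ((lattice_adj_iff _ _).2 ?_)
  rw [add_sub_cancel_left]
  exact (finite_unitVectors d).mem_toFinset.1 hu

theorem laplacian_apply_of_lattice_le (X : BoundaryCondition) {G : SimpleGraph (Vertex d)}
    (hG : G ≤ lattice d) (hG' : lattice d ≤ G) (φ : L2 d) (x : Vertex d) :
    laplacian X hG φ x = 2 * d * φ x - ∑ u ∈ units d, φ (x + u) := by
  classical
  rw [laplacian_apply, sum_neighbors, vertexDegree_of_lattice_le hG hG']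
  congr 1
  · congr 1
    cases X
    · simp [diagonal]
    · simp [diagonal]
    · simp only [diagonal]
      push_cast
      ring
  · refine Finset.sum_congr rfl fun u hu => ?_
    rw [if_pos]
    refine hG' ((lattice_adj_iff _ _).2 ?_)
    rw [add_sub_cancel_left]
    exact (finite_unitVectors d).mem_toFinset.1 hu

/-- Truncated plane waves are approximate eigenvectors of the Laplacian of the full lattice. -/
theorem exists_finite_support_approx_eigenvector (hd : 1 ≤ d) (X : BoundaryCondition)
    {G : SimpleGraph (Vertex d)} (hG : G ≤ lattice d) (hG' : lattice d ≤ G) {E : ℝ}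
    (hE : E ∈ Set.Icc (0 : ℝ) (4 * d)) {ε : ℝ} (hε : 0 < ε) :
    ∃ φ : L2 d, φ ≠ 0 ∧ {x | φ x ≠ 0}.Finite ∧
      ‖laplacian X hG φ - (E : ℂ) • φ‖ ≤ ε * ‖φ‖ := by
  have hd0 : (0 : ℝ) < d := by exact_mod_cast hd
  -- The diagonal plane wave has energy `2d - 2d cos θ`, which covers `[0, 4d]`.
  obtain ⟨θ, hθ⟩ : ∃ θ : ℝ, 2 * d * Real.cos θ = 2 * d - E := by
    refine ⟨Real.arccos ((2 * d - E) / (2 * d)), ?_⟩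
    rw [Real.cos_arccos]
    · field_simp
    · rw [le_div_iff₀ (by positivity)]
      linarith [hE.2]
    · rw [div_le_one (by positivity)]
      linarith [hE.1]
  -- The error at a vertex is a sum over `2d` directions of terms of modulus at most `2`, whence
  -- `(4d)²` after squaring.
  obtain ⟨k, hk⟩ := exists_shell_small d ((4 * d) ^ 2) (show 0 < ε ^ 2 by positivity)
  let φ : L2 d := cutoff (cube d (k + 1)) (planeWave θ)
  have hnorm : ‖φ‖ ^ 2 = (2 * ((k + 1 : ℕ) : ℝ) + 1) ^ d := by
    rw [norm_sq_eq_tsum, tsum_eq_sum (s := cube d (k + 1))]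
    · rw [Finset.sum_congr rfl fun x hx => by
        rw [show φ x = _ from cutoff_of_mem hx, norm_planeWave, one_pow]]
      rw [Finset.sum_const, card_cube, nsmul_eq_mul, mul_one]
      push_cast
      rfl
    · intro x hx
      rw [show φ x = 0 from cutoff_of_notMem hx]
      simp
  have hle : ∀ x, ‖φ x‖ ≤ 1 := fun x => by
    by_cases hx : x ∈ cube d (k + 1)
    · rw [show φ x = _ from cutoff_of_mem hx, norm_planeWave]
    · rw [show φ x = 0 from cutoff_of_notMem hx]
      simp
  have hval : ∀ x, (laplacian X hG φ - (E : ℂ) • φ : L2 d) x =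
      ∑ u ∈ units d, (planeWave θ u * φ x - φ (x + u)) := fun x => by
    change laplacian X hG φ x - (E : ℂ) * φ x = _
    rw [laplacian_apply_of_lattice_le X hG hG', Finset.sum_sub_distrib, ← Finset.sum_mul,
      sum_planeWave_units, hθ]
    push_cast
    ring
  -- Well inside the cube the eigenvalue equation is exact, and far outside everything vanishes;
  -- only the shell around the boundary sees the truncation.
  have hval0 : ∀ x ∉ cube d (k + 2) \ cube d k,
      (laplacian X hG φ - (E : ℂ) • φ : L2 d) x = 0 := fun x hx => by
    rw [hval]
    refine Finset.sum_eq_zero fun u hu => ?_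
    by_cases hxk : x ∈ cube d k
    · rw [show φ x = _ from cutoff_of_mem (cube_subset_cube (Nat.le_succ k) hxk),
        show φ (x + u) = _ from cutoff_of_mem (add_mem_cube hxk hu), planeWave_add, sub_self]
    · have hx2 : x ∉ cube d (k + 2) := fun h => hx (Finset.mem_sdiff.2 ⟨h, hxk⟩)
      rw [show φ x = 0 from cutoff_of_notMem fun h => hx2 (cube_subset_cube (Nat.le_succ _) h),
        show φ (x + u) = 0 from cutoff_of_notMem fun h => hx2 ?_]
      · simp
      · have := add_mem_cube h (neg_mem_units.2 hu)
        rwa [add_neg_cancel_right] at this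
  have hvalle : ∀ x, ‖(laplacian X hG φ - (E : ℂ) • φ : L2 d) x‖ ^ 2 ≤ (4 * d) ^ 2 := fun x => by
    gcongr
    rw [hval]
    refine (norm_sum_le_of_le (f := fun u => planeWave θ u * φ x - φ (x + u)) (units d)
      (n := fun _ => 2) fun u _ => ?_).trans ?_
    · refine (norm_sub_le _ _).trans ?_
      rw [norm_mul, norm_planeWave, one_mul]
      linarith [hle x, hle (x + u)]
    · rw [Finset.sum_const, card_units, nsmul_eq_mul]
      push_cast
      linarith
  refine ⟨φ, ?_, ?_, ?_⟩
  · intro h0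
    rw [h0, norm_zero, zero_pow two_ne_zero] at hnorm
    exact absurd hnorm (by positivity)
  · refine (cube d (k + 1)).finite_toSet.subset fun x hx => ?_
    by_contra h
    exact hx (cutoff_of_notMem h)
  · refine le_of_sq_le_sq ?_ (by positivity)
    rw [mul_pow, hnorm]
    refine le_trans ?_ hk
    rw [norm_sq_eq_tsum, tsum_eq_sum (s := cube d (k + 2) \ cube d k)]
    · refine (Finset.sum_le_card_nsmul _ _ _ fun x _ => hvalle x).trans (le_of_eq ?_)
      rw [nsmul_eq_mul, mul_comm, Finset.card_sdiff_of_subset (cube_subset_cube (by omega)),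
        Nat.cast_sub (Finset.card_le_card (cube_subset_cube (by omega))), card_cube, card_cube]
      push_cast
      rfl
    · intro x hx
      rw [hval0 x hx]
      simp

theorem inner_single_one (x : Vertex d) (φ : L2 d) :
    ⟪(lp.single 2 x (1 : ℂ) : L2 d), φ⟫_ℂ = φ x := by
  rw [lp.inner_single_left]
  simp

theorem continuous_apply_L2 (x : Vertex d) : Continuous fun φ : L2 d => φ x := by
  simp only [← inner_single_one]
  fun_prop

/-- Infinitely many translates of a finitely supported vector span an infinite-dimensional space. -/
theorem not_finiteDimensional_of_translation_mem {V : Submodule ℂ (L2 d)} {φ : L2 d} (hφ : φ ≠ 0)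
    (hfin : {x | φ x ≠ 0}.Finite) {Z : Set (Vertex d)} (hZ : Z.Infinite)
    (h : ∀ z ∈ Z, translation z φ ∈ V) : ¬ FiniteDimensional ℂ V := by
  intro hV
  have hproper : ProperSpace V := FiniteDimensional.proper ℂ V
  let z := hZ.natEmbedding
  let v : ℕ → V := fun n => ⟨translation (z n : Vertex d) φ, h _ (z n).2⟩
  have hv : ∀ n, ‖v n‖ = ‖φ‖ := fun n => (translation (z n : Vertex d)).norm_map φ
  -- In a finite-dimensional space the translates would have a norm-convergent subsequence. Its
  -- limit has norm `‖φ‖`, yet vanishes pointwise because the supports escape every fixed vertex.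
  obtain ⟨a, -, k, hk, ha⟩ := (isCompact_closedBall (0 : V) ‖φ‖).tendsto_subseq (x := v)
    fun n => mem_closedBall_zero_iff.2 (hv n).le
  have hna : ‖a‖ = ‖φ‖ := by
    refine tendsto_nhds_unique ha.norm ?_
    simp only [Function.comp, hv]
    exact tendsto_const_nhds
  have hzero : (a : L2 d) = 0 := by
    ext x
    have h1 : Tendsto (fun n => (v (k n) : L2 d) x) atTop (𝓝 ((a : L2 d) x)) :=
      (((continuous_apply_L2 x).comp continuous_subtype_val).tendsto a).comp ha
    refine tendsto_nhds_unique h1 ?_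
    refine Tendsto.congr' ?_ tendsto_const_nhds
    have hf : {n : ℕ | φ (x - z (k n)) ≠ 0}.Finite := by
      refine (hfin.preimage (f := fun n : ℕ => x - (z (k n) : Vertex d)) ?_)
      intro m _ n _ hmn
      exact hk.injective (z.injective (Subtype.ext (sub_right_injective hmn)))
    have := hf.compl_mem_cofinite
    rw [Nat.cofinite_eq_atTop] at this
    filter_upwards [this] with n hn
    exact (not_not.1 hn).symm
  have : ‖φ‖ = 0 := by
    rw [← hna]
    exact congrArg norm hzero |>.trans norm_zero
  exact hφ (norm_eq_zero.1 this)

open Classical in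
/-- Multiplication by the indicator function of a set of vertices. -/
noncomputable def restrictTo (C : Set (Vertex d)) : L2 d →L[ℂ] L2 d :=
  mulOp (fun x => if x ∈ C then 1 else 0) 1 fun x => by split_ifs <;> simp

theorem restrictTo_of_mem {C : Set (Vertex d)} {x : Vertex d} (hx : x ∈ C) (φ : L2 d) :
    restrictTo C φ x = φ x := by
  rw [restrictTo, mulOp_apply, if_pos hx, one_mul]

theorem restrictTo_of_notMem {C : Set (Vertex d)} {x : Vertex d} (hx : x ∉ C) (φ : L2 d) :
    restrictTo C φ x = 0 := by
  rw [restrictTo, mulOp_apply, if_neg hx, zero_mul]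

theorem laplacian_restrictTo (X : BoundaryCondition) {G : SimpleGraph (Vertex d)}
    (hG : G ≤ lattice d) {C : Set (Vertex d)} (hC : ∀ x y, G.Adj x y → (x ∈ C ↔ y ∈ C))
    (φ : L2 d) : laplacian X hG (restrictTo C φ) = restrictTo C (laplacian X hG φ) := by
  ext x
  have hy : ∀ y ∈ neighbors hG x, (x ∈ C ↔ y ∈ C) := fun y hy => hC x y ((mem_neighbors hG x y).1 hy)
  by_cases hx : x ∈ C
  · rw [restrictTo_of_mem hx, laplacian_apply, laplacian_apply, restrictTo_of_mem hx]
    congr 1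
    exact Finset.sum_congr rfl fun y h => restrictTo_of_mem ((hy y h).1 hx) φ
  · rw [restrictTo_of_notMem hx, laplacian_apply, restrictTo_of_notMem hx, mul_zero,
      Finset.sum_eq_zero fun y h => restrictTo_of_notMem (fun hyC => hx ((hy y h).2 hyC)) φ,
      sub_zero]

/-- Vectors supported on a finite union of connected components belong to the pure point
subspace. -/
theorem mem_pp_of_restrictTo_eq (X : BoundaryCondition) {G : SimpleGraph (Vertex d)}
    (hG : G ≤ lattice d) {C : Set (Vertex d)} (hC : ∀ x y, G.Adj x y → (x ∈ C ↔ y ∈ C))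
    (hfin : C.Finite) {φ : L2 d} (hφ : restrictTo C φ = φ) :
    φ ∈ spectralSubspace (laplacian X hG) .pp := by
  set A := laplacian X hG
  have hcomm : Commute (restrictTo C) A :=
    ContinuousLinearMap.ext fun ψ => (laplacian_restrictTo X hG hC ψ).symm
  have hcomm' : ∀ q : Polynomial ℝ, Commute (restrictTo C) (Polynomial.aeval A q) := fun q => by
    rw [Polynomial.aeval_eq_sum_range]
    exact Commute.sum_right _ _ _ fun n _ => (hcomm.pow_right n).smul_right _
  have hinv : ∀ q : Polynomial ℝ, restrictTo C (Polynomial.aeval A q φ) =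
      Polynomial.aeval A q φ := fun q => by
    have h1 := congrArg (fun T : L2 d →L[ℂ] L2 d => T φ) (hcomm' q).eq
    simp only [mul_apply_eq_comp, hφ] at h1
    exact h1
  have hCf : Finite C := hfin
  let f : Polynomial ℝ →ₗ[ℝ] (C → ℂ) :=
    { toFun := fun q y => Polynomial.aeval A q φ y
      map_add' := fun q r => by
        ext y
        rw [map_add]
        rfl
      map_smul' := fun c q => by
        ext y
        rw [map_smul]
        rfl }
  -- The polynomials are infinite-dimensional while functions on the finite set `C` are not, so some
  -- nonzero `q` has `q(A)φ = 0` on `C`; off `C` this holds by commutation with the restriction.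
  have hf : ¬ Function.Injective f := fun h =>
    Polynomial.not_finite (Module.Finite.of_injective f h)
  rw [injective_iff_map_eq_zero] at hf
  push Not at hf
  obtain ⟨q, hq, hq0⟩ := hf
  refine mem_pp_of_aeval_eq_zero (isSelfAdjoint_laplacian X hG) hq0 ?_
  ext y
  by_cases hy : y ∈ C
  · exact congrFun hq ⟨y, hy⟩
  · exact (congrArg (fun ψ : L2 d => ψ y) (hinv q)).symm.trans (restrictTo_of_notMem hy _)

end Eigenvectors

/-! ### Ergodicity of the shifts and recurrence of finite patterns. -/

section PercolationMeasure

variable {d : ℕ}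

theorem Edge.shift_zero (e : Edge d) : e.shift 0 = e := by
  obtain ⟨e, he⟩ := e
  induction e with
  | _ x y => exact Subtype.ext (by simp [Edge.shift])

theorem Edge.shift_shift (z w : Vertex d) (e : Edge d) :
    (e.shift z).shift w = e.shift (z + w) := by
  obtain ⟨e, he⟩ := e
  induction e with
  | _ x y => exact Subtype.ext (by simp [Edge.shift, add_assoc])

/-- Translation by `z` as a permutation of the edges. -/
def Edge.shiftEquiv (z : Vertex d) : Edge d ≃ Edge d where
  toFun e := e.shift z
  invFun e := e.shift (-z)
  left_inv e := by
    change (e.shift z).shift (-z) = e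
    rw [Edge.shift_shift, add_neg_cancel, Edge.shift_zero]
  right_inv e := by
    change (e.shift (-z)).shift z = e
    rw [Edge.shift_shift, neg_add_cancel, Edge.shift_zero]

theorem Config.shift_zero (ω : Config d) : Config.shift 0 ω = ω :=
  funext fun e => congrArg ω e.shift_zero

theorem Config.shift_add (z w : Vertex d) (ω : Config d) :
    Config.shift (z + w) ω = Config.shift z (Config.shift w ω) :=
  funext fun e => congrArg ω (e.shift_shift z w).symm

theorem Config.shift_iterate (z : Vertex d) (n : ℕ) :
    (Config.shift z)^[n] = Config.shift (n • z) := by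
  induction n with
  | zero =>
    ext1 ω
    rw [zero_smul, Config.shift_zero]
    rfl
  | succ n ih =>
    ext1 ω
    rw [Function.iterate_succ_apply', ih, ← Config.shift_add, succ_nsmul']

theorem measurable_shift (z : Vertex d) : Measurable (Config.shift z) :=
  measurable_pi_lambda _ fun e => measurable_pi_apply (e.shift z)

instance (p : I) : IsProbabilityMeasure (percMeasure d p) := by
  unfold percMeasure
  infer_instance

theorem measurePreserving_shift (p : I) (z : Vertex d) :
    MeasurePreserving (Config.shift z) (percMeasure d p) (percMeasure d p) := by
  refine ⟨measurable_shift z, ?_⟩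
  -- `piCongrLeft` composes a configuration with the inverse permutation, so the shift by `z`
  -- corresponds to the edge translation by `-z`.
  have h := Measure.infinitePi_map_piCongrLeft (X := fun _ : Edge d => Bool)
    (fun _ : Edge d => bernoulliMeasure true false p) (Edge.shiftEquiv (-z))
  have h1 : (MeasurableEquiv.piCongrLeft (fun _ : Edge d => Bool) (Edge.shiftEquiv (-z)) :
      Config d → Config d) = Config.shift z := by
    ext ω e
    obtain ⟨e', rfl⟩ := (Edge.shiftEquiv (-z)).surjective e
    have h2 := Equiv.piCongrLeft_apply_apply (fun _ : Edge d => Bool) (Edge.shiftEquiv (-z)) ω e'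
    refine h2.trans ?_
    change ω e' = ω ((e'.shift (-z)).shift z)
    rw [Edge.shift_shift, neg_add_cancel, Edge.shift_zero]
  rw [h1] at h
  exact h

/-- The translations moving one edge to another are finitely many. -/
theorem finite_shift_eq (e e' : Edge d) : {z : Vertex d | e.shift z = e'}.Finite := by
  obtain ⟨e, he⟩ := e
  obtain ⟨e', he'⟩ := e'
  induction e with
  | _ x y =>
    induction e' with
    | _ x' y' =>
      refine (Set.toFinite {x' - x, y' - x}).subset fun z hz => ?_
      have h : s(x + z, y + z) = s(x', y') := congrArg Subtype.val hz
      rw [Sym2.eq_iff] at h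
      rcases h with ⟨h, -⟩ | ⟨h, -⟩
      · exact .inl (by rw [← h, add_sub_cancel_left])
      · exact .inr (by rw [Set.mem_singleton_iff, ← h, add_sub_cancel_left])

theorem infinite_vertex (hd : 1 ≤ d) : Infinite (Vertex d) := by
  have : Nonempty (Fin d) := ⟨⟨0, hd⟩⟩
  exact Function.infinite_of_right

/-- Each pair of edges of `F` rules out finitely many translations, and `ℤ^d` is infinite. -/
theorem exists_shift_disjoint (hd : 1 ≤ d) (F : Finset (Edge d)) :
    ∃ z : Vertex d, ∀ e ∈ F, e.shift z ∉ F := by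
  have := infinite_vertex hd
  have hfin : (⋃ e ∈ F, ⋃ e' ∈ F, {z : Vertex d | e.shift z = e'}).Finite :=
    F.finite_toSet.biUnion fun e _ => F.finite_toSet.biUnion fun e' _ => finite_shift_eq e e'
  obtain ⟨z, hz⟩ := hfin.infinite_compl.nonempty
  refine ⟨z, fun e he he' => hz ?_⟩
  simp only [Set.mem_iUnion]
  exact ⟨e, he, e.shift z, he', rfl⟩

theorem measure_cylinder_inter_shift (p : I) {F : Finset (Edge d)} {z : Vertex d}
    (hz : ∀ e ∈ F, e.shift z ∉ F) {S : Set (F → Bool)} (hS : MeasurableSet S) :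
    percMeasure d p (cylinder F S ∩ Config.shift z ⁻¹' cylinder F S) =
      percMeasure d p (cylinder F S) * percMeasure d p (cylinder F S) := by
  classical
  let F' := F.image (Edge.shift z)
  have hdisj : Disjoint F F' := Finset.disjoint_left.2 fun e he he' => by
    obtain ⟨e', he1, rfl⟩ := Finset.mem_image.1 he'
    exact hz e' he1 he
  have hind := iIndepFun.indepFun_finset F F' hdisj
    (iIndepFun_infinitePi (P := fun _ : Edge d => bernoulliMeasure true false p)
      (X := fun _ b => b) fun _ => measurable_id) fun e => measurable_pi_apply e
  let r : (F' → Bool) → F → Bool := fun g e => g ⟨e.1.shift z, Finset.mem_image_of_mem _ e.2⟩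
  have hr : Measurable r := measurable_pi_lambda _ fun e => measurable_pi_apply _
  have h := hind.measure_inter_preimage_eq_mul S (r ⁻¹' S) hS (hr hS)
  have hpre := (measurePreserving_shift p z).measure_preimage
    (MeasurableSet.cylinder (α := fun _ : Edge d => Bool) F hS).nullMeasurableSet
  conv_rhs => arg 2; rw [← hpre]
  exact h

/-- Approximate `s` by a cylinder `t` and shift it onto disjoint edges: by independence `P(t ∩ τ_z⁻¹
t) = P(t)²`, and invariance of `s` gives `P(s) = P(s)²` in the limit. Replacing the intersection
costs `2ε` and replacing the square another `2ε`. -/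
theorem ergodic_shift (hd : 1 ≤ d) (p : I) {s : Set (Config d)} (hs : MeasurableSet s)
    (hinv : ∀ z, Config.shift z ⁻¹' s = s) :
    percMeasure d p s = 0 ∨ percMeasure d p s = 1 := by
  set P := percMeasure d p
  have key : ∀ ε > 0, |P.real s - P.real s * P.real s| ≤ 4 * ε := fun ε hε => by
    obtain ⟨t, ht, hts⟩ := exists_measure_symmDiff_lt_of_generateFrom_isSetRing (μ := P)
      isSetAlgebra_measurableCylinders.isSetRing
      ⟨{Set.univ}, Set.countable_singleton _, by
        rw [Set.singleton_subset_iff]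
        exact univ_mem_measurableCylinders _, by simp⟩
      generateFrom_measurableCylinders.symm hs (ENNReal.ofReal_pos.2 hε)
    obtain ⟨F, S, hS, rfl⟩ := (mem_measurableCylinders _).1 ht
    obtain ⟨z, hz⟩ := exists_shift_disjoint hd F
    have hmix := measure_cylinder_inter_shift p hz hS
    have htm : MeasurableSet (cylinder (α := fun _ : Edge d => Bool) F S) :=
      MeasurableSet.cylinder (α := fun _ : Edge d => Bool) F hS
    set t := cylinder (α := fun _ : Edge d => Bool) F S
    have hsd : P.real (symmDiff t s) ≤ ε := by
      rw [measureReal_def]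
      exact ENNReal.toReal_le_of_le_ofReal hε.le hts.le
    have hsub : symmDiff (t ∩ Config.shift z ⁻¹' t) s ⊆
        symmDiff t s ∪ Config.shift z ⁻¹' symmDiff t s := by
      rw [Set.preimage_symmDiff, hinv]
      intro ω hω
      simp only [Set.mem_symmDiff, Set.mem_inter_iff, Set.mem_union] at hω ⊢
      tauto
    have hsd2 : P.real (symmDiff (t ∩ Config.shift z ⁻¹' t) s) ≤ 2 * ε := by
      refine (measureReal_mono hsub).trans ((measureReal_union_le _ _).trans ?_)
      have : P.real (Config.shift z ⁻¹' symmDiff t s) = P.real (symmDiff t s) :=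
        (measurePreserving_shift p z).measureReal_preimage
          (htm.symmDiff hs).nullMeasurableSet
      rw [this]
      linarith
    have h1 := (abs_measureReal_sub_le_measureReal_symmDiff (μ := P)
      htm.nullMeasurableSet hs.nullMeasurableSet).trans hsd
    have h2 := (abs_measureReal_sub_le_measureReal_symmDiff (μ := P)
      (htm.inter (measurable_shift z htm)).nullMeasurableSet hs.nullMeasurableSet).trans hsd2
    have h3 : P.real (t ∩ Config.shift z ⁻¹' t) = P.real t * P.real t := by
      rw [measureReal_def, hmix, ENNReal.toReal_mul]
      rfl
    have h4 : |P.real t * P.real t - P.real s * P.real s| ≤ 2 * ε := by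
      have : P.real t * P.real t - P.real s * P.real s =
          (P.real t - P.real s) * (P.real t + P.real s) := by ring
      rw [this, abs_mul, mul_comm]
      have h5 : |P.real t + P.real s| ≤ 2 := by
        rw [abs_of_nonneg (by positivity)]
        linarith [measureReal_le_one (μ := P) (s := t), measureReal_le_one (μ := P) (s := s)]
      gcongr
    rw [h3] at h2
    rw [abs_le] at h2 h4 ⊢
    constructor <;> linarith [h2.1, h2.2, h4.1, h4.2]
  have h0 : P.real s - P.real s * P.real s = 0 := by
    refine abs_eq_zero.1 (le_antisymm (le_of_forall_pos_le_add fun ε hε => ?_) (abs_nonneg _))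
    have := key (ε / 4) (by positivity)
    linarith
  have h1 : P.real s * (1 - P.real s) = 0 := by linarith
  rcases mul_eq_zero.1 h1 with h | h
  · left
    rwa [measureReal_eq_zero_iff] at h
  · right
    have h2 : P.real s = 1 := by linarith
    rwa [measureReal_def, ENNReal.toReal_eq_one_iff] at h2

theorem percGraph_shift_adj (z : Vertex d) (ω : Config d) (x y : Vertex d) :
    (percGraph (Config.shift z ω)).Adj x y ↔ (percGraph ω).Adj (x + z) (y + z) := by
  constructor
  · rintro ⟨h, hω⟩
    exact ⟨lattice_adj_add z h, hω⟩
  · rintro ⟨h, hω⟩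
    have h' := lattice_adj_add (-z) h
    simp only [add_neg_cancel_right] at h'
    exact ⟨h', hω⟩

theorem percLaplacian_covariant (X : BoundaryCondition) (z : Vertex d) (ω : Config d) (φ : L2 d) :
    percLaplacian X (Config.shift z ω) φ =
      (translation z).symm (percLaplacian X ω (translation z φ)) := by
  rw [LinearIsometryEquiv.eq_symm_apply]
  exact (laplacian_translation X (percGraph_le _) (percGraph_le _) z φ
    fun x _ y => (percGraph_shift_adj z ω x y).symm).symm

theorem measurableSet_adj (x y : Vertex d) :
    MeasurableSet {ω : Config d | (percGraph ω).Adj x y} := by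
  by_cases h : (lattice d).Adj x y
  · have : {ω : Config d | (percGraph ω).Adj x y} = {ω | ω ⟨s(x, y), h⟩ = true} := by
      ext ω
      exact ⟨fun ⟨_, hω⟩ => hω, fun hω => ⟨h, hω⟩⟩
    rw [this]
    have hm : Measurable fun ω : Config d => ω ⟨s(x, y), h⟩ := measurable_pi_apply _
    exact hm (measurableSet_singleton true)
  · have : {ω : Config d | (percGraph ω).Adj x y} = ∅ :=
      Set.eq_empty_of_forall_notMem fun ω hω => h hω.1
    rw [this]
    exact MeasurableSet.empty

theorem measurable_percLaplacian_apply (X : BoundaryCondition) (φ : L2 d) (x : Vertex d) :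
    Measurable fun ω : Config d => percLaplacian X ω φ x := by
  classical
  have h : ∀ ω : Config d, percLaplacian X ω φ x =
      ((diagonal d X (∑ u ∈ units d, if (percGraph ω).Adj x (x + u) then 1 else 0) : ℝ) : ℂ) * φ x -
        ∑ u ∈ units d, if (percGraph ω).Adj x (x + u) then φ (x + u) else 0 := fun ω => by
    rw [percLaplacian, laplacian_apply, vertexDegree_eq_sum, sum_neighbors]
  simp only [h]
  refine Measurable.sub (Measurable.mul_const ?_ _) ?_
  · refine Complex.measurable_ofReal.comp ((measurable_of_countable (diagonal d X)).comp ?_)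
    exact Finset.measurable_sum _ fun u _ =>
      Measurable.ite (measurableSet_adj x (x + u)) measurable_const measurable_const
  · exact Finset.measurable_sum _ fun u _ =>
      Measurable.ite (measurableSet_adj x (x + u)) measurable_const measurable_const

theorem isErgodicRandomOperator_percLaplacian (hd : 1 ≤ d) (X : BoundaryCondition) (p : I) :
    IsErgodicRandomOperator (percMeasure d p) Config.shift translation
      (percLaplacian (d := d) X) where
  isSelfAdjoint ω := isSelfAdjoint_laplacian X (percGraph_le ω)
  measurable_inner φ ψ := measurable_of_hasSum
    (f := fun x ω => inner ℂ (φ x) (percLaplacian X ω ψ x))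
    (fun x => Measurable.inner measurable_const (measurable_percLaplacian_apply X ψ x))
    fun ω => lp.hasSum_inner φ (percLaplacian X ω ψ)
  shift_zero := Config.shift_zero
  shift_add := Config.shift_add
  measurePreserving := measurePreserving_shift p
  ergodic _ hs hinv := ergodic_shift hd p hs hinv
  covariant := percLaplacian_covariant X

/-- The configurations that agree with `η` on `F`. -/
def agreeSet (F : Finset (Edge d)) (η : Config d) : Set (Config d) := {ω | ∀ e ∈ F, ω e = η e}

theorem agreeSet_eq_pi (F : Finset (Edge d)) (η : Config d) :
    agreeSet F η = (F : Set (Edge d)).pi fun e => {η e} := rfl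

theorem measurableSet_agreeSet (F : Finset (Edge d)) (η : Config d) :
    MeasurableSet (agreeSet F η) := by
  rw [agreeSet_eq_pi]
  exact MeasurableSet.pi F.countable_toSet fun e _ => measurableSet_singleton _

theorem percMeasure_agreeSet_ne_zero {p : I} (hp0 : 0 < p) (hp1 : p < 1) (F : Finset (Edge d))
    (η : Config d) : percMeasure d p (agreeSet F η) ≠ 0 := by
  classical
  rw [agreeSet_eq_pi, percMeasure, Measure.infinitePi_pi _ fun e _ => measurableSet_singleton _,
    Finset.prod_ne_zero_iff]
  intro e _
  have h0 : (p : ℝ) ≠ 0 := (show (0 : ℝ) < p from hp0).ne'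
  have h1 : (1 : ℝ) - p ≠ 0 := (sub_pos.2 (show (p : ℝ) < 1 from hp1)).ne'
  have h0' : unitInterval.toNNReal p ≠ 0 := fun h => h0 (congrArg NNReal.toReal h)
  have h1' : unitInterval.toNNReal (unitInterval.symm p) ≠ 0 :=
    fun h => h1 (congrArg NNReal.toReal h)
  rw [bernoulliMeasure_apply p (measurableSet_singleton _)]
  cases η e <;> simp [h0', h1']

/-- Having infinitely many good translates is a shift-invariant event. By recurrence it contains
almost all of `agreeSet F η`, which has positive probability, so ergodicity gives probability one.
-/
theorem ae_infinite_agree (hd : 1 ≤ d) {p : I} (hp0 : 0 < p) (hp1 : p < 1)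
    (F : Finset (Edge d)) (η : Config d) :
    ∀ᵐ ω ∂(percMeasure d p), {z | Config.shift z ω ∈ agreeSet F η}.Infinite := by
  have hs := measurableSet_agreeSet F η
  set s := agreeSet F η
  let J : Set (Config d) := {ω | {z | Config.shift z ω ∈ s}.Infinite}
  have hJ : J = ⋂ B : Finset (Vertex d), ⋃ z : {z // z ∉ B}, Config.shift z.1 ⁻¹' s := by
    ext ω
    simp only [Set.mem_iInter, Set.mem_iUnion, Set.mem_preimage, Subtype.exists, exists_prop]
    constructor
    · intro h B
      obtain ⟨z, hz, hzB⟩ := h.exists_notMem_finset B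
      exact ⟨z, hzB, hz⟩
    · intro h hfin
      obtain ⟨z, hzB, hz⟩ := h hfin.toFinset
      exact hzB (hfin.mem_toFinset.2 hz)
  have hJm : MeasurableSet J := by
    rw [hJ]
    exact MeasurableSet.iInter fun B => MeasurableSet.iUnion fun z => measurable_shift z.1 hs
  have hJinv : ∀ w, Config.shift w ⁻¹' J = J := fun w => by
    ext ω
    have h1 : {z | Config.shift z (Config.shift w ω) ∈ s} =
        (fun z => z + w) ⁻¹' {z | Config.shift z ω ∈ s} := by
      ext z
      rw [Set.mem_preimage, Set.mem_ofPred_eq, Set.mem_ofPred_eq, Config.shift_add]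
    change {z | Config.shift z (Config.shift w ω) ∈ s}.Infinite ↔
      {z | Config.shift z ω ∈ s}.Infinite
    have h2 := (Equiv.addRight w).symm.image_eq_preimage_symm {z | Config.shift z ω ∈ s}
    rw [h1, show (fun z => z + w) ⁻¹' {z | Config.shift z ω ∈ s} = _ from h2.symm,
      Set.infinite_image_iff (Equiv.injective _).injOn]
  let e₀ : Vertex d := Pi.single ⟨0, hd⟩ 1
  have hrec := (measurePreserving_shift p e₀).conservative.ae_mem_imp_frequently_image_mem
    hs.nullMeasurableSet
  have hsJ : ∀ᵐ ω ∂(percMeasure d p), ω ∈ s → ω ∈ J := by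
    filter_upwards [hrec] with ω hω hωs
    have h1 := hω hωs
    rw [Nat.frequently_atTop_iff_infinite] at h1
    have hinj : Function.Injective fun n : ℕ => n • e₀ := fun m n hmn => by
      have := congrFun hmn ⟨0, hd⟩
      simpa [e₀] using this
    refine (h1.image hinj.injOn).mono ?_
    rintro _ ⟨n, hn, rfl⟩
    simp only [Set.mem_ofPred_eq, Config.shift_iterate] at hn
    exact hn
  rcases ergodic_shift hd p hJm hJinv with h0 | h1
  · refine absurd (le_antisymm ?_ bot_le) (percMeasure_agreeSet_ne_zero hp0 hp1 F η)
    exact (measure_mono_ae hsJ).trans h0.le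
  · exact (mem_ae_iff_prob_eq_one hJm).2 h1

theorem ae_forall_infinite_agree (hd : 1 ≤ d) {p : I} (hp0 : 0 < p) (hp1 : p < 1) :
    ∀ᵐ ω ∂(percMeasure d p), ∀ (F : Finset (Edge d)) (η : Config d),
      {z | Config.shift z ω ∈ agreeSet F η}.Infinite := by
  classical
  -- Only the values of `η` on `F` matter, and they are encoded by a finite set `T` of open bonds;
  -- this leaves countably many almost sure statements.
  have h : ∀ᵐ ω ∂(percMeasure d p), ∀ F T : Finset (Edge d),
      {z | Config.shift z ω ∈ agreeSet F fun e => decide (e ∈ T)}.Infinite :=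
    ae_all_iff.2 fun F => ae_all_iff.2 fun T => ae_infinite_agree hd hp0 hp1 F _
  filter_upwards [h] with ω hω F η
  refine (hω F (F.filter fun e => η e = true)).mono fun z hz e he => ?_
  rw [hz e he]
  cases h : η e <;> simp [he, h]

/-- Almost surely, every finitely supported vector has infinitely many translates on which the
Laplacian acts as for any prescribed configuration. -/
theorem ae_infinite_translation_intertwine (hd : 1 ≤ d) {p : I} (hp0 : 0 < p) (hp1 : p < 1)
    (X : BoundaryCondition) : ∀ᵐ ω ∂(percMeasure d p), ∀ (η : Config d) (φ : L2 d),
      {x | φ x ≠ 0}.Finite → {z | percLaplacian X ω (translation z φ) =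
        translation z (percLaplacian X η φ)}.Infinite := by
  filter_upwards [ae_forall_infinite_agree hd hp0 hp1] with ω hω η φ hφ
  -- All bonds with at least one end in the support must agree, so that the closed bonds at its
  -- boundary are reproduced too.
  have hF : {e : Edge d | ∃ x, φ x ≠ 0 ∧ x ∈ e.1}.Finite := by
    have h1 : (Set.image2 (fun x u => s(x, x + u)) {x | φ x ≠ 0} (units d : Set (Vertex d))).Finite :=
      hφ.image2 _ (units d).finite_toSet
    refine (h1.preimage Subtype.val_injective.injOn).subset ?_
    rintro ⟨e, he⟩ ⟨x, hx, hxe⟩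
    obtain ⟨y, rfl⟩ := hxe
    refine ⟨x, hx, y - x, ?_, by simp⟩
    exact (finite_unitVectors d).mem_toFinset.2 ((lattice_adj_iff x y).1 he)
  refine (hω hF.toFinset η).mono fun z hz => ?_
  refine laplacian_translation X (percGraph_le η) (percGraph_le ω) z φ fun x hx y => ?_
  rw [← percGraph_shift_adj]
  have key : ∀ h : (lattice d).Adj x y, Config.shift z ω ⟨s(x, y), h⟩ = η ⟨s(x, y), h⟩ :=
    fun h => hz _ (hF.mem_toFinset.2 ⟨x, hx, Sym2.mem_mk_left x y⟩)
  exact ⟨fun ⟨h, h'⟩ => ⟨h, (key h).symm.trans h'⟩, fun ⟨h, h'⟩ => ⟨h, (key h).trans h'⟩⟩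

end PercolationMeasure

/-! ### Finiteness of clusters in the subcritical phase. -/

section Clusters

variable {d : ℕ}

theorem measurableSet_reachable (x y : Vertex d) :
    MeasurableSet {ω : Config d | (percGraph ω).Reachable x y} := by
  -- `S n y` is the event that an open walk of exactly `n` bonds leads from `x` to `y`.
  let S : ℕ → Vertex d → Set (Config d) := fun n => n.rec (fun y => {_ω | y = x})
    fun _ R y => ⋃ z, R z ∩ {ω | (percGraph ω).Adj z y}
  have hS : ∀ n y, MeasurableSet (S n y) := fun n => by
    induction n with
    | zero => exact fun y => MeasurableSet.const _
    | succ n ih => exact fun y => MeasurableSet.iUnion fun z => (ih z).inter (measurableSet_adj z y)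
  have h : {ω : Config d | (percGraph ω).Reachable x y} = ⋃ n, S n y := by
    ext ω
    rw [Set.mem_ofPred_eq, SimpleGraph.reachable_iff_reflTransGen, Set.mem_iUnion]
    constructor
    · intro h
      induction h with
      | refl => exact ⟨0, rfl⟩
      | tail _ hadj ih =>
        obtain ⟨n, hn⟩ := ih
        exact ⟨n + 1, Set.mem_iUnion.2 ⟨_, hn, hadj⟩⟩
    · rintro ⟨n, hn⟩
      induction n generalizing y with
      | zero =>
        have : y = x := hn
        rw [this]
      | succ n ih =>
        obtain ⟨z, hz, hadj⟩ := Set.mem_iUnion.1 hn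
        exact (ih z hz).tail hadj
  rw [h]
  exact MeasurableSet.iUnion fun n => hS n y

theorem measurableSet_infinite_clusterOf (x : Vertex d) :
    MeasurableSet {ω : Config d | (clusterOf ω x).Infinite} := by
  have h : {ω : Config d | (clusterOf ω x).Infinite} =
      ⋂ B : Finset (Vertex d), ⋃ y : {y // y ∉ B}, {ω | (percGraph ω).Reachable x y} := by
    ext ω
    simp only [Set.mem_iInter, Set.mem_iUnion, Subtype.exists, exists_prop]
    constructor
    · intro h B
      obtain ⟨z, hz, hzB⟩ := Set.Infinite.exists_notMem_finset h B
      exact ⟨z, hzB, hz⟩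
    · intro h hfin
      obtain ⟨z, hzB, hz⟩ := h hfin.toFinset
      exact hzB (hfin.mem_toFinset.2 hz)
  rw [h]
  exact MeasurableSet.iInter fun B => MeasurableSet.iUnion fun y => measurableSet_reachable x y

theorem clusterOf_mono {ω ω' : Config d} (h : ω ≤ ω') (x : Vertex d) :
    clusterOf ω x ⊆ clusterOf ω' x := fun _ hy =>
  SimpleGraph.Reachable.mono (fun a b (hab : (percGraph ω).Adj a b) => by
    obtain ⟨h1, h2⟩ := hab
    exact ⟨h1, top_le_iff.1 (h2.ge.trans (h _))⟩) hy

/-- The bonds whose uniform mark is at most `p` are distributed as `p`-percolation. -/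
theorem map_threshold_eq_percMeasure (p : I) :
    (Measure.infinitePi fun _ : Edge d => (volume : Measure I)).map
      (fun u e => decide (u e ≤ p)) = percMeasure d p := by
  have hm : Measurable fun u : I => decide (u ≤ p) :=
    measurable_to_bool (by
      have : (fun u : I => decide (u ≤ p)) ⁻¹' {true} = Set.Iic p := by
        ext u
        simp
      rw [this]
      exact measurableSet_Iic)
  rw [Measure.infinitePi_map_pi _ (f := fun _ u => decide (u ≤ p)) fun _ => hm, percMeasure]
  congr 1
  ext1 e
  classical
  refine Measure.ext_of_singleton fun b => ?_
  rw [Measure.map_apply hm (measurableSet_singleton b),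
    bernoulliMeasure_apply p (measurableSet_singleton b)]
  cases b
  · have : (fun u : I => decide (u ≤ p)) ⁻¹' {false} = Set.Ioi p := by
      ext u
      simp
    rw [this, unitInterval.volume_Ioi]
    have h : ENNReal.ofReal (1 - (p : ℝ)) = unitInterval.toNNReal (unitInterval.symm p) :=
      congrArg ENNReal.ofNNReal (NNReal.eq (Real.coe_toNNReal _ (sub_nonneg.2 p.2.2)))
    simpa using h
  · have : (fun u : I => decide (u ≤ p)) ⁻¹' {true} = Set.Iic p := by
      ext u
      simp
    rw [this, unitInterval.volume_Iic]
    have h : ENNReal.ofReal (p : ℝ) = unitInterval.toNNReal p :=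
      congrArg ENNReal.ofNNReal (NNReal.eq (Real.coe_toNNReal _ p.2.1))
    simpa using h

/-- Monotone coupling: both measures arise by thresholding the same uniform marks, and more open
bonds can only enlarge a cluster. -/
theorem percMeasure_infinite_clusterOf_mono {p q : I} (hpq : p ≤ q) (x : Vertex d)
    (hq : percMeasure d q {ω | (clusterOf ω x).Infinite} = 0) :
    percMeasure d p {ω | (clusterOf ω x).Infinite} = 0 := by
  have hm : ∀ p : I, Measurable fun (u : Edge d → I) e => decide (u e ≤ p) := fun p =>
    measurable_pi_lambda _ fun e => measurable_to_bool (by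
      have : (fun u : Edge d → I => decide (u e ≤ p)) ⁻¹' {true} =
          (fun u => u e) ⁻¹' Set.Iic p := by
        ext u
        simp
      rw [this]
      exact measurable_pi_apply e measurableSet_Iic)
  rw [← map_threshold_eq_percMeasure, Measure.map_apply (hm _) (measurableSet_infinite_clusterOf x)]
    at hq ⊢
  refine measure_mono_null (fun u hu => ?_) hq
  refine Set.Infinite.mono (clusterOf_mono (fun e => ?_) x) hu
  change decide (u e ≤ p) ≤ decide (u e ≤ q)
  by_cases h : u e ≤ p
  · simp [h, h.trans hpq]
  · simp [h]

/-- The supremum supplies some `q > p` with finite cluster at the origin, the coupling brings this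
down to `p`, and shift invariance moves it to every vertex. -/
theorem ae_finite_clusterOf {p : I} (hp : (p : ℝ) < criticalProb d) :
    ∀ᵐ ω ∂(percMeasure d p), ∀ x, (clusterOf ω x).Finite := by
  -- On the empty set the real supremum is `0` by convention, which would contradict `0 ≤ p < p_c`.
  have hne : ((fun p : I => (p : ℝ)) ''
      {p | percMeasure d p {ω | (clusterOf ω 0).Infinite} = 0}).Nonempty := by
    by_contra h
    rw [Set.not_nonempty_iff_eq_empty] at h
    rw [criticalProb, h, Real.sSup_empty] at hp
    exact absurd hp (not_lt.2 p.2.1)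
  obtain ⟨_, ⟨q, hq, rfl⟩, hpq⟩ := exists_lt_of_lt_csSup hne hp
  have h0 : percMeasure d p {ω | (clusterOf ω 0).Infinite} = 0 :=
    percMeasure_infinite_clusterOf_mono (le_of_lt hpq) 0 hq
  refine ae_all_iff.2 fun x => ?_
  have h1 : {ω : Config d | (clusterOf ω x).Infinite} ⊆
      Config.shift x ⁻¹' {ω | (clusterOf ω 0).Infinite} := fun ω hω => by
    let f : percGraph (Config.shift x ω) ≃g percGraph ω :=
      ⟨Equiv.addRight x, fun {a b} => (percGraph_shift_adj x ω a b).symm⟩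
    have h2 : clusterOf (Config.shift x ω) 0 = (fun y => y + x) ⁻¹' clusterOf ω x := by
      ext y
      have h3 := f.reachable_iff (u := 0) (v := y)
      have h4 : f 0 = x := zero_add x
      rw [h4] at h3
      exact h3.symm
    change (clusterOf (Config.shift x ω) 0).Infinite
    rw [h2]
    exact hω.preimage fun y _ => ⟨y - x, sub_add_cancel y x⟩
  have h2 : percMeasure d p {ω | (clusterOf ω x).Infinite} = 0 := by
    refine measure_mono_null h1 ?_
    rw [(measurePreserving_shift p x).measure_preimage
      (measurableSet_infinite_clusterOf 0).nullMeasurableSet, h0]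
  filter_upwards [measure_eq_zero_iff_ae_notMem.1 h2] with ω hω
  exact Set.not_infinite.1 hω

end Clusters

/-! ### Spectrum, eigenvalues and multiplicities of the percolation Laplacians. -/

section MainTheorem

variable {d : ℕ}

/-- The standard Hilbert basis of `ℓ²(ℤ^d)`. -/
noncomputable def standardBasis (d : ℕ) : HilbertBasis (Vertex d) ℂ (L2 d) :=
  HilbertBasis.ofRepr (LinearIsometryEquiv.refl ℂ (L2 d))

/-- Truncated plane waves of the full lattice are moved into large fully open regions of `ω`, where
they remain approximate eigenvectors. -/
theorem spectrum_percLaplacian_eq (hd : 1 ≤ d) (X : BoundaryCondition) {ω : Config d}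
    (hω : ∀ (η : Config d) (φ : L2 d), {x | φ x ≠ 0}.Finite →
      {z | percLaplacian X ω (translation z φ) = translation z (percLaplacian X η φ)}.Infinite) :
    spectrum ℂ (percLaplacian X ω) = Complex.ofReal '' Set.Icc (0 : ℝ) (4 * d) := by
  refine (spectrum_laplacian_subset X (percGraph_le ω)).antisymm ?_
  rintro _ ⟨E, hE, rfl⟩
  refine mem_spectrum_of_approx_eigenvector _ _ fun ε hε => ?_
  obtain ⟨φ, hφ0, hfin, hle⟩ := exists_finite_support_approx_eigenvector hd X
    (percGraph_le fun _ => true) (fun x y h => ⟨h, rfl⟩) hE hε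
  obtain ⟨z, hz⟩ := (hω (fun _ => true) φ hfin).nonempty
  refine ⟨translation z φ, fun h => hφ0 ((translation z).map_eq_zero_iff.1 h), ?_⟩
  rw [show laplacian X (percGraph_le ω) (translation z φ) =
    translation z (laplacian X (percGraph_le fun _ => true) φ) from hz, ← map_smul, ← map_sub,
    LinearIsometryEquiv.norm_map, LinearIsometryEquiv.norm_map]
  exact hle

/-- The energies of the finitely supported eigenvectors on arbitrary bond configurations. -/
def localizedEnergies (d : ℕ) (X : BoundaryCondition) : Set ℝ :=
  {E | ∃ (η : Config d) (φ : L2 d), φ ≠ 0 ∧ {x | φ x ≠ 0}.Finite ∧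
    percLaplacian X η φ = (E : ℂ) • φ}

theorem mem_clusterOf_iff_of_adj {ω : Config d} (v : Vertex d) {x y : Vertex d}
    (h : (percGraph ω).Adj x y) : x ∈ clusterOf ω v ↔ y ∈ clusterOf ω v :=
  ⟨fun hx => SimpleGraph.Reachable.trans hx h.reachable,
    fun hy => SimpleGraph.Reachable.trans hy h.symm.reachable⟩

/-- Every `δ_x` is supported on the finite cluster of `x`, hence lies in `H_pp`, and these vectors
form a countable total family. -/
theorem spectralSubspace_percLaplacian_pp (X : BoundaryCondition) {ω : Config d}
    (hfin : ∀ x, (clusterOf ω x).Finite) :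
    spectralSubspace (percLaplacian X ω) .pp = ⊤ := by
  refine spectralSubspace_pp_eq_top (isSelfAdjoint_laplacian X (percGraph_le ω))
    (e := fun x : Vertex d => lp.single 2 x (1 : ℂ)) (fun ψ h => ?_) fun x => ?_
  · ext x
    exact (inner_single_one x ψ).symm.trans (h x)
  · refine mem_pp_of_restrictTo_eq X (percGraph_le ω) (C := clusterOf ω x)
      (fun a b => mem_clusterOf_iff_of_adj x) (hfin x) ?_
    ext y
    by_cases hy : y ∈ clusterOf ω x
    · exact restrictTo_of_mem hy _
    · rw [restrictTo_of_notMem hy, lp.single_apply, Pi.single_eq_of_ne]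
      rintro rfl
      exact hy (SimpleGraph.Reachable.refl _)

theorem eigenvector_infinite_multiplicity (X : BoundaryCondition) {ω : Config d}
    (hω : ∀ (η : Config d) (φ : L2 d), {x | φ x ≠ 0}.Finite →
      {z | percLaplacian X ω (translation z φ) = translation z (percLaplacian X η φ)}.Infinite)
    {E : ℝ} (hE : E ∈ localizedEnergies d X) :
    Module.End.HasEigenvalue (percLaplacian X ω : L2 d →ₗ[ℂ] L2 d) E ∧
      ¬ FiniteDimensional ℂ
        (Module.End.eigenspace (percLaplacian X ω : L2 d →ₗ[ℂ] L2 d) E) := by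
  obtain ⟨η, φ, hφ0, hfin, hη⟩ := hE
  have hinf := hω η φ hfin
  have hmem : ∀ z ∈ {z | percLaplacian X ω (translation z φ) =
      translation z (percLaplacian X η φ)}, translation z φ ∈
      Module.End.eigenspace (percLaplacian X ω : L2 d →ₗ[ℂ] L2 d) E := fun z hz => by
    rw [Module.End.mem_eigenspace_iff]
    refine Eq.trans hz ?_
    rw [hη, map_smul]
  refine ⟨?_, not_finiteDimensional_of_translation_mem hφ0 hfin hinf hmem⟩
  obtain ⟨z, hz⟩ := hinf.nonempty
  exact Module.End.hasEigenvalue_of_hasEigenvector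
    ⟨hmem z hz, fun h => hφ0 ((translation z).map_eq_zero_iff.1 h)⟩

/-- Cutting an eigenvector down to the cluster of a point where it does not vanish leaves a finitely
supported eigenvector with the same energy. -/
theorem mem_localizedEnergies_of_eigenvector (X : BoundaryCondition) {ω : Config d}
    (hfin : ∀ x, (clusterOf ω x).Finite) {E : ℝ} {φ : L2 d} (hφ : φ ≠ 0)
    (h : percLaplacian X ω φ = (E : ℂ) • φ) : E ∈ localizedEnergies d X := by
  obtain ⟨x, hx⟩ : ∃ x, φ x ≠ 0 := by
    by_contra! h0
    exact hφ (by ext x; exact h0 x)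
  have hxC : x ∈ clusterOf ω x := SimpleGraph.Reachable.refl x
  refine ⟨ω, restrictTo (clusterOf ω x) φ, fun h0 => hx ?_, ?_, ?_⟩
  · rw [← restrictTo_of_mem hxC φ, h0]
    rfl
  · refine (hfin x).subset fun y hy => ?_
    by_contra hyC
    exact hy (restrictTo_of_notMem hyC φ)
  · refine (laplacian_restrictTo X (percGraph_le ω)
      (fun a b => mem_clusterOf_iff_of_adj x) φ).trans ?_
    rw [show laplacian X (percGraph_le ω) φ = _ from h, map_smul]

theorem eigenvalues_percLaplacian (X : BoundaryCondition) {ω : Config d}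
    (hω : ∀ (η : Config d) (φ : L2 d), {x | φ x ≠ 0}.Finite →
      {z | percLaplacian X ω (translation z φ) = translation z (percLaplacian X η φ)}.Infinite)
    (hfin : ∀ x, (clusterOf ω x).Finite) :
    {E : ℂ | Module.End.HasEigenvalue (percLaplacian X ω : L2 d →ₗ[ℂ] L2 d) E} =
      Complex.ofReal '' localizedEnergies d X := by
  ext E
  constructor
  · intro hE
    obtain ⟨φ, hφ⟩ := Module.End.HasEigenvalue.exists_hasEigenvector hE
    have h1 : percLaplacian X ω φ = E • φ := hφ.apply_eq_smul
    have h2 : E ∈ spectrum ℂ (percLaplacian X ω) :=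
      mem_spectrum_of_approx_eigenvector _ _ fun ε hε => ⟨φ, hφ.2, by
        rw [h1, sub_self, norm_zero]
        positivity⟩
    obtain ⟨E, -, rfl⟩ := spectrum_laplacian_subset X (percGraph_le ω) h2
    exact ⟨E, mem_localizedEnergies_of_eigenvector X hfin hφ.2 h1, rfl⟩
  · rintro ⟨E, hE, rfl⟩
    exact (eigenvector_infinite_multiplicity X hω hE).1

theorem closure_localizedEnergies (hd : 1 ≤ d) (X : BoundaryCondition) {ω : Config d}
    (hω : ∀ (η : Config d) (φ : L2 d), {x | φ x ≠ 0}.Finite →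
      {z | percLaplacian X ω (translation z φ) = translation z (percLaplacian X η φ)}.Infinite)
    (hfin : ∀ x, (clusterOf ω x).Finite) :
    closure (localizedEnergies d X) = Set.Icc (0 : ℝ) (4 * d) := by
  have hspec := spectrum_percLaplacian_eq hd X hω
  have hA : IsSelfAdjoint (percLaplacian X ω) := isSelfAdjoint_laplacian X (percGraph_le ω)
  refine (closure_minimal (fun E hE => ?_) isClosed_Icc).antisymm fun E hE => ?_
  · have h1 : (E : ℂ) ∈ Complex.ofReal '' localizedEnergies d X := ⟨E, hE, rfl⟩
    rw [← eigenvalues_percLaplacian X hω hfin] at h1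
    obtain ⟨φ, hφ⟩ := Module.End.HasEigenvalue.exists_hasEigenvector h1
    have h2 : (E : ℂ) ∈ spectrum ℂ (percLaplacian X ω) :=
      mem_spectrum_of_approx_eigenvector _ _ fun ε hε => ⟨φ, hφ.2, by
        rw [show percLaplacian X ω φ = (E : ℂ) • φ from hφ.apply_eq_smul, sub_self, norm_zero]
        positivity⟩
    rw [hspec] at h2
    obtain ⟨E', hE', h3⟩ := h2
    rwa [← Complex.ofReal_injective h3]
  · rw [Metric.mem_closure_iff]
    intro ε hε
    -- A gap of `S` around a spectral value would contain the spectral measure of a nonzero vector;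
    -- being pure point, that measure has an atom, and the atom is an eigenvalue in the gap.
    by_contra! hcon
    have hmem : (E : ℂ) ∈ spectrum ℂ (percLaplacian X ω) := hspec ▸ ⟨E, hE, rfl⟩
    obtain ⟨φ, hφ⟩ := exists_spectralMeasure_ne_zero_of_mem_spectrum hA hmem hε
    obtain ⟨ψ, hψ, -⟩ := exists_spectralProjection hA φ (measurableSet_norm_sub_lt (E : ℂ) ε)
    refine ne_zero_of_spectralMeasure_eq_restrict hψ hφ
      (eq_zero_of_mem_pp_of_forall_singleton hA
        (spectralSubspace_percLaplacian_pp X hfin ▸ Submodule.mem_top : ψ ∈ _) fun x => ?_)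
    by_contra hx
    obtain ⟨χ, hχ0, hχ⟩ := exists_eigenvector_of_atom hA hx
    have h1 := hcon x (mem_localizedEnergies_of_eigenvector X hfin hχ0 hχ)
    rw [hψ, Measure.restrict_apply (measurableSet_singleton x)] at hx
    refine hx (measure_mono_null ?_ measure_empty)
    rintro y ⟨hy, hlt⟩
    have hy' : y = x := hy
    have hlt' : ‖(y : ℂ) - E‖ < ε := hlt
    rw [hy', ← Complex.ofReal_sub, Complex.norm_real, ← dist_eq_norm, dist_comm] at hlt'
    exact absurd hlt' (not_lt.2 h1)

end MainTheorem

end PercLap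


theorem mainTheorem4 (d : ℕ) (hd : 1 ≤ d) (X : BoundaryCondition) (p : unitInterval)
    (hp0 : 0 < p) (hp1 : p < 1) :
    IsErgodicRandomOperator (percMeasure d p) Config.shift translation (percLaplacian X) ∧
    (∀ᵐ ω ∂(percMeasure d p),
      spectrum ℂ (percLaplacian X ω) = Complex.ofReal '' Set.Icc (0 : ℝ) (4 * d)) ∧
    (∀ κ : SpectralType, ∃ T : Set ℝ, IsClosed T ∧ ∀ᵐ ω ∂(percMeasure d p),
      spectralComponent (percLaplacian X ω) κ = Complex.ofReal '' T) ∧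
    ((p : ℝ) < criticalProb d →
      ∃ S : Set ℝ, closure S = Set.Icc (0 : ℝ) (4 * d) ∧ ∀ᵐ ω ∂(percMeasure d p),
        spectralSubspace (percLaplacian X ω) .pp = ⊤ ∧
        spectralComponent (percLaplacian X ω) .pp =
          Complex.ofReal '' Set.Icc (0 : ℝ) (4 * d) ∧
        spectralComponent (percLaplacian X ω) .sc = ∅ ∧
        spectralComponent (percLaplacian X ω) .ac = ∅ ∧
        {E : ℂ | Module.End.HasEigenvalue (percLaplacian X ω : L2 d →ₗ[ℂ] L2 d) E} =
          Complex.ofReal '' S ∧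
        ∀ E : ℂ, Module.End.HasEigenvalue (percLaplacian X ω : L2 d →ₗ[ℂ] L2 d) E →
          ¬ FiniteDimensional ℂ
            (Module.End.eigenspace (percLaplacian X ω : L2 d →ₗ[ℂ] L2 d) E)) := by
  have hpattern := ae_infinite_translation_intertwine hd hp0 hp1 X
  have hergodic := isErgodicRandomOperator_percLaplacian hd X p
  refine ⟨hergodic, ?_, fun κ => hergodic.exists_spectralComponent_eq (standardBasis d) κ,
    fun hpc => ⟨localizedEnergies d X, ?_, ?_⟩⟩
  · filter_upwards [hpattern] with ω hω using spectrum_percLaplacian_eq hd X hω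
  · obtain ⟨ω, hω, hfin⟩ := (hpattern.and (ae_finite_clusterOf hpc)).exists
    exact closure_localizedEnergies hd X hω hfin
  · filter_upwards [hpattern, ae_finite_clusterOf hpc] with ω hω hfin
    have hA : IsSelfAdjoint (percLaplacian X ω) := isSelfAdjoint_laplacian X (percGraph_le ω)
    have hpp := spectralSubspace_percLaplacian_pp X hfin
    have heig := eigenvalues_percLaplacian X hω hfin
    refine ⟨hpp, ?_, spectralComponent_eq_empty hA hpp (by simp),
      spectralComponent_eq_empty hA hpp (by simp), heig, fun E hE => ?_⟩
    · rw [spectralComponent_eq_spectrum hA hpp, spectrum_percLaplacian_eq hd X hω]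
    · have hE' : E ∈ Complex.ofReal '' localizedEnergies d X := by
        rw [← heig]
        exact hE
      obtain ⟨E, hS, rfl⟩ := hE'
      exact (eigenvector_infinite_multiplicity X hω hS).2
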